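/- Let $M$ be a compact smooth manifold of dimension $n\ge 1$ with (possibly empty) boundary $\partial M$, and let $\varepsilon>0$. For $|t|<\varepsilon$ let $g(t)$ be smooth Riemannian metrics on $M$ depending differentiably on $t$, let $\eta:(-\varepsilon,\varepsilon)\times M\to\mathbb R$ be a smooth function, $\eta(t)=\eta(t,\cdot)$, and put $dm_t=e^{-\eta(t)}\,dV_{g(t)}$ and $$\bar L_t f=\Delta_{g(t)}f-g(t)(\nabla\eta(t),\nabla f),$$ where $\nabla$ is the gradient for $g(t)$ and $\Delta_{g(t)}=\operatorname{div}\nabla$. Let $\phi_1(t),\dots,\phi_m(t)\in C^\infty(M)$ and $\lambda_1(t),\dots,\lambda_m(t)\in\mathbb R$ depend differentiably on $t$ and satisfy, for all $|t|<\varepsilon$ and all $i,j$, $$-\bar L_t\phi_i(t)=\lambda_i(t)\phi_i(t)\ \text{ in } M,\qquad \phi_i(t)=0\ \text{ on }\partial M,\qquad \int_M\phi_i(t)\phi_j(t)\,dm_t=\delta_{ij},$$ and suppose that $\lambda_1(0)=\dots=\lambda_m(0)=\lambda$. (For $g(t)$ and $\phi_i(t)$, "differentiably" means that the difference quotients in $t$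 of the components $g_{kl}(t)$ in charts, respectively of $\phi_i(t)$, converge locally uniformly on the domain of the chart, respectively on $M$; this is the case, for instance, if they are $C^1$ in $(t,x)$.) Write $g=g(0)$, $dm=dm_0$, $L=\bar L_0$, $\phi_i=\phi_i(0)$, $H=\frac{d}{dt}\big|_{t=0}g(t)$, $\dot\eta=\frac{d}{dt}\big|_{t=0}\eta(t)$, and let $\langle T,S\rangle=\sum g^{ik}g^{jl}T_{ij}S_{kl}$ be the inner product induced by $g$ on $(0,2)$-tensors, $\langle\cdot,\cdot\rangle=g(\cdot,\cdot)$ on vectors. Then for all $i,j$ the two integrands below are integrable and the function $t\mapsto(\lambda_i(t)+\lambda_j(t))\delta_{ij}$ has at $t=0$ the derivative $$(\lambda_i+\lambda_j)'\delta_{ij}=\int_M\Big\langle\tfrac12 L(\phi_i\phi_j)\,g-2\,d\phi_i\otimes d\phi_j,\,H\Big\rangle\,dm+\int_M\langle\nabla\dot\eta,\nabla(\phi_i\phi_j)\rangle\,dm.$$ -/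

import Mathlib

open Set Filter Topology MeasureTheory
open scoped Manifold ContDiff

noncomputable section

namespace EtaLaplacian

/-- The model vector space `ℝⁿ`. -/
abbrev Model (n : ℕ) : Type := EuclideanSpace ℝ (Fin n)

/-- Smooth Riemannian metrics on a smooth `n`-manifold `M` (possibly with boundary, modelled on the
Euclidean half space): smooth sections of the bundle of bilinear forms on the tangent spaces which
are symmetric and positive definite at every point. -/
abbrev Metric (n : ℕ) [NeZero n] (M : Type*) [TopologicalSpace M]
    [ChartedSpace (EuclideanHalfSpace n) M] [IsManifold (𝓡∂ n) ∞ M] :=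
  Bundle.ContMDiffRiemannianMetric (𝓡∂ n) ∞ (Model n) (fun p : M => TangentSpace (𝓡∂ n) p)

variable {n : ℕ} [NeZero n] {M : Type*} [TopologicalSpace M]
  [ChartedSpace (EuclideanHalfSpace n) M] [IsManifold (𝓡∂ n) ∞ M]

/-! ### Pointwise tensor algebra -/

/-- The basis `e₁, …, eₙ` of the tangent space at `p` (the coordinate basis at `p` of the preferred
chart at `p`, in which Mathlib models the tangent space). It serves to compute traces and
contractions, none of which depends on the choice of a basis. -/
def frame (p : M) (i : Fin n) : TangentSpace (𝓡∂ n) p :=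
  (EuclideanSpace.single i (1 : ℝ) : Model n)

/-- The matrix `(g_{ij})` of the metric at `p` in the basis `frame p`. -/
def gram (g : Metric n M) (p : M) : Matrix (Fin n) (Fin n) ℝ :=
  Matrix.of fun i j => g.inner p (frame p i) (frame p j)

/-- The inner product `⟨T, S⟩ = ∑ g^{ik} g^{jl} T_{ij} S_{kl}` induced by `g` on the
`(0,2)`-tensors at `p`. -/
def tensorInner (g : Metric n M) (p : M)
    (T S : TangentSpace (𝓡∂ n) p → TangentSpace (𝓡∂ n) p → ℝ) : ℝ :=
  ∑ i, ∑ j, ∑ k, ∑ l, (gram g p)⁻¹ i k * (gram g p)⁻¹ j l *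
    T (frame p i) (frame p j) * S (frame p k) (frame p l)

/-- The differential `df` at `p`, as a covector. -/
def differential (f : M → ℝ) (p : M) (v : TangentSpace (𝓡∂ n) p) : ℝ :=
  mfderiv (𝓡∂ n) 𝓘(ℝ, ℝ) f p v

/-- The gradient `∇f = ∑ g^{ij} (∂_j f) e_i` of `f` with respect to `g`. -/
def riemannianGradient (g : Metric n M) (f : M → ℝ) (p : M) : TangentSpace (𝓡∂ n) p :=
  ∑ i, (∑ j, (gram g p)⁻¹ i j * differential f p (frame p j)) • frame p i

/-! ### Volume, divergence, Laplacian -/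

/-- The matrix `g_{ij} = g(∂_i, ∂_j)` of the metric in the preferred chart at `x₀`, as a function of
the coordinates `y`. The coordinate vector `∂_i` is the push-forward of the `i`-th standard basis
vector under the inverse chart. -/
def chartGram (g : Metric n M) (x₀ : M) (y : Model n) : Matrix (Fin n) (Fin n) ℝ :=
  Matrix.of fun i j => g.inner ((extChartAt (𝓡∂ n) x₀).symm y)
    (mfderivWithin 𝓘(ℝ, Model n) (𝓡∂ n) (extChartAt (𝓡∂ n) x₀).symm (range (𝓡∂ n)) y
      (EuclideanSpace.single i (1 : ℝ) : Model n))
    (mfderivWithin 𝓘(ℝ, Model n) (𝓡∂ n) (extChartAt (𝓡∂ n) x₀).symm (range (𝓡∂ n)) y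
      (EuclideanSpace.single j (1 : ℝ) : Model n))

/-- The Riemannian volume on the domain of the preferred chart at `x₀`: the measure
`√det(g_{ij}) dy¹ ⋯ dyⁿ`, transported to `M` by the inverse chart. -/
def chartVolume [MeasurableSpace M] (g : Metric n M) (x₀ : M) : Measure M :=
  (((volume : Measure (Model n)).restrict (extChartAt (𝓡∂ n) x₀).target).withDensity
    (fun y => ENNReal.ofReal (√(chartGram g x₀ y).det))).map (extChartAt (𝓡∂ n) x₀).symm

/-- The Riemannian volume measure `dV` of `g`. The measures `chartVolume g x₀` agree on overlaps of
charts, and the measure on `M` obtained by gluing them is their least upper bound. -/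
def riemannianVolume [MeasurableSpace M] (g : Metric n M) : Measure M :=
  ⨆ x₀ : M, chartVolume g x₀

/-- The weighted measure `dm = e^{-η} dV`. -/
def weightedVolume [MeasurableSpace M] (g : Metric n M) (η : M → ℝ) : Measure M :=
  (riemannianVolume g).withDensity (fun p => ENNReal.ofReal (Real.exp (-η p)))

/-- The divergence of a vector field `X` with respect to `g`, computed at `p` in the preferred chart
at `p` by `div X = (1 / √det g) ∑ ∂_i (√det g Xⁱ)` (the value does not depend on the chart). At
boundary points the partial derivatives are those within the half space. -/
def divergence (g : Metric n M) (X : (p : M) → TangentSpace (𝓡∂ n) p) (p : M) : ℝ :=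
  (√(chartGram g p (extChartAt (𝓡∂ n) p p)).det)⁻¹ *
    ∑ i, fderivWithin ℝ
      (fun y : Model n => √(chartGram g p y).det *
        (EuclideanSpace.proj i : Model n →L[ℝ] ℝ)
          (mfderiv (𝓡∂ n) 𝓘(ℝ, Model n) (extChartAt (𝓡∂ n) p) ((extChartAt (𝓡∂ n) p).symm y)
            (X ((extChartAt (𝓡∂ n) p).symm y))))
      (range (𝓡∂ n)) (extChartAt (𝓡∂ n) p p) (EuclideanSpace.single i (1 : ℝ))

/-- The Laplace-Beltrami operator `Δ f = div ∇f`. -/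
def laplacian (g : Metric n M) (f : M → ℝ) (p : M) : ℝ :=
  divergence g (riemannianGradient g f) p

/-- The `η`-Laplacian `L f = Δ f - g(∇η, ∇f)`. -/
def etaLaplacian (g : Metric n M) (η f : M → ℝ) (p : M) : ℝ :=
  laplacian g f p - g.inner p (riemannianGradient g η p) (riemannianGradient g f p)

/-! ### Families depending on a parameter -/

/-- The real functions `f t` on `s`, `t ∈ J`, depend differentiably on `t`: at every `t₀ ∈ J` the
difference quotients in `t` converge locally uniformly on `s`. -/
def DifferentiableFamily {X : Type*} [TopologicalSpace X] (J : Set ℝ) (f : ℝ → X → ℝ)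
    (s : Set X) : Prop :=
  ∀ t₀ ∈ J, ∃ D : X → ℝ,
    TendstoLocallyUniformlyOn (fun t x => slope (fun r => f r x) t₀ t) D (𝓝[≠] t₀) s

/-- The metrics `g t`, `t ∈ J`, depend differentiably on `t`: so do their components `g_{ij}(t)` in
the charts. -/
def DifferentiableVariation (J : Set ℝ) (g : ℝ → Metric n M) : Prop :=
  ∀ (x₀ : M) (i j : Fin n),
    DifferentiableFamily J (fun t y => chartGram (g t) x₀ y i j) (extChartAt (𝓡∂ n) x₀).target

/-- The `(0,2)`-tensor `H = d/dt|_{t=0} g(t)`. -/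
def metricVelocity (g : ℝ → Metric n M) (p : M) (v w : TangentSpace (𝓡∂ n) p) : ℝ :=
  deriv (fun t => (g t).inner p v w) 0

/-- The function `d/dt|_{t=0} η(t)`. -/
def weightVelocity (η : ℝ → M → ℝ) (p : M) : ℝ :=
  deriv (fun t => η t p) 0

end EtaLaplacian

end

open EtaLaplacian

/-! The eigenvalue equation is differentiated in its weak form. Let `ρ t` be the density of `dm_t`
with respect to `dm = dm_0`, and `⟨·,·⟩_t` the inner product of covectors given by `g t`. Green's
formula (`integral_green`) gives, for every smooth `ψ` vanishing on the boundary, `∫ ρ t ⟨dφ t,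
dψ⟩_t dm = λ(t) ∫ ρ t φ t ψ dm`. Take `ψ = φ_j(0)` and `φ = φ_i`. Since `ψ` is itself an
eigenfunction at time `0` for the same `λ`, also `∫ ⟨dφ t, dψ⟩_0 dm = λ ∫ φ t ψ dm`. Subtract and
divide by `t`: only `ρ t`, `⟨·,·⟩_t` and `λ(t)` are differenced. This matters because the hypotheses
control the difference quotients of `φ t` but not those of `dφ t`.

With `ρ' = tr H / 2 - η̇` and `(ρ ⟨du, dv⟩)' = ρ' ⟨du, dv⟩ - H(∇u, ∇v)`, the limit is `λ_i' δ_ij + λ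
∫ ρ' φ_i φ_j = ∫ (ρ' ⟨dφ_i, dφ_j⟩ - H(∇φ_i, ∇φ_j))` (`IsEigenfamily.deriv_mul_integral`). Doubling
it, and inserting `L(φ_i φ_j) / 2 = ⟨dφ_i, dφ_j⟩ - λ φ_i φ_j` together with an integration by parts
of the `η̇` terms (`integral_cometric_mul_of_eigen`), yields the formula.

The delicate point of the limit is that `dφ t` still occurs in it. The remainder with `φ t - φ 0` in
place of `φ t` is bounded by a constant times the `L¹` norm of `|d(φ t - φ 0)|`, because the two
Dirichlet forms differ by `O(t)` relative to `g 0` (`exists_weightRatio_bound`). It tends to `0`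
because `φ t → φ 0` in energy (`IsEigenfamily.tendsto_energy`): the energy of `φ t` is close to
`λ(t)`, hence to `λ`, and the mixed energy of `φ t` and `φ 0` is `λ ∫ φ t φ 0`, which also tends to
`λ`.

The `O(t)` estimates are made in `g 0`-orthonormal frames, where `g 0` is the identity and the
constants do not depend on the point; compactness makes them uniform. Green's formula reduces by a
partition of unity to the divergence theorem on a half space. This uses that Laplacian and volume
have the same expression in every chart; for the Laplacian that is the Piola identity
(`sum_fderiv_piola`). -/

set_option linter.unusedSectionVars false

namespace EtaLaplacian

/-! ### Derivatives of determinants and inverses -/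

section MatrixCalculus

variable {ι : Type*} [Fintype ι] [DecidableEq ι]

/-- Jacobi's formula. In the Leibniz expansion, the terms with the factor from row `i`
differentiated add up to the determinant with row `i` replaced by that of `A'`; cofactor expansion
along this row produces the trace. -/
theorem hasDerivAt_det {A : ℝ → Matrix ι ι ℝ} {A' : Matrix ι ι ℝ} {t : ℝ}
    (h : ∀ i j, HasDerivAt (fun s => A s i j) (A' i j) t) :
    HasDerivAt (fun s => (A s).det) ((A t).adjugate * A').trace t := by
  have key : ∀ i, ((A t).updateRow i (A' i)).det = ∑ j, (A t).adjugate j i * A' i j := by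
    intro i
    rw [Matrix.det_eq_sum_mul_adjugate_row _ i]
    refine Finset.sum_congr rfl fun j _ => ?_
    rw [Matrix.updateRow_self, mul_comm]
    congr 1
    rw [Matrix.adjugate_apply, Matrix.adjugate_apply, Matrix.updateRow_idem]
  have h2 : ((A t).adjugate * A').trace = ∑ i, ((A t).updateRow i (A' i)).det := by
    simp_rw [key, Matrix.trace, Matrix.diag, Matrix.mul_apply]
    rw [Finset.sum_comm]
  rw [h2]
  have h3 : ∀ B : Matrix ι ι ℝ, B.det = ∑ σ : Equiv.Perm ι, (Equiv.Perm.sign σ : ℝ) *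
      ∏ i, B i (σ i) := by
    intro B
    rw [← Matrix.det_transpose, Matrix.det_apply']
    simp
  simp_rw [h3]
  rw [Finset.sum_comm]
  refine HasDerivAt.fun_sum fun σ _ => ?_
  rw [← Finset.mul_sum]
  refine HasDerivAt.const_mul _ ?_
  have := HasDerivAt.fun_finsetProd (u := Finset.univ) (x := t)
    (f := fun i s => A s i (σ i)) (f' := fun i => A' i (σ i)) (fun i _ => h i (σ i))
  convert this using 1
  refine Finset.sum_congr rfl fun i _ => ?_
  rw [← Finset.mul_prod_erase _ _ (Finset.mem_univ i)]
  simp only [Matrix.updateRow_self, smul_eq_mul]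
  rw [mul_comm]
  congr 1
  refine Finset.prod_congr rfl fun j hj => ?_
  rw [Matrix.updateRow_ne (Finset.ne_of_mem_erase hj)]

theorem contDiffWithinAt_det {F : Type*} [NormedAddCommGroup F] [NormedSpace ℝ F] {k : ℕ∞ω}
    {A : F → Matrix ι ι ℝ} {s : Set F} {x : F}
    (h : ∀ i j, ContDiffWithinAt ℝ k (fun y => A y i j) s x) :
    ContDiffWithinAt ℝ k (fun y => (A y).det) s x := by
  simp_rw [Matrix.det_apply']
  refine ContDiffWithinAt.sum fun σ _ => contDiffWithinAt_const.mul ?_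
  exact contDiffWithinAt_prod fun i _ => h _ _

/-- Cramer's rule: an entry of the adjugate is the determinant of the matrix with one row replaced
by a constant one. -/
theorem contDiffWithinAt_inv_entry {F : Type*} [NormedAddCommGroup F] [NormedSpace ℝ F] {k : ℕ∞ω}
    {A : F → Matrix ι ι ℝ} {s : Set F} {x : F}
    (h : ∀ i j, ContDiffWithinAt ℝ k (fun y => A y i j) s x) (hx : (A x).det ≠ 0) (i j : ι) :
    ContDiffWithinAt ℝ k (fun y => (A y)⁻¹ i j) s x := by
  simp only [Matrix.inv_def, Matrix.smul_apply, smul_eq_mul, Ring.inverse_eq_inv]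
  refine ((contDiffWithinAt_det h).inv hx).mul ?_
  simp_rw [Matrix.adjugate_apply]
  refine contDiffWithinAt_det fun a b => ?_
  by_cases ha : a = j
  · subst ha; simp only [Matrix.updateRow_self]; exact contDiffWithinAt_const
  · simp only [Matrix.updateRow_ne ha]; exact h a b

/-- The difference quotient of the inverse is `-A(s)⁻¹ ((A(s) - A(t)) / (s - t)) A(t)⁻¹`, so only
continuity of the inverse is needed, and Cramer's rule supplies it. -/
theorem hasDerivAt_inv_entry {A : ℝ → Matrix ι ι ℝ} {A' : Matrix ι ι ℝ} {t : ℝ}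
    (h : ∀ i j, HasDerivAt (fun s => A s i j) (A' i j) t) (ht : (A t).det ≠ 0) (i j : ι) :
    HasDerivAt (fun s => (A s)⁻¹ i j) (-((A t)⁻¹ * A' * (A t)⁻¹) i j) t := by
  have hdet : ContinuousAt (fun s => (A s).det) t := (hasDerivAt_det h).continuousAt
  have hA : Tendsto A (𝓝 t) (𝓝 (A t)) :=
    tendsto_pi_nhds.2 fun i => tendsto_pi_nhds.2 fun j => (h i j).continuousAt
  have hinv : Tendsto (fun s => (A s)⁻¹) (𝓝 t) (𝓝 (A t)⁻¹) := by
    simp_rw [Matrix.inv_def, Ring.inverse_eq_inv]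
    refine (hdet.tendsto.inv₀ ht).smul ?_
    exact (Continuous.matrix_adjugate continuous_id).continuousAt.tendsto.comp hA
  have hS : Tendsto (fun s => (s - t)⁻¹ • (A s - A t)) (𝓝[≠] t) (𝓝 A') := by
    refine tendsto_pi_nhds.2 fun i => tendsto_pi_nhds.2 fun j => ?_
    have := hasDerivAt_iff_tendsto_slope.1 (h i j)
    simpa [slope_fun_def] using this
  rw [hasDerivAt_iff_tendsto_slope]
  have hlim : Tendsto (fun s => -((A s)⁻¹ * ((s - t)⁻¹ • (A s - A t)) * (A t)⁻¹)) (𝓝[≠] t)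
      (𝓝 (-((A t)⁻¹ * A' * (A t)⁻¹))) :=
    (((hinv.mono_left nhdsWithin_le_nhds).mul hS).mul tendsto_const_nhds).neg
  have hlim2 := tendsto_pi_nhds.1 (tendsto_pi_nhds.1 hlim i) j
  refine hlim2.congr' ?_
  filter_upwards [nhdsWithin_le_nhds (hdet.eventually_ne ht)] with s hs
  have e : -((A s)⁻¹ * ((s - t)⁻¹ • (A s - A t)) * (A t)⁻¹)
      = (s - t)⁻¹ • ((A s)⁻¹ - (A t)⁻¹) := by
    rw [Matrix.mul_smul, Matrix.smul_mul, ← smul_neg, Matrix.mul_sub, Matrix.sub_mul,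
      Matrix.nonsing_inv_mul _ (isUnit_iff_ne_zero.2 hs), Matrix.mul_assoc,
      Matrix.mul_nonsing_inv _ (isUnit_iff_ne_zero.2 ht)]
    simp
  rw [e]
  simp [slope, Matrix.smul_apply]

/-- `A ↦ √(det A)` and `A ↦ √(det A) A⁻¹` are Lipschitz near the identity. -/
theorem exists_lipschitz_sqrt_det_inv [Nonempty ι] :
    ∃ K > 0, ∃ r > 0, ∀ (A : Matrix ι ι ℝ) (s : ℝ), s ≤ r →
      (∀ a b, |A a b - (1 : Matrix ι ι ℝ) a b| ≤ s) →
        |√A.det - 1| ≤ K * s ∧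
        ∀ a b, |√A.det * A⁻¹ a b - (1 : Matrix ι ι ℝ) a b| ≤ K * s := by
  -- On `ι → ι → ℝ` with the sup norm the entrywise hypothesis reads `‖A - 1‖ ≤ s`.
  set F : (ι → ι → ℝ) → ℝ := fun A => √(Matrix.of A).det with hF
  set G : ι → ι → (ι → ι → ℝ) → ℝ := fun a b A => F A * (Matrix.of A)⁻¹ a b with hG
  set e : ι → ι → ℝ := fun a b => (1 : Matrix ι ι ℝ) a b with he
  have hcoord : ∀ i j, ContDiffWithinAt ℝ 1 (fun y : ι → ι → ℝ => Matrix.of y i j)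
      univ e := fun i j => by
    have : ContDiff ℝ 1 (fun y : ι → ι → ℝ => y i j) := by fun_prop
    exact this.contDiffAt
  have he1 : Matrix.of e = 1 := rfl
  have hdet1 : (Matrix.of e).det = 1 := by rw [he1, Matrix.det_one]
  have hFd : ContDiffWithinAt ℝ 1 F univ e :=
    (contDiffWithinAt_det hcoord).sqrt (by rw [hdet1]; exact one_ne_zero)
  have hGd : ∀ a b, ContDiffWithinAt ℝ 1 (G a b) univ e := fun a b =>
    hFd.mul (contDiffWithinAt_inv_entry hcoord (by rw [hdet1]; exact one_ne_zero) a b)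
  have lip : ∀ H : (ι → ι → ℝ) → ℝ, ContDiffWithinAt ℝ 1 H univ e →
      ∃ K > 0, ∀ᶠ A in 𝓝 e, |H A - H e| ≤ K * ‖A - e‖ := by
    intro H hH
    have h1 : DifferentiableAt ℝ H e :=
      ((contDiffWithinAt_univ.1 hH).differentiableAt one_ne_zero)
    obtain ⟨K, hK, h2⟩ := h1.isBigO_sub.exists_pos
    exact ⟨K, hK, by simpa using h2.bound⟩
  obtain ⟨K₀, hK₀, h₀⟩ := lip F hFd
  choose K₁ hK₁ h₁ using fun a b => lip (G a b) (hGd a b)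
  have hall : ∀ᶠ A in 𝓝 e, |F A - F e| ≤ K₀ * ‖A - e‖ ∧
      ∀ a b, |G a b A - G a b e| ≤ K₁ a b * ‖A - e‖ :=
    h₀.and (eventually_all.2 fun a => eventually_all.2 fun b => h₁ a b)
  obtain ⟨r, hr, hr'⟩ := Metric.eventually_nhds_iff.1 hall
  have hsum : ∀ a b, K₁ a b ≤ ∑ a, ∑ b, K₁ a b := fun a b =>
    (Finset.single_le_sum (f := fun b => K₁ a b) (fun b _ => (hK₁ a b).le)
      (Finset.mem_univ b)).trans
    (Finset.single_le_sum (f := fun a => ∑ b, K₁ a b)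
      (fun a _ => Finset.sum_nonneg fun b _ => (hK₁ a b).le) (Finset.mem_univ a))
  have hs0 : 0 ≤ ∑ a, ∑ b, K₁ a b :=
    Finset.sum_nonneg fun a _ => Finset.sum_nonneg fun b _ => (hK₁ a b).le
  -- Half the radius: the entries are bounded non-strictly by `s ≤ r / 2`, while the ball of radius
  -- `r` is open.
  refine ⟨K₀ + ∑ a, ∑ b, K₁ a b, by positivity, r / 2, by positivity, fun A s hs hA => ?_⟩
  have hFe : F e = 1 := by simp [hF, hdet1]
  have hGe : ∀ a b, G a b e = e a b := fun a b => by
    simp only [hG, hFe, he1, one_mul, inv_one]; rfl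
  obtain ⟨a₀⟩ := ‹Nonempty ι›
  have hs00 : 0 ≤ s := (abs_nonneg _).trans (hA a₀ a₀)
  have hnorm : ‖(fun a b => A a b) - e‖ ≤ s := by
    rw [pi_norm_le_iff_of_nonneg hs00]
    intro a
    rw [pi_norm_le_iff_of_nonneg hs00]
    intro b
    exact hA a b
  have hd : dist (fun a b => A a b) e < r := by
    rw [dist_eq_norm]; linarith
  obtain ⟨g1, g2⟩ := hr' hd
  constructor
  · rw [hFe] at g1
    refine g1.trans ?_
    gcongr
    linarith
  · intro a b
    have := g2 a b
    rw [hGe] at this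
    refine this.trans ?_
    gcongr
    linarith [hsum a b]

end MatrixCalculus

end EtaLaplacian

namespace EtaLaplacian

/-! ### The divergence theorem on the half space -/

section EuclideanCalculus

/-- Piola identity: `div (|det J| J⁻¹ (W ∘ σ)) = |det J| (div W) ∘ σ` when `J` is the Jacobian of
`σ`. The terms in which `W` is not differentiated come from the determinant and from the inverse;
they cancel because second derivatives of `σ` commute. -/
theorem sum_fderiv_piola {n : ℕ} {J : Model n → Matrix (Fin n) (Fin n) ℝ} {σ : Model n → Model n}
    {L : Model n →L[ℝ] Model n} {W : Fin n → Model n → ℝ} {z : Model n}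
    (hJ : ∀ k l, DifferentiableAt ℝ (fun y => J y k l) z)
    (hsymm : ∀ k l i, fderiv ℝ (fun y => J y k l) z (EuclideanSpace.single i 1) =
      fderiv ℝ (fun y => J y k i) z (EuclideanSpace.single l 1))
    (hdet : (J z).det ≠ 0) (hσ : HasFDerivAt σ L z)
    (hL : ∀ i k, L (EuclideanSpace.single i 1) k = J z k i)
    (hW : ∀ k, DifferentiableAt ℝ (W k) (σ z))
    (hV : ∀ i, DifferentiableAt ℝ
      (fun y => |(J y).det| * ∑ k, (J y)⁻¹ i k * W k (σ y)) z) :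
    ∑ i, fderiv ℝ (fun y => |(J y).det| * ∑ k, (J y)⁻¹ i k * W k (σ y)) z
        (EuclideanSpace.single i 1) =
      |(J z).det| * ∑ k, fderiv ℝ (W k) (σ z) (EuclideanSpace.single k 1) := by
  set B : Fin n → Matrix (Fin n) (Fin n) ℝ := fun i => Matrix.of fun k l =>
    fderiv ℝ (fun y => J y k l) z (EuclideanSpace.single i 1) with hB
  have hBs : ∀ i k l, B i k l = B l k i := fun i k l => hsymm k l i
  have line : ∀ (v : Model n), HasDerivAt (fun s : ℝ => z + s • v) v 0 := fun v => by
    simpa using ((hasDerivAt_id (0 : ℝ)).smul_const v).const_add z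
  have along : ∀ {H : Model n → ℝ} (v : Model n), DifferentiableAt ℝ H z →
      HasDerivAt (fun s : ℝ => H (z + s • v)) (fderiv ℝ H z v) 0 := fun {H} v hH => by
    have h1 : HasFDerivAt H (fderiv ℝ H z) (z + (0 : ℝ) • v) := by simpa using hH.hasFDerivAt
    exact h1.comp_hasDerivAt (0 : ℝ) (line v)
  have hi : ∀ i, fderiv ℝ (fun y => |(J y).det| * ∑ k, (J y)⁻¹ i k * W k (σ y)) z
      (EuclideanSpace.single i 1) =
      |(J z).det| * (((J z)⁻¹ * B i).trace * ∑ k, (J z)⁻¹ i k * W k (σ z)) +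
      |(J z).det| * ∑ k, (-((J z)⁻¹ * B i * (J z)⁻¹) i k * W k (σ z) +
        (J z)⁻¹ i k * ∑ l, fderiv ℝ (W k) (σ z) (EuclideanSpace.single l 1) * J z l i) := by
    intro i
    set v : Model n := EuclideanSpace.single i 1 with hv
    have hA : ∀ k l, HasDerivAt (fun s : ℝ => J (z + s • v) k l) (B i k l) 0 :=
      fun k l => along v (hJ k l)
    have z0 : z + (0 : ℝ) • v = z := by simp
    have hd := hasDerivAt_det hA
    have hdet0 : (J (z + (0 : ℝ) • v)).det ≠ 0 := by rwa [z0]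
    have hinv := fun k => hasDerivAt_inv_entry hA hdet0 i k
    -- Orientation plays no role: `sign (det J)` times the adjugate is `|det J| J⁻¹` for either
    -- sign.
    have habs : HasDerivAt (fun s : ℝ => |(J (z + s • v)).det|)
        (|(J z).det| * ((J z)⁻¹ * B i).trace) 0 := by
      have h1 := (hasDerivAt_abs hdet0).comp (0 : ℝ) hd
      refine h1.congr_deriv ?_
      rw [z0, Matrix.inv_def, Ring.inverse_eq_inv, Matrix.smul_mul, Matrix.trace_smul, smul_eq_mul,
        ← mul_assoc]
      congr 1
      rcases lt_or_gt_of_ne hdet with h | h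
      · rw [abs_of_neg h]; simp [h]
        field_simp
      · rw [abs_of_pos h]; simp [h]
        field_simp
    have hw : ∀ k, HasDerivAt (fun s : ℝ => W k (σ (z + s • v)))
        (∑ l, fderiv ℝ (W k) (σ z) (EuclideanSpace.single l 1) * J z l i) 0 := by
      intro k
      have h1 : HasFDerivAt (fun y => W k (σ y)) ((fderiv ℝ (W k) (σ z)).comp L) z :=
        (hW k).hasFDerivAt.comp z hσ
      have h2 := along v h1.differentiableAt
      rw [h1.fderiv] at h2
      refine h2.congr_deriv ?_
      have : L v = ∑ l, J z l i • EuclideanSpace.single l (1 : ℝ) := by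
        ext m
        simp [hv, hL, Pi.single_apply]
      simp [this, mul_comm]
    have hs := habs.fun_mul (HasDerivAt.fun_sum (u := Finset.univ) fun k _ => (hinv k).fun_mul (hw k))
    refine ((along v (hV i)).unique hs).trans ?_
    simp only [z0]
    ring
  rw [Finset.sum_congr rfl fun i _ => hi i, Finset.sum_add_distrib, ← Finset.mul_sum,
    ← Finset.mul_sum, ← mul_add]
  congr 1
  simp only [Finset.sum_add_distrib, neg_mul, Finset.sum_neg_distrib]
  -- The cancellation: the symmetry `hBs` exchanges the direction of differentiation with a column
  -- index, which turns the trace term into the term coming from the inverse.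
  have e1 : ∑ i, ((J z)⁻¹ * B i).trace * ∑ k, (J z)⁻¹ i k * W k (σ z) =
      ∑ i, ∑ k, ((J z)⁻¹ * B i * (J z)⁻¹) i k * W k (σ z) := by
    simp_rw [Finset.mul_sum]
    rw [Finset.sum_comm, Finset.sum_comm (f := fun i k => ((J z)⁻¹ * B i * (J z)⁻¹) i k * W k (σ z))]
    refine Finset.sum_congr rfl fun k _ => ?_
    simp_rw [← mul_assoc, ← Finset.sum_mul]
    congr 1
    simp_rw [Matrix.mul_apply (M := (J z)⁻¹ * B _) (N := (J z)⁻¹)]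
    rw [Finset.sum_comm]
    refine Finset.sum_congr rfl fun b _ => ?_
    rw [← Finset.sum_mul]
    congr 1
    simp_rw [Matrix.trace, Matrix.diag, Matrix.mul_apply]
    exact Finset.sum_congr rfl fun a _ => Finset.sum_congr rfl fun c _ => by rw [hBs]
  have e2 : ∑ i, ∑ k, (J z)⁻¹ i k *
      ∑ l, fderiv ℝ (W k) (σ z) (EuclideanSpace.single l 1) * J z l i =
      ∑ k, fderiv ℝ (W k) (σ z) (EuclideanSpace.single k 1) := by
    rw [Finset.sum_comm]
    refine Finset.sum_congr rfl fun k _ => ?_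
    simp_rw [Finset.mul_sum]
    rw [Finset.sum_comm]
    have : ∀ l, ∑ i, (J z)⁻¹ i k * (fderiv ℝ (W k) (σ z) (EuclideanSpace.single l 1) * J z l i) =
        fderiv ℝ (W k) (σ z) (EuclideanSpace.single l 1) * (1 : Matrix (Fin n) (Fin n) ℝ) l k := by
      intro l
      rw [← Matrix.mul_nonsing_inv (J z) (isUnit_iff_ne_zero.2 hdet), Matrix.mul_apply,
        Finset.mul_sum]
      exact Finset.sum_congr rfl fun i _ => by ring
    simp [this, Matrix.one_apply]
  rw [e1, e2]
  ring

/-- Divergence theorem on the box `[0, S] × [-S, S]^(n-1)`. The face in the boundary hyperplane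
contributes nothing since the field vanishes there; the other faces lie outside the ball of radius
`R`, where it vanishes as well. -/
theorem integral_divergence_halfSpace {n : ℕ} [NeZero n] (V : Fin n → Model n → ℝ) (R : ℝ)
    (hR : ∀ i y, 0 ≤ y 0 → R < ‖y‖ → V i y = 0)
    (hc : ∀ i, ContinuousOn (V i) {y : Model n | 0 ≤ y 0})
    (h0 : ∀ i y, y 0 = 0 → V i y = 0)
    (hd : ∀ i y, 0 < y 0 → DifferentiableAt ℝ (V i) y)
    (hint : IntegrableOn (fun y => ∑ i, fderiv ℝ (V i) y (EuclideanSpace.single i 1))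
      {y : Model n | 0 < y 0}) :
    ∫ y in {y : Model n | 0 < y 0}, ∑ i, fderiv ℝ (V i) y (EuclideanSpace.single i 1) = 0 := by
  obtain ⟨k, rfl⟩ : ∃ k, n = k + 1 := ⟨n - 1, (Nat.succ_pred_eq_of_ne_zero (NeZero.ne n)).symm⟩
  set D : Model (k + 1) → ℝ := fun y => ∑ i, fderiv ℝ (V i) y (EuclideanSpace.single i 1) with hD
  -- The maximum with `0` keeps the box nondegenerate even for negative `R`.
  set S : ℝ := max R 0 + 1 with hS
  have hSpos : 0 < S := by positivity
  have hRS : R < S := by rw [hS]; linarith [le_max_left R 0]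
  have hD0 : ∀ y : Model (k + 1), 0 < y 0 → R < ‖y‖ → D y = 0 := by
    intro y hy hyR
    refine Finset.sum_eq_zero fun i _ => ?_
    have : V i =ᶠ[𝓝 y] fun _ => 0 := by
      have c0 : ContinuousAt (fun y : Model (k + 1) => y 0) y := by fun_prop
      filter_upwards [c0.eventually (lt_mem_nhds hy),
        continuous_norm.continuousAt.eventually (lt_mem_nhds hyR)] with w h1 h2
      exact hR i w h1.le h2
    rw [this.fderiv_eq]
    simp
  set T : (Fin (k + 1) → ℝ) → Model (k + 1) := fun x => WithLp.toLp 2 x with hT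
  have hTL : ∀ x, HasFDerivAt T ((PiLp.continuousLinearEquiv 2 ℝ
      (fun _ : Fin (k + 1) => ℝ)).symm : (Fin (k + 1) → ℝ) →L[ℝ] Model (k + 1)) x := fun x =>
    ((PiLp.continuousLinearEquiv 2 ℝ (fun _ : Fin (k + 1) => ℝ)).symm :
      (Fin (k + 1) → ℝ) →L[ℝ] Model (k + 1)).hasFDerivAt
  set a : Fin (k + 1) → ℝ := fun i => if i = 0 then 0 else -S with ha
  set b : Fin (k + 1) → ℝ := fun _ => S with hb
  have hab : a ≤ b := by
    intro i; simp only [ha, hb]; split_ifs <;> linarith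
  have mp : MeasurePreserving T := PiLp.volume_preserving_toLp (Fin (k + 1))
  have me : MeasurableEmbedding T := (MeasurableEquiv.toLp 2 (Fin (k + 1) → ℝ)).measurableEmbedding
  have nrm : ∀ (x : Fin (k + 1) → ℝ) (i), |x i| ≤ ‖T x‖ := fun x i => by
    have := PiLp.norm_apply_le (T x) i
    simpa using this
  have hpre : ∫ y in {y : Model (k + 1) | 0 < y 0}, D y =
      ∫ x in {x : Fin (k + 1) → ℝ | 0 < x 0}, D (T x) :=
    (mp.setIntegral_preimage_emb me D {y : Model (k + 1) | 0 < y 0}).symm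
  have hpreint : IntegrableOn (fun x => D (T x)) {x : Fin (k + 1) → ℝ | 0 < x 0} :=
    (mp.integrableOn_comp_preimage me).2 hint
  -- The open box lies in the open half space, where the field is differentiable, and differs from
  -- the closed box by a null set.
  set Q : Set (Fin (k + 1) → ℝ) := Set.pi univ fun i => Ioo (a i) (b i) with hQ
  have hQsub : Q ⊆ {x : Fin (k + 1) → ℝ | 0 < x 0} := fun x hx => by
    have := (hx 0 (mem_univ _)).1
    simpa [ha] using this
  have hQm : MeasurableSet Q := MeasurableSet.univ_pi fun i => measurableSet_Ioo
  have hout : ∀ x ∈ {x : Fin (k + 1) → ℝ | 0 < x 0} \ Q, D (T x) = 0 := by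
    rintro x ⟨hx, hxQ⟩
    refine hD0 _ hx ?_
    simp only [hQ, Set.mem_pi, mem_univ, true_implies, not_forall] at hxQ
    obtain ⟨i, hi⟩ := hxQ
    refine hRS.trans_le (le_trans ?_ (nrm x i))
    by_contra hlt
    push Not at hlt
    rw [abs_lt] at hlt
    apply hi
    refine ⟨?_, hlt.2⟩
    simp only [ha]
    split_ifs with h
    · rw [h]; exact hx
    · exact hlt.1
  have hae : Q =ᵐ[volume] Icc a b := Measure.univ_pi_Ioo_ae_eq_Icc
  have hbox : ∫ x in {x : Fin (k + 1) → ℝ | 0 < x 0}, D (T x) = ∫ x in Icc a b, D (T x) := by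
    rw [← setIntegral_congr_set hae]
    exact setIntegral_eq_of_subset_of_forall_sdiff_eq_zero
      (measurableSet_lt measurable_const (measurable_pi_apply 0)) hQsub hout
  rw [hpre, hbox]
  have hcoord : ∀ (i : Fin (k + 1)) (x : Fin (k + 1) → ℝ), x ∈ Icc a b → 0 ≤ x 0 := fun i x hx => by
    have := hx.1 0
    simpa [ha] using this
  have main := integral_divergence_of_hasFDerivAt_off_countable' a b hab
    (fun i x => V i (T x))
    (fun i x => (fderiv ℝ (V i) (T x)).comp ((PiLp.continuousLinearEquiv 2 ℝ
      (fun _ : Fin (k + 1) => ℝ)).symm : (Fin (k + 1) → ℝ) →L[ℝ] Model (k + 1)))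
    ∅ countable_empty
    (fun i => (hc i).comp (PiLp.continuous_toLp 2 _).continuousOn fun x hx => hcoord i x hx)
    (fun x hx i => by
      have hx0 : 0 < (T x) 0 := hQsub hx.1
      exact (hd i _ hx0).hasFDerivAt.comp x (hTL x))
    (by
      refine IntegrableOn.congr_set_ae ?_ hae.symm
      exact hpreint.mono_set hQsub)
  have hz : ∀ (i : Fin (k + 1)) (c : ℝ) (x : Fin k → ℝ), (0 ≤ (T (i.insertNth c x)) 0) →
      ((i = 0 ∧ c = 0) ∨ |c| = S) → V i (T (i.insertNth c x)) = 0 := by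
    intro i c x h1 h2
    rcases h2 with ⟨rfl, rfl⟩ | h2
    · exact h0 _ _ (by simp [hT])
    · refine hR _ _ h1 (hRS.trans_le ?_)
      have := nrm (i.insertNth c x) i
      rwa [Fin.insertNth_apply_same, h2] at this
  refine main.trans (Finset.sum_eq_zero fun i _ => ?_)
  have hface : ∀ c, (c = a i ∨ c = b i) → ∫ x in Icc (a ∘ i.succAbove) (b ∘ i.succAbove),
      V i (T (i.insertNth c x)) = 0 := by
    intro c hcab
    refine setIntegral_eq_zero_of_forall_eq_zero fun x hx => ?_
    refine hz i c x ?_ ?_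
    · have : i.insertNth c x ∈ Icc a b := by
        refine Fin.insertNth_mem_Icc.2 ⟨?_, hx⟩
        rcases hcab with rfl | rfl
        · exact ⟨le_rfl, hab i⟩
        · exact ⟨hab i, le_rfl⟩
      exact hcoord i _ this
    · rcases hcab with rfl | rfl
      · simp only [ha]
        split_ifs with h
        · exact Or.inl ⟨h, rfl⟩
        · right; rw [abs_neg, abs_of_pos hSpos]
      · right; exact abs_of_pos hSpos
  rw [hface _ (Or.inl rfl), hface _ (Or.inr rfl), sub_zero]

end EuclideanCalculus

end EtaLaplacian

namespace EtaLaplacian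

/-! ### Change of charts -/

variable {n : ℕ} [NeZero n] {M : Type*} [TopologicalSpace M]
  [ChartedSpace (EuclideanHalfSpace n) M] [IsManifold (𝓡∂ n) ∞ M]

section Transition

instance isManifold_one : IsManifold (𝓡∂ n) 1 M := IsManifold.of_le (n := ∞) (by simp)

/-- The Jacobian matrix at `p` of the transition from the chart at `x` to the chart at `x'`. -/
noncomputable def transition (n : ℕ) [NeZero n] {M : Type*} [TopologicalSpace M]
    [ChartedSpace (EuclideanHalfSpace n) M] [IsManifold (𝓡∂ n) ∞ M] (x x' p : M) : Matrix (Fin n) (Fin n) ℝ :=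
  Matrix.of fun k i => (tangentCoordChange (𝓡∂ n) x x' p (EuclideanSpace.single i 1)) k

theorem euclidean_eq_sum {n : ℕ} (v : Model n) : v = ∑ i, v i • EuclideanSpace.single i (1 : ℝ) := by
  ext m
  simp [Pi.single_apply]

theorem tangentCoordChange_apply_eq_mulVec (x x' p : M) (v : Model n) (k : Fin n) :
    (tangentCoordChange (𝓡∂ n) x x' p v) k = (transition n x x' p).mulVec v k := by
  conv_lhs => rw [euclidean_eq_sum v]
  simp [transition, Matrix.mulVec, dotProduct, mul_comm]

theorem transition_mul {x x' x'' p : M} (h : p ∈ (extChartAt (𝓡∂ n) x).source)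
    (h' : p ∈ (extChartAt (𝓡∂ n) x').source) (h'' : p ∈ (extChartAt (𝓡∂ n) x'').source) :
    transition n x' x'' p * transition n x x' p = transition n x x'' p := by
  ext k i
  have := tangentCoordChange_comp (I := 𝓡∂ n) (w := x) (x := x') (y := x'') (z := p)
    (v := (EuclideanSpace.single i 1 : Model n)) ⟨⟨h, h'⟩, h''⟩
  have h2 := congrArg (fun w : Model n => w k) this
  simp only [tangentCoordChange_apply_eq_mulVec] at h2
  simp only [transition, Matrix.of_apply]
  rw [← this, tangentCoordChange_apply_eq_mulVec]
  rfl

theorem transition_self {x p : M} (h : p ∈ (extChartAt (𝓡∂ n) x).source) :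
    transition n x x p = 1 := by
  ext k i
  simp only [transition, Matrix.of_apply]
  rw [tangentCoordChange_self (I := 𝓡∂ n) h]
  simp [Matrix.one_apply]

theorem transition_mul_symm {x x' p : M} (h : p ∈ (extChartAt (𝓡∂ n) x).source)
    (h' : p ∈ (extChartAt (𝓡∂ n) x').source) : transition n x' x p * transition n x x' p = 1 := by
  rw [transition_mul h h' h, transition_self h]

theorem transition_det_ne_zero {x x' p : M} (h : p ∈ (extChartAt (𝓡∂ n) x).source)
    (h' : p ∈ (extChartAt (𝓡∂ n) x').source) : (transition n x x' p).det ≠ 0 := by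
  intro h0
  have := congrArg Matrix.det (transition_mul_symm h h')
  rw [Matrix.det_mul, h0, Matrix.det_one] at this
  simp at this

theorem transition_inv {x x' p : M} (h : p ∈ (extChartAt (𝓡∂ n) x).source)
    (h' : p ∈ (extChartAt (𝓡∂ n) x').source) : (transition n x x' p)⁻¹ = transition n x' x p :=
  Matrix.inv_eq_left_inv (transition_mul_symm h h')

/-- The tangent space at `p` is modelled on the preferred chart at `p`, so differentiating another
chart amounts to a transition between the two charts. -/
theorem mfderivWithin_chart_symm {x p : M} (h : p ∈ (extChartAt (𝓡∂ n) x).source) :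
    mfderivWithin 𝓘(ℝ, Model n) (𝓡∂ n) (extChartAt (𝓡∂ n) x).symm (range (𝓡∂ n))
      (extChartAt (𝓡∂ n) x p) = tangentCoordChange (𝓡∂ n) x p p := by
  have h' : p ∈ (chartAt (EuclideanHalfSpace n) x).source := by rwa [extChartAt_source] at h
  rw [← TangentBundle.symmL_trivializationAt h']
  exact TangentBundle.symmL_trivializationAt_eq_core h'

theorem mfderiv_chart {x p : M} (h : p ∈ (extChartAt (𝓡∂ n) x).source) :
    mfderiv (𝓡∂ n) 𝓘(ℝ, Model n) (extChartAt (𝓡∂ n) x) p = tangentCoordChange (𝓡∂ n) p x p := by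
  have h' : p ∈ (chartAt (EuclideanHalfSpace n) x).source := by rwa [extChartAt_source] at h
  rw [← TangentBundle.continuousLinearMapAt_trivializationAt h']
  exact TangentBundle.continuousLinearMapAt_trivializationAt_eq_core h'

theorem frame_sum (p : M) (v : Model n) :
    (v : TangentSpace (𝓡∂ n) p) = ∑ i, v i • frame p i := euclidean_eq_sum v

theorem inner_eq_sum_gram (g : Metric n M) (p : M) (v w : Model n) :
    g.inner p v w = ∑ k, ∑ l, v k * gram g p k l * w l := by
  have hv := frame_sum p v
  have hw := frame_sum p w
  have : g.inner p v w = g.inner p (∑ i, v i • frame p i) (∑ i, w i • frame p i) := by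
    rw [← hv, ← hw]
  rw [this, map_sum]
  simp_rw [map_sum, map_smul, sum_apply, smul_apply, smul_eq_mul, Finset.mul_sum]
  rw [Finset.sum_comm]
  refine Finset.sum_congr rfl fun k _ => Finset.sum_congr rfl fun l _ => ?_
  simp only [gram, Matrix.of_apply]
  ring

/-- Metric matrices transform by congruence. This links the pointwise matrix `gram` with the matrix
in a fixed chart, and every invariant below passes through it. -/
theorem chartGram_eq (g : Metric n M) {x p : M} (h : p ∈ (extChartAt (𝓡∂ n) x).source) :
    chartGram g x (extChartAt (𝓡∂ n) x p) =
      (transition n x p p).transpose * gram g p * transition n x p p := by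
  ext i j
  -- The base point in `chartGram` is `e.symm (e p)`, which has to be replaced by `p` inside a
  -- dependent type.
  have aux : ∀ q : M, q = p → ∀ v w : Model n, g.inner q v w = g.inner p v w := by
    rintro _ rfl _ _; rfl
  have h1 := aux _ ((extChartAt (𝓡∂ n) x).left_inv h)
  have : chartGram g x (extChartAt (𝓡∂ n) x p) i j =
      g.inner p (tangentCoordChange (𝓡∂ n) x p p (EuclideanSpace.single i 1))
        (tangentCoordChange (𝓡∂ n) x p p (EuclideanSpace.single j 1)) := by
    rw [← mfderivWithin_chart_symm h]
    exact h1 _ _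
  rw [this, inner_eq_sum_gram]
  simp only [Matrix.mul_apply, Matrix.transpose_apply, transition, Matrix.of_apply]
  simp_rw [Finset.sum_mul]
  rw [Finset.sum_comm]

theorem chartGram_transition (g : Metric n M) {x x' p : M}
    (h : p ∈ (extChartAt (𝓡∂ n) x).source) (h' : p ∈ (extChartAt (𝓡∂ n) x').source) :
    chartGram g x (extChartAt (𝓡∂ n) x p) = (transition n x x' p).transpose *
      chartGram g x' (extChartAt (𝓡∂ n) x' p) * transition n x x' p := by
  have hp := mem_extChartAt_source (I := 𝓡∂ n) p
  rw [chartGram_eq g h, chartGram_eq g h', ← transition_mul h h' hp, Matrix.transpose_mul]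
  simp only [Matrix.mul_assoc]

theorem gram_posDef (g : Metric n M) (p : M) : (gram g p).PosDef := by
  refine Matrix.PosDef.of_dotProduct_mulVec_pos ?_ ?_
  · ext i j
    simp [gram, g.symm p (frame p j) (frame p i)]
  · intro v hv
    have h1 : (WithLp.toLp 2 v : Model n) ≠ 0 := by
      intro h0
      apply hv
      ext i
      have := congrArg (fun w : Model n => w i) h0
      simpa using this
    have h2 := g.pos p (WithLp.toLp 2 v : Model n) h1
    rw [inner_eq_sum_gram] at h2
    simpa [dotProduct, Matrix.mulVec, Finset.mul_sum, mul_assoc] using h2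

theorem gram_det_pos (g : Metric n M) (p : M) : 0 < (gram g p).det := (gram_posDef g p).det_pos

theorem chartGram_det_eq (g : Metric n M) {x p : M} (h : p ∈ (extChartAt (𝓡∂ n) x).source) :
    (chartGram g x (extChartAt (𝓡∂ n) x p)).det = (transition n x p p).det ^ 2 * (gram g p).det := by
  rw [chartGram_eq g h, Matrix.det_mul, Matrix.det_mul, Matrix.det_transpose]; ring

theorem chartGram_det_pos (g : Metric n M) {x p : M} (h : p ∈ (extChartAt (𝓡∂ n) x).source) :
    0 < (chartGram g x (extChartAt (𝓡∂ n) x p)).det := by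
  rw [chartGram_det_eq g h]
  have := transition_det_ne_zero h (mem_extChartAt_source (I := 𝓡∂ n) p)
  have := gram_det_pos g p
  positivity

theorem chartGram_det_pos_of_mem_target (g : Metric n M) {x : M} {y : Model n}
    (h : y ∈ (extChartAt (𝓡∂ n) x).target) : 0 < (chartGram g x y).det := by
  have := chartGram_det_pos g ((extChartAt (𝓡∂ n) x).map_target h)
  rwa [(extChartAt (𝓡∂ n) x).right_inv h] at this

theorem sqrt_chartGram_det_transition (g : Metric n M) {x x' p : M}
    (h : p ∈ (extChartAt (𝓡∂ n) x).source) (h' : p ∈ (extChartAt (𝓡∂ n) x').source) :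
    √(chartGram g x (extChartAt (𝓡∂ n) x p)).det =
      |(transition n x x' p).det| * √(chartGram g x' (extChartAt (𝓡∂ n) x' p)).det := by
  rw [chartGram_transition g h h', Matrix.det_mul, Matrix.det_mul, Matrix.det_transpose,
    show ∀ a b : ℝ, a * b * a = a ^ 2 * b by intros; ring, Real.sqrt_mul (sq_nonneg _),
    Real.sqrt_sq_eq_abs]

end Transition

/-! ### Differentials in coordinates -/

section Differential

/-- The components of `df` at `p` in the basis `frame p`. -/
noncomputable def diffVec (f : M → ℝ) (p : M) : Fin n → ℝ := fun i => differential f p (frame p i)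

/-- The partial derivatives of `f` in the chart at `x`, at the point with coordinates `y`. -/
noncomputable def chartDiff (f : M → ℝ) (x : M) (y : Model n) : Fin n → ℝ := fun i =>
  fderivWithin ℝ (f ∘ (extChartAt (𝓡∂ n) x).symm) (range (𝓡∂ n)) y (EuclideanSpace.single i 1)

theorem differential_eq_sum (f : M → ℝ) (p : M) (v : Model n) :
    differential f p v = ∑ k, diffVec f p k * v k := by
  have hv := frame_sum p v
  have : differential f p v = differential f p (∑ i, v i • frame p i) := by rw [← hv]
  rw [this]
  refine (map_sum (mfderiv (𝓡∂ n) 𝓘(ℝ, ℝ) f p) _ _).trans (Finset.sum_congr rfl fun i _ => ?_)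
  refine (map_smul (mfderiv (𝓡∂ n) 𝓘(ℝ, ℝ) f p) (v i) (frame p i)).trans ?_
  exact mul_comm (v i) (diffVec f p i)

theorem chartDiff_eq {f : M → ℝ} {x p : M} (h : p ∈ (extChartAt (𝓡∂ n) x).source)
    (hf : MDifferentiableAt (𝓡∂ n) 𝓘(ℝ, ℝ) f p) :
    chartDiff f x (extChartAt (𝓡∂ n) x p) = (transition n x p p).transpose.mulVec (diffVec f p) := by
  ext i
  have hl := (extChartAt (𝓡∂ n) x).left_inv h
  have h1 : HasMFDerivWithinAt 𝓘(ℝ, Model n) (𝓡∂ n) (extChartAt (𝓡∂ n) x).symm (range (𝓡∂ n))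
      (extChartAt (𝓡∂ n) x p) (tangentCoordChange (𝓡∂ n) x p p) := by
    rw [← mfderivWithin_chart_symm h]
    exact (mdifferentiableWithinAt_extChartAt_symm
      ((extChartAt (𝓡∂ n) x).map_source h)).hasMFDerivWithinAt
  have h2 : HasMFDerivAt (𝓡∂ n) 𝓘(ℝ, ℝ) f ((extChartAt (𝓡∂ n) x).symm (extChartAt (𝓡∂ n) x p))
      (mfderiv (𝓡∂ n) 𝓘(ℝ, ℝ) f p) := by
    rw [hl]; exact hf.hasMFDerivAt
  have h3 := h2.comp_hasMFDerivWithinAt _ h1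
  set D : Model n →L[ℝ] ℝ := ContinuousLinearMap.comp
    (mfderiv (𝓡∂ n) 𝓘(ℝ, ℝ) f p : Model n →L[ℝ] ℝ) (tangentCoordChange (𝓡∂ n) x p p) with hD
  have h4 : HasFDerivWithinAt (f ∘ (extChartAt (𝓡∂ n) x).symm) D (range (𝓡∂ n))
      (extChartAt (𝓡∂ n) x p) := h3.hasFDerivWithinAt
  have hu : UniqueDiffWithinAt ℝ (range (𝓡∂ n)) (extChartAt (𝓡∂ n) x p) :=
    (𝓡∂ n).uniqueDiffOn _ (extChartAt_target_subset_range (I := 𝓡∂ n) x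
      ((extChartAt (𝓡∂ n) x).map_source h))
  unfold chartDiff
  have h6 := h4.fderivWithin hu
  have h5 := differential_eq_sum f p
    (tangentCoordChange (𝓡∂ n) x p p (EuclideanSpace.single i 1))
  refine Eq.trans (congrArg (fun L : Model n →L[ℝ] ℝ => L (EuclideanSpace.single i 1)) h6)
    (h5.trans ?_)
  · simp only [Matrix.mulVec, dotProduct, Matrix.transpose_apply, transition, Matrix.of_apply]
    exact Finset.sum_congr rfl fun k _ => mul_comm _ _

end Differential

/-! ### Smoothness of coordinate expressions -/

section Smoothness

/-- The coordinate vector fields form the local frame of the trivialization of the tangent bundle at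
`x`. They are smooth sections, and the metric pairs them smoothly. -/
theorem contDiffOn_chartGram (g : Metric n M) (x : M) (i j : Fin n) :
    ContDiffOn ℝ ∞ (fun y => chartGram g x y i j) (extChartAt (𝓡∂ n) x).target := by
  set e := trivializationAt (Model n) (TangentSpace (𝓡∂ n) : M → Type _) x with he
  set b := (EuclideanSpace.basisFun (Fin n) ℝ).toBasis with hb
  have hsec : ∀ i : Fin n, ContMDiffOn (𝓡∂ n) ((𝓡∂ n).prod 𝓘(ℝ, Model n)) ∞
      (fun p : M => (Bundle.TotalSpace.mk' (Model n) p (e.localFrame b i p) :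
        TangentBundle (𝓡∂ n) M)) e.baseSet := fun i =>
    e.contMDiffOn_localFrame_baseSet (n := ∞) (I := 𝓡∂ n) b i
  have h1 : ContMDiffOn (𝓡∂ n) ((𝓡∂ n).prod 𝓘(ℝ, ℝ)) ∞ (fun p : M =>
      Bundle.TotalSpace.mk' ℝ (E := Bundle.Trivial M ℝ) p
        (g.inner p (e.localFrame b i p) (e.localFrame b j p))) e.baseSet :=
    ContMDiffOn.clm_bundle_apply₂ (F₁ := Model n) (F₂ := Model n) (b := fun p : M => p)
      g.contMDiff.contMDiffOn (hsec i) (hsec j)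
  have h1' : ContMDiffOn (𝓡∂ n) 𝓘(ℝ, ℝ) ∞ (fun p : M =>
        (g.inner p (e.localFrame b i p) (e.localFrame b j p))) e.baseSet := fun p hp => by
    have := h1 p hp
    simp only [Bundle.contMDiffWithinAt_totalSpace] at this
    exact this.2
  have h2 := h1'.comp (contMDiffOn_extChartAt_symm (n := ∞) (I := 𝓡∂ n) x) (fun y hy => by
    have := (extChartAt (𝓡∂ n) x).map_target hy
    rwa [extChartAt_source] at this)
  refine (contMDiffOn_iff_contDiffOn.1 h2).congr fun y hy => ?_
  have hp := (extChartAt (𝓡∂ n) x).map_target hy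
  have hp' : (extChartAt (𝓡∂ n) x).symm y ∈ (chartAt (EuclideanHalfSpace n) x).source := by
    rwa [extChartAt_source] at hp
  have hfr : ∀ i : Fin n, e.localFrame b i ((extChartAt (𝓡∂ n) x).symm y) =
      mfderivWithin 𝓘(ℝ, Model n) (𝓡∂ n) (extChartAt (𝓡∂ n) x).symm (range (𝓡∂ n)) y
      (EuclideanSpace.single i (1 : ℝ) : Model n) := by
    intro i
    rw [e.localFrame_apply_of_mem_baseSet b hp']
    have h3 := TangentBundle.symmL_trivializationAt (I := 𝓡∂ n) hp'
    rw [(extChartAt (𝓡∂ n) x).right_inv hy] at h3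
    rw [← h3]
    have h4 : b i = EuclideanSpace.single i (1 : ℝ) := by simp [hb]
    rw [← h4]
    exact (Module.Basis.map_apply _ _ _).trans (e.symmL_apply (R := ℝ) hp' (b i)).symm
  simp only [Function.comp_apply, hfr]
  rfl

theorem contDiffOn_comp_chart_symm {f : M → ℝ} (hf : ContMDiff (𝓡∂ n) 𝓘(ℝ, ℝ) ∞ f) (x : M) :
    ContDiffOn ℝ ∞ (f ∘ (extChartAt (𝓡∂ n) x).symm) (extChartAt (𝓡∂ n) x).target :=
  contMDiffOn_iff_contDiffOn.1 (hf.comp_contMDiffOn (contMDiffOn_extChartAt_symm (n := ∞) x))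

theorem contDiffOn_chartDiff {f : M → ℝ} (hf : ContMDiff (𝓡∂ n) 𝓘(ℝ, ℝ) ∞ f) (x : M) (i : Fin n) :
    ContDiffOn ℝ ∞ (fun y => chartDiff f x y i) (extChartAt (𝓡∂ n) x).target := by
  have h := (contDiffOn_comp_chart_symm hf x).fderivWithin (m := ∞)
    (uniqueDiffOn_extChartAt_target (I := 𝓡∂ n) x) (by simp)
  have h2 := h.clm_apply (contDiffOn_const (c := (EuclideanSpace.single i 1 : Model n)))
  refine h2.congr fun y hy => ?_
  unfold chartDiff
  rw [fderivWithin_congr_set (extChartAt_target_eventuallyEq_of_mem hy)]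

end Smoothness

end EtaLaplacian

namespace EtaLaplacian

/-! ### The cometric and the Laplacian in charts -/

variable {n : ℕ} [NeZero n] {M : Type*} [TopologicalSpace M]
  [ChartedSpace (EuclideanHalfSpace n) M] [IsManifold (𝓡∂ n) ∞ M]

open Matrix

section Cometric

/-- The inner product `⟨du, dv⟩` of covectors induced by `g`. -/
noncomputable def cometric (g : Metric n M) (u v : M → ℝ) (p : M) : ℝ :=
  diffVec u p ⬝ᵥ (gram g p)⁻¹ *ᵥ diffVec v p

theorem transpose_gram (g : Metric n M) (p : M) : (gram g p)ᵀ = gram g p := by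
  ext i j
  exact g.symm p _ _

theorem riemannianGradient_apply (g : Metric n M) (f : M → ℝ) (p : M) (k : Fin n) :
    (EuclideanSpace.proj k : Model n →L[ℝ] ℝ) (riemannianGradient g f p) =
      ((gram g p)⁻¹ *ᵥ diffVec f p) k := by
  have h : (riemannianGradient g f p : Model n) =
      ∑ i, ((gram g p)⁻¹ *ᵥ diffVec f p) i • (EuclideanSpace.single i (1 : ℝ) : Model n) := rfl
  refine (congrArg (EuclideanSpace.proj k : Model n →L[ℝ] ℝ) h).trans ?_
  simp

theorem cometric_comm (g : Metric n M) (u v : M → ℝ) (p : M) :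
    cometric g u v p = cometric g v u p := by
  unfold cometric
  rw [dotProduct_comm, ← vecMul_transpose, ← dotProduct_mulVec, transpose_nonsing_inv,
    transpose_gram]

theorem inner_riemannianGradient (g : Metric n M) (u v : M → ℝ) (p : M) :
    g.inner p (riemannianGradient g u p) (riemannianGradient g v p) = cometric g u v p := by
  have h : ∀ a b : Fin n → ℝ, ∑ k, ∑ l, a k * gram g p k l * b l = a ⬝ᵥ gram g p *ᵥ b := by
    intro a b
    simp [dotProduct, mulVec, Finset.mul_sum, mul_assoc]
  have key : ∀ a b : Model n, (∀ k, a k = ((gram g p)⁻¹ *ᵥ diffVec u p) k) →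
      (∀ k, b k = ((gram g p)⁻¹ *ᵥ diffVec v p) k) → g.inner p a b = cometric g u v p := by
    intro a b ha hb
    rw [inner_eq_sum_gram]
    simp_rw [ha, hb]
    rw [h, mulVec_mulVec, mul_nonsing_inv _ (isUnit_iff_ne_zero.2 (gram_det_pos g p).ne'),
      one_mulVec, dotProduct_comm]
    exact cometric_comm g v u p
  exact key _ _ (riemannianGradient_apply g u p) (riemannianGradient_apply g v p)

/-- Invariance of the dual form under a change of basis, used for changes of charts and for
orthonormal frames alike. -/
theorem dotProduct_inv_congruence {G T : Matrix (Fin n) (Fin n) ℝ} (hT : T.det ≠ 0)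
    (a b : Fin n → ℝ) : (Tᵀ *ᵥ a) ⬝ᵥ (Tᵀ * G * T)⁻¹ *ᵥ (Tᵀ *ᵥ b) = a ⬝ᵥ G⁻¹ *ᵥ b := by
  have h1 : IsUnit T.det := isUnit_iff_ne_zero.2 hT
  have h2 : IsUnit Tᵀ.det := by rwa [det_transpose]
  rw [Matrix.mul_inv_rev, Matrix.mul_inv_rev, mulVec_mulVec, Matrix.mul_assoc, Matrix.mul_assoc,
    nonsing_inv_mul _ h2, Matrix.mul_one, mulVec_transpose, dotProduct_mulVec, vecMul_vecMul,
    ← Matrix.mul_assoc, mul_nonsing_inv _ h1, Matrix.one_mul, ← dotProduct_mulVec]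

theorem cometric_eq_chart (g : Metric n M) {u v : M → ℝ} {x p : M}
    (h : p ∈ (extChartAt (𝓡∂ n) x).source)
    (hu : MDifferentiableAt (𝓡∂ n) 𝓘(ℝ, ℝ) u p) (hv : MDifferentiableAt (𝓡∂ n) 𝓘(ℝ, ℝ) v p) :
    cometric g u v p = chartDiff u x (extChartAt (𝓡∂ n) x p) ⬝ᵥ
      (chartGram g x (extChartAt (𝓡∂ n) x p))⁻¹ *ᵥ chartDiff v x (extChartAt (𝓡∂ n) x p) := by
  rw [chartDiff_eq h hu, chartDiff_eq h hv, chartGram_eq g h, dotProduct_inv_congruence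
    (transition_det_ne_zero h (mem_extChartAt_source (I := 𝓡∂ n) p))]
  rfl

/-- The components of `∇ f` in the chart at `x`. -/
noncomputable def chartGradient (g : Metric n M) (f : M → ℝ) (x : M) (y : Model n) : Fin n → ℝ :=
  (chartGram g x y)⁻¹ *ᵥ chartDiff f x y

theorem chartGradient_eq (g : Metric n M) {f : M → ℝ} {x p : M}
    (h : p ∈ (extChartAt (𝓡∂ n) x).source) (hf : MDifferentiableAt (𝓡∂ n) 𝓘(ℝ, ℝ) f p) :
    chartGradient g f x (extChartAt (𝓡∂ n) x p) =
      transition n p x p *ᵥ ((gram g p)⁻¹ *ᵥ diffVec f p) := by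
  have hp := mem_extChartAt_source (I := 𝓡∂ n) p
  have h1 : IsUnit (transition n x p p)ᵀ.det := by
    rw [det_transpose]; exact isUnit_iff_ne_zero.2 (transition_det_ne_zero h hp)
  rw [chartGradient, chartDiff_eq h hf, chartGram_eq g h, Matrix.mul_inv_rev, Matrix.mul_inv_rev,
    mulVec_mulVec, Matrix.mul_assoc, Matrix.mul_assoc, nonsing_inv_mul _ h1, Matrix.mul_one,
    transition_inv h hp, mulVec_mulVec]

theorem mfderiv_chart_riemannianGradient (g : Metric n M) {f : M → ℝ} {x p : M}
    (h : p ∈ (extChartAt (𝓡∂ n) x).source) (hf : MDifferentiableAt (𝓡∂ n) 𝓘(ℝ, ℝ) f p)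
    (k : Fin n) :
    (EuclideanSpace.proj k : Model n →L[ℝ] ℝ)
      (mfderiv (𝓡∂ n) 𝓘(ℝ, Model n) (extChartAt (𝓡∂ n) x) p (riemannianGradient g f p)) =
      chartGradient g f x (extChartAt (𝓡∂ n) x p) k := by
  rw [chartGradient_eq g h hf, mfderiv_chart h]
  refine (tangentCoordChange_apply_eq_mulVec p x p (riemannianGradient g f p) k).trans ?_
  congr 1
  ext l
  exact riemannianGradient_apply g f p l

theorem chartGradient_transition (g : Metric n M) {f : M → ℝ} {x x' p : M}
    (h : p ∈ (extChartAt (𝓡∂ n) x).source) (h' : p ∈ (extChartAt (𝓡∂ n) x').source)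
    (hf : MDifferentiableAt (𝓡∂ n) 𝓘(ℝ, ℝ) f p) :
    chartGradient g f x (extChartAt (𝓡∂ n) x p) =
      (transition n x x' p)⁻¹ *ᵥ chartGradient g f x' (extChartAt (𝓡∂ n) x' p) := by
  have hp := mem_extChartAt_source (I := 𝓡∂ n) p
  rw [chartGradient_eq g h hf, chartGradient_eq g h' hf, transition_inv h h', mulVec_mulVec
    (M := transition n x' x p), transition_mul hp h' h]

/-- `√(det g) ∇ f` in the chart at `x`. -/
noncomputable def chartFlux (g : Metric n M) (f : M → ℝ) (x : M) (k : Fin n) (y : Model n) : ℝ :=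
  √(chartGram g x y).det * chartGradient g f x y k

theorem contDiffOn_sqrt_chartGram_det (g : Metric n M) (x : M) :
    ContDiffOn ℝ ∞ (fun y => √(chartGram g x y).det) (extChartAt (𝓡∂ n) x).target := fun y hy =>
  (contDiffWithinAt_det fun i j => contDiffOn_chartGram g x i j y hy).sqrt
    (chartGram_det_pos_of_mem_target g hy).ne'

theorem contDiffOn_chartGram_inv (g : Metric n M) (x : M) (i j : Fin n) :
    ContDiffOn ℝ ∞ (fun y => (chartGram g x y)⁻¹ i j) (extChartAt (𝓡∂ n) x).target := fun y hy =>
  contDiffWithinAt_inv_entry (fun i j => contDiffOn_chartGram g x i j y hy)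
    (chartGram_det_pos_of_mem_target g hy).ne' i j

theorem contDiffOn_chartGradient (g : Metric n M) {f : M → ℝ}
    (hf : ContMDiff (𝓡∂ n) 𝓘(ℝ, ℝ) ∞ f) (x : M) (k : Fin n) :
    ContDiffOn ℝ ∞ (fun y => chartGradient g f x y k) (extChartAt (𝓡∂ n) x).target := by
  simp only [chartGradient, mulVec, dotProduct]
  exact ContDiffOn.sum fun j _ => (contDiffOn_chartGram_inv g x k j).mul (contDiffOn_chartDiff hf x j)

theorem contDiffOn_chartFlux (g : Metric n M) {f : M → ℝ}
    (hf : ContMDiff (𝓡∂ n) 𝓘(ℝ, ℝ) ∞ f) (x : M) (k : Fin n) :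
    ContDiffOn ℝ ∞ (chartFlux g f x k) (extChartAt (𝓡∂ n) x).target :=
  (contDiffOn_sqrt_chartGram_det g x).mul (contDiffOn_chartGradient g hf x k)

/-- `gram g p` and `diffVec u p` refer to the preferred chart at `p`, which may jump with `p`.
Continuity is visible only after passing to one fixed chart. -/
theorem continuous_cometric (g : Metric n M) {u v : M → ℝ} (hu : ContMDiff (𝓡∂ n) 𝓘(ℝ, ℝ) ∞ u)
    (hv : ContMDiff (𝓡∂ n) 𝓘(ℝ, ℝ) ∞ v) : Continuous (cometric g u v) := by
  rw [continuous_iff_continuousAt]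
  intro x
  have h1 : ContinuousOn (fun y => chartDiff u x y ⬝ᵥ chartGradient g v x y)
      (extChartAt (𝓡∂ n) x).target := by
    simp only [dotProduct]
    exact (ContDiffOn.sum fun j _ =>
      (contDiffOn_chartDiff hu x j).mul (contDiffOn_chartGradient g hv x j)).continuousOn
  have h2 := h1.comp (continuousOn_extChartAt x) (extChartAt (𝓡∂ n) x).mapsTo
  have h3 := h2.continuousAt (extChartAt_source_mem_nhds (I := 𝓡∂ n) x)
  refine h3.congr ?_
  filter_upwards [extChartAt_source_mem_nhds (I := 𝓡∂ n) x] with p hp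
  exact (cometric_eq_chart g hp (hu.mdifferentiableAt (by simp)) (hv.mdifferentiableAt (by simp))).symm

end Cometric

/-! ### Interior and boundary points in charts -/

section HalfSpace

theorem range_halfSpace : range (𝓡∂ n) = {y : Model n | 0 ≤ y 0} :=
  range_modelWithCornersEuclideanHalfSpace n

theorem chart_target_mem_nhds {x : M} {y : Model n} (hy : y ∈ (extChartAt (𝓡∂ n) x).target)
    (h0 : 0 < y 0) : (extChartAt (𝓡∂ n) x).target ∈ 𝓝 y := by
  have h1 : range (𝓡∂ n) ∈ 𝓝 y := by
    rw [range_halfSpace]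
    have c0 : ContinuousAt (fun y : Model n => y 0) y := by fun_prop
    filter_upwards [c0.eventually (lt_mem_nhds h0)] with w hw
    exact le_of_lt hw
  have h2 := extChartAt_target_mem_nhdsWithin_of_mem (I := 𝓡∂ n) hy
  rwa [nhdsWithin_eq_nhds.2 h1] at h2

theorem isInteriorPoint_of_coord_pos {x p : M} (h : p ∈ (extChartAt (𝓡∂ n) x).source)
    (h0 : 0 < (extChartAt (𝓡∂ n) x p) 0) : (𝓡∂ n).IsInteriorPoint p := by
  have h' : p ∈ (chartAt (EuclideanHalfSpace n) x).source := by rwa [extChartAt_source] at h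
  rw [ModelWithCorners.isInteriorPoint_iff_of_mem_atlas (n := ∞) (by simp) (chart_mem_atlas _ x) h',
    mem_interior_iff_mem_nhds]
  exact chart_target_mem_nhds ((extChartAt (𝓡∂ n) x).map_source h) h0

theorem coord_pos_of_isInteriorPoint {x p : M} (h : p ∈ (extChartAt (𝓡∂ n) x).source)
    (hp : (𝓡∂ n).IsInteriorPoint p) : 0 < (extChartAt (𝓡∂ n) x p) 0 := by
  have h' : p ∈ (chartAt (EuclideanHalfSpace n) x).source := by rwa [extChartAt_source] at h
  rw [ModelWithCorners.isInteriorPoint_iff_of_mem_atlas (n := ∞) (by simp) (chart_mem_atlas _ x) h']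
    at hp
  have h2 := interior_mono (extChartAt_target_subset_range (I := 𝓡∂ n) x) hp
  rw [interior_range_modelWithCornersEuclideanHalfSpace] at h2
  exact h2

theorem mem_boundary_of_coord_eq_zero {x p : M} (h : p ∈ (extChartAt (𝓡∂ n) x).source)
    (h0 : (extChartAt (𝓡∂ n) x p) 0 = 0) : p ∈ (𝓡∂ n).boundary M := by
  rw [← ModelWithCorners.compl_interior]
  intro hp
  exact (coord_pos_of_isInteriorPoint h hp).ne' h0

end HalfSpace

/-! ### Chart independence of the Laplacian -/

section Laplacian

theorem laplacian_eq (g : Metric n M) {f : M → ℝ} (hf : ContMDiff (𝓡∂ n) 𝓘(ℝ, ℝ) ∞ f) (p : M) :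
    laplacian g f p = (√(chartGram g p (extChartAt (𝓡∂ n) p p)).det)⁻¹ *
      ∑ i, fderivWithin ℝ (chartFlux g f p i) (range (𝓡∂ n)) (extChartAt (𝓡∂ n) p p)
        (EuclideanSpace.single i 1) := by
  unfold laplacian divergence
  congr 1
  refine Finset.sum_congr rfl fun i _ => ?_
  have key : ∀ y ∈ (extChartAt (𝓡∂ n) p).target, √(chartGram g p y).det *
        (EuclideanSpace.proj i : Model n →L[ℝ] ℝ)
          (mfderiv (𝓡∂ n) 𝓘(ℝ, Model n) (extChartAt (𝓡∂ n) p) ((extChartAt (𝓡∂ n) p).symm y)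
            (riemannianGradient g f ((extChartAt (𝓡∂ n) p).symm y))) = chartFlux g f p i y := by
    intro y hy
    unfold chartFlux
    congr 1
    refine (mfderiv_chart_riemannianGradient g ((extChartAt (𝓡∂ n) p).map_target hy)
      (hf.mdifferentiableAt (by simp)) i).trans ?_
    rw [(extChartAt (𝓡∂ n) p).right_inv hy]
  have hev := eventually_of_mem (extChartAt_target_mem_nhdsWithin (I := 𝓡∂ n) p) key
  rw [Filter.EventuallyEq.fderivWithin_eq hev (key _ (mem_extChartAt_target (I := 𝓡∂ n) p))]

/-- The Laplacian at `p` is defined in the preferred chart at `p`; the Piola identity for the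
transition map `σ` carries it to the chart at `x`. Interior points suffice for integrals, and there
the half space is a neighbourhood, so ordinary derivatives may be used. -/
theorem laplacian_eq_chart (g : Metric n M) {f : M → ℝ} (hf : ContMDiff (𝓡∂ n) 𝓘(ℝ, ℝ) ∞ f)
    {x p : M} (h : p ∈ (extChartAt (𝓡∂ n) x).source) (h0 : 0 < (extChartAt (𝓡∂ n) x p) 0) :
    laplacian g f p = (√(chartGram g x (extChartAt (𝓡∂ n) x p)).det)⁻¹ *
      ∑ i, fderiv ℝ (chartFlux g f x i) (extChartAt (𝓡∂ n) x p) (EuclideanSpace.single i 1) := by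
  have hp := mem_extChartAt_source (I := 𝓡∂ n) p
  have hz0 := coord_pos_of_isInteriorPoint hp (isInteriorPoint_of_coord_pos h h0)
  set z := extChartAt (𝓡∂ n) p p with hz
  set y := extChartAt (𝓡∂ n) x p with hy
  have hzt : z ∈ (extChartAt (𝓡∂ n) p).target := mem_extChartAt_target (I := 𝓡∂ n) p
  have hyt : y ∈ (extChartAt (𝓡∂ n) x).target := (extChartAt (𝓡∂ n) x).map_source h
  have hzn := chart_target_mem_nhds hzt hz0
  have hyn := chart_target_mem_nhds hyt h0
  set σ : Model n → Model n := extChartAt (𝓡∂ n) x ∘ (extChartAt (𝓡∂ n) p).symm with hσ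
  have hσz : σ z = y := by
    simp only [hσ, Function.comp_apply, hz, (extChartAt (𝓡∂ n) p).left_inv hp, hy]
  have hrange : range (𝓡∂ n) ∈ 𝓝 z :=
    mem_of_superset hzn (extChartAt_target_subset_range (I := 𝓡∂ n) p)
  have hσs : ContDiffAt ℝ ∞ σ z := by
    have hm : z ∈ ((extChartAt (𝓡∂ n) p).symm ≫ extChartAt (𝓡∂ n) x).source := by
      rw [PartialEquiv.trans_source]
      refine ⟨hzt, ?_⟩
      simp only [mem_preimage, hz, (extChartAt (𝓡∂ n) p).left_inv hp]
      exact h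
    exact (contDiffWithinAt_ext_coord_change x p hm).contDiffAt hrange
  set J : Model n → Matrix (Fin n) (Fin n) ℝ := fun y' => Matrix.of fun k l =>
    (fderiv ℝ σ y' (EuclideanSpace.single l 1)) k with hJ
  -- The Piola identity differentiates `J`, so agreement of `J` with the transition matrices is
  -- needed near `z` and not only at `z`.
  have hnear : ∀ᶠ y' in 𝓝 z, y' ∈ (extChartAt (𝓡∂ n) p).target ∧
      (extChartAt (𝓡∂ n) p).symm y' ∈ (extChartAt (𝓡∂ n) x).source ∧
      transition n p x ((extChartAt (𝓡∂ n) p).symm y') = J y' := by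
    have c1 : ∀ᶠ y' in 𝓝 z,
        (extChartAt (𝓡∂ n) p).symm y' ∈ (extChartAt (𝓡∂ n) x).source := by
      refine (continuousAt_extChartAt_symm p).eventually_mem ?_
      rw [(extChartAt (𝓡∂ n) p).left_inv hp]
      exact (isOpen_extChartAt_source x).mem_nhds h
    have c2 : ∀ᶠ y' in 𝓝 z, range (𝓡∂ n) ∈ 𝓝 y' := eventually_mem_nhds_iff.2 hrange
    filter_upwards [hzn, c1, c2] with y' h1 h2 h3
    refine ⟨h1, h2, ?_⟩
    ext k l
    simp only [transition, hJ, Matrix.of_apply]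
    rw [tangentCoordChange_def, (extChartAt (𝓡∂ n) p).right_inv h1, fderivWithin_of_mem_nhds h3]
  -- `√(det g) ∇f` is a vector density: `√(det g)` contributes `|det J|` and the gradient
  -- contributes `J⁻¹`.
  have hflux : ∀ i, chartFlux g f p i =ᶠ[𝓝 z]
      fun y' => |(J y').det| * ∑ k, (J y')⁻¹ i k * chartFlux g f x k (σ y') := by
    intro i
    filter_upwards [hnear] with y' ⟨h1, h2, h3⟩
    have hq := (extChartAt (𝓡∂ n) p).map_target h1
    have e1 := sqrt_chartGram_det_transition g hq h2
    have e2 := chartGradient_transition g hq h2 (hf.mdifferentiableAt (by simp))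
    rw [(extChartAt (𝓡∂ n) p).right_inv h1, h3] at e1 e2
    unfold chartFlux
    rw [e1, e2]
    simp only [mulVec, dotProduct, hσ, Function.comp_apply, Finset.mul_sum]
    exact Finset.sum_congr rfl fun k _ => by ring
  have hTz : transition n p x p = J z := by
    have := (hnear.self_of_nhds).2.2
    rwa [(extChartAt (𝓡∂ n) p).left_inv hp] at this
  have hdet : (J z).det ≠ 0 := by rw [← hTz]; exact transition_det_ne_zero hp h
  have hσ2 : DifferentiableAt ℝ (fderiv ℝ σ) z :=
    (hσs.fderiv_right (m := 1) (by norm_cast)).differentiableAt one_ne_zero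
  have hJder : ∀ k l, HasFDerivAt (fun y' => J y' k l)
      ((EuclideanSpace.proj k : Model n →L[ℝ] ℝ).comp
        ((ContinuousLinearMap.apply ℝ (Model n) (EuclideanSpace.single l (1 : ℝ))).comp
          (fderiv ℝ (fderiv ℝ σ) z))) z := by
    intro k l
    exact (EuclideanSpace.proj k : Model n →L[ℝ] ℝ).hasFDerivAt.comp z
      ((ContinuousLinearMap.apply ℝ (Model n)
        (EuclideanSpace.single l (1 : ℝ) : Model n)).hasFDerivAt.comp z hσ2.hasFDerivAt)
  have hsymm : IsSymmSndFDerivAt ℝ σ z := hσs.isSymmSndFDerivAt (by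
    rw [minSmoothness_of_isRCLikeNormedField]; norm_cast)
  have hfluxd : ∀ (x' : M) (y' : Model n) (k : Fin n), (extChartAt (𝓡∂ n) x').target ∈ 𝓝 y' →
      DifferentiableAt ℝ (chartFlux g f x' k) y' := fun x' y' k hn =>
    ((contDiffOn_chartFlux g hf x' k).contDiffAt hn).differentiableAt (by simp)
  have piola := sum_fderiv_piola (J := J) (σ := σ) (L := fderiv ℝ σ z)
    (W := chartFlux g f x) (z := z) (fun k l => (hJder k l).differentiableAt)
    (fun k l i => by
      rw [(hJder k l).fderiv, (hJder k i).fderiv]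
      simp only [ContinuousLinearMap.comp_apply, ContinuousLinearMap.apply_apply]
      rw [hsymm.eq])
    hdet (hσs.differentiableAt (by simp)).hasFDerivAt (fun i k => rfl)
    (fun k => by rw [hσz]; exact hfluxd x y k hyn)
    (fun i => (hfluxd p z i hzn).congr_of_eventuallyEq (hflux i).symm)
  rw [laplacian_eq g hf p]
  have e3 : ∑ i, fderivWithin ℝ (chartFlux g f p i) (range (𝓡∂ n)) z (EuclideanSpace.single i 1) =
      |(J z).det| * ∑ k, fderiv ℝ (chartFlux g f x k) y (EuclideanSpace.single k 1) := by
    rw [← hσz, ← piola]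
    refine Finset.sum_congr rfl fun i _ => ?_
    rw [fderivWithin_of_mem_nhds hrange, (hflux i).fderiv_eq]
  have e4 : √(chartGram g p z).det = |(J z).det| * √(chartGram g x y).det := by
    rw [← hTz]; exact sqrt_chartGram_det_transition g hp h
  have h5 : |(J z).det| ≠ 0 := abs_ne_zero.2 hdet
  rw [← hz, e3, e4, mul_inv]
  field_simp

end Laplacian

/-! ### Product rules -/

section ProductRules

theorem contMDiff_mul {u v : M → ℝ} (hu : ContMDiff (𝓡∂ n) 𝓘(ℝ, ℝ) ∞ u)
    (hv : ContMDiff (𝓡∂ n) 𝓘(ℝ, ℝ) ∞ v) : ContMDiff (𝓡∂ n) 𝓘(ℝ, ℝ) ∞ fun q => u q * v q := by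
  have := contDiff_mul (𝕜 := ℝ) (𝔸 := ℝ) (n := ∞)
  exact this.contMDiff.comp (hu.prodMk_space hv)

theorem chartDiff_mul {u v : M → ℝ} (hu : ContMDiff (𝓡∂ n) 𝓘(ℝ, ℝ) ∞ u)
    (hv : ContMDiff (𝓡∂ n) 𝓘(ℝ, ℝ) ∞ v) {x : M} {y : Model n}
    (hy : y ∈ (extChartAt (𝓡∂ n) x).target) (i : Fin n) :
    chartDiff (fun q => u q * v q) x y i =
      u ((extChartAt (𝓡∂ n) x).symm y) * chartDiff v x y i +
      v ((extChartAt (𝓡∂ n) x).symm y) * chartDiff u x y i := by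
  have hr : y ∈ range (𝓡∂ n) := extChartAt_target_subset_range (I := 𝓡∂ n) x hy
  have hd : ∀ {w : M → ℝ}, ContMDiff (𝓡∂ n) 𝓘(ℝ, ℝ) ∞ w →
      DifferentiableWithinAt ℝ (w ∘ (extChartAt (𝓡∂ n) x).symm) (range (𝓡∂ n)) y := by
    intro w hw
    refine (((contDiffOn_comp_chart_symm hw x) y hy).differentiableWithinAt
      (by simp)).mono_of_mem_nhdsWithin (extChartAt_target_mem_nhdsWithin_of_mem hy)
  have := fderivWithin_fun_mul ((𝓡∂ n).uniqueDiffOn y hr) (hd hu) (hd hv)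
  unfold chartDiff
  rw [show (fun q => u q * v q) ∘ (extChartAt (𝓡∂ n) x).symm = fun y =>
    (u ∘ (extChartAt (𝓡∂ n) x).symm) y * (v ∘ (extChartAt (𝓡∂ n) x).symm) y from rfl, this]
  simp

theorem diffVec_eq_chartDiff {f : M → ℝ} {p : M} (hf : MDifferentiableAt (𝓡∂ n) 𝓘(ℝ, ℝ) f p) :
    diffVec (n := n) f p = chartDiff f p (extChartAt (𝓡∂ n) p p) := by
  have hp := mem_extChartAt_source (I := 𝓡∂ n) p
  rw [chartDiff_eq hp hf, transition_self hp, transpose_one, one_mulVec]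

theorem diffVec_mul {u v : M → ℝ} (hu : ContMDiff (𝓡∂ n) 𝓘(ℝ, ℝ) ∞ u)
    (hv : ContMDiff (𝓡∂ n) 𝓘(ℝ, ℝ) ∞ v) (p : M) :
    diffVec (n := n) (fun q => u q * v q) p = u p • diffVec v p + v p • diffVec u p := by
  have hp := mem_extChartAt_source (I := 𝓡∂ n) p
  rw [diffVec_eq_chartDiff (hu.mdifferentiableAt (by simp)),
    diffVec_eq_chartDiff (hv.mdifferentiableAt (by simp)),
    diffVec_eq_chartDiff ((contMDiff_mul hu hv).mdifferentiableAt (by simp))]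
  ext i
  rw [chartDiff_mul hu hv (mem_extChartAt_target (I := 𝓡∂ n) p), (extChartAt (𝓡∂ n) p).left_inv hp]
  rfl

theorem cometric_mul_right (g : Metric n M) (w : M → ℝ) {u v : M → ℝ}
    (hu : ContMDiff (𝓡∂ n) 𝓘(ℝ, ℝ) ∞ u) (hv : ContMDiff (𝓡∂ n) 𝓘(ℝ, ℝ) ∞ v) (p : M) :
    cometric g w (fun q => u q * v q) p = u p * cometric g w v p + v p * cometric g w u p := by
  unfold cometric
  rw [diffVec_mul hu hv, mulVec_add, mulVec_smul, mulVec_smul, dotProduct_add, dotProduct_smul,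
    dotProduct_smul]
  rfl

theorem cometric_mul_left (g : Metric n M) (w : M → ℝ) {u v : M → ℝ}
    (hu : ContMDiff (𝓡∂ n) 𝓘(ℝ, ℝ) ∞ u) (hv : ContMDiff (𝓡∂ n) 𝓘(ℝ, ℝ) ∞ v) (p : M) :
    cometric g (fun q => u q * v q) w p = u p * cometric g v w p + v p * cometric g u w p := by
  rw [cometric_comm, cometric_mul_right g w hu hv, cometric_comm g w v, cometric_comm g w u]

/-- The flux obeys the Leibniz rule. Differentiating it gives the two second-order terms and two
cross terms, each equal to `⟨du, dv⟩` by symmetry. Derivatives within the half space make this valid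
at boundary points too. -/
theorem laplacian_mul (g : Metric n M) {u v : M → ℝ} (hu : ContMDiff (𝓡∂ n) 𝓘(ℝ, ℝ) ∞ u)
    (hv : ContMDiff (𝓡∂ n) 𝓘(ℝ, ℝ) ∞ v) (p : M) :
    laplacian g (fun q => u q * v q) p =
      u p * laplacian g v p + v p * laplacian g u p + 2 * cometric g u v p := by
  have hp := mem_extChartAt_source (I := 𝓡∂ n) p
  have ht := mem_extChartAt_target (I := 𝓡∂ n) p
  have hmd : ∀ {w : M → ℝ}, ContMDiff (𝓡∂ n) 𝓘(ℝ, ℝ) ∞ w → MDifferentiableAt (𝓡∂ n) 𝓘(ℝ, ℝ) w p :=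
    fun hw => hw.mdifferentiableAt (by simp)
  rw [laplacian_eq g (contMDiff_mul hu hv), laplacian_eq g hu, laplacian_eq g hv]
  set z := extChartAt (𝓡∂ n) p p with hz
  set e := extChartAt (𝓡∂ n) p with he
  have hun : UniqueDiffWithinAt ℝ (range (𝓡∂ n)) z :=
    (𝓡∂ n).uniqueDiffOn z (extChartAt_target_subset_range (I := 𝓡∂ n) p ht)
  have hd : ∀ {w : Model n → ℝ}, ContDiffOn ℝ ∞ w e.target →
      DifferentiableWithinAt ℝ w (range (𝓡∂ n)) z := by
    intro w hw
    refine ((hw z ht).differentiableWithinAt (by simp)).mono_of_mem_nhdsWithin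
      (extChartAt_target_mem_nhdsWithin (I := 𝓡∂ n) p)
  have hfl : ∀ y ∈ e.target, ∀ i, chartFlux g (fun q => u q * v q) p i y =
      (u ∘ e.symm) y * chartFlux g v p i y + (v ∘ e.symm) y * chartFlux g u p i y := by
    intro y hy i
    simp only [chartFlux, chartGradient, mulVec, dotProduct, Finset.mul_sum,
      ← Finset.sum_add_distrib]
    refine Finset.sum_congr rfl fun j _ => ?_
    rw [chartDiff_mul hu hv hy]
    simp only [Function.comp_apply]
    ring
  have hder : ∀ i, fderivWithin ℝ (chartFlux g (fun q => u q * v q) p i) (range (𝓡∂ n)) z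
      (EuclideanSpace.single i 1) =
      u p * fderivWithin ℝ (chartFlux g v p i) (range (𝓡∂ n)) z (EuclideanSpace.single i 1) +
      v p * fderivWithin ℝ (chartFlux g u p i) (range (𝓡∂ n)) z (EuclideanSpace.single i 1) +
      (chartFlux g v p i z * chartDiff u p z i + chartFlux g u p i z * chartDiff v p z i) := by
    intro i
    have hev := eventually_of_mem (extChartAt_target_mem_nhdsWithin (I := 𝓡∂ n) p)
      (fun y hy => hfl y hy i)
    have du := hd (contDiffOn_comp_chart_symm hu p)
    have dv := hd (contDiffOn_comp_chart_symm hv p)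
    have dfu := hd (contDiffOn_chartFlux g hu p i)
    have dfv := hd (contDiffOn_chartFlux g hv p i)
    have hup : (u ∘ e.symm) z = u p := by simp [hz, e.left_inv hp]
    have hvp : (v ∘ e.symm) z = v p := by simp [hz, e.left_inv hp]
    rw [Filter.EventuallyEq.fderivWithin_eq hev (hfl z ht i),
      fderivWithin_fun_add hun (du.fun_mul dfv) (dv.fun_mul dfu), fderivWithin_fun_mul hun du dfv,
      fderivWithin_fun_mul hun dv dfu, hup, hvp]
    simp only [_root_.add_apply, _root_.smul_apply, smul_eq_mul, chartDiff]
    ring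
  have hs : √(chartGram g p z).det ≠ 0 := (Real.sqrt_pos.2 (chartGram_det_pos g hp)).ne'
  have hc1 : cometric g u v p = ∑ i, chartDiff u p z i * chartGradient g v p z i :=
    cometric_eq_chart g hp (hmd hu) (hmd hv)
  have hc2 : cometric g u v p = ∑ i, chartDiff v p z i * chartGradient g u p z i := by
    rw [cometric_comm]
    exact cometric_eq_chart g hp (hmd hv) (hmd hu)
  rw [Finset.sum_congr rfl fun i _ => hder i]
  simp only [Finset.sum_add_distrib, ← Finset.mul_sum]
  have hsum : ∀ a b : M → ℝ, ∑ i, chartFlux g a p i z * chartDiff b p z i =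
      √(chartGram g p z).det * ∑ i, chartDiff b p z i * chartGradient g a p z i := by
    intro a b
    rw [Finset.mul_sum]
    exact Finset.sum_congr rfl fun i _ => by unfold chartFlux; ring
  rw [hsum, hsum, ← hc1, ← hc2]
  field_simp
  ring

theorem etaLaplacian_mul (g : Metric n M) (η : M → ℝ) {u v : M → ℝ}
    (hu : ContMDiff (𝓡∂ n) 𝓘(ℝ, ℝ) ∞ u) (hv : ContMDiff (𝓡∂ n) 𝓘(ℝ, ℝ) ∞ v) (p : M) :
    etaLaplacian g η (fun q => u q * v q) p =
      u p * etaLaplacian g η v p + v p * etaLaplacian g η u p + 2 * cometric g u v p := by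
  simp only [etaLaplacian, inner_riemannianGradient]
  rw [laplacian_mul g hu hv, cometric_mul_right g η hu hv]
  ring

end ProductRules

end EtaLaplacian

namespace EtaLaplacian

/-! ### The Riemannian volume in charts and under a change of metric -/

variable {n : ℕ} [NeZero n] {M : Type*} [TopologicalSpace M]
  [ChartedSpace (EuclideanHalfSpace n) M] [IsManifold (𝓡∂ n) ∞ M]

section Volume

theorem measurableSet_chart_target (x : M) : MeasurableSet (extChartAt (𝓡∂ n) x).target := by
  rw [extChartAt_target]
  exact ((chartAt (EuclideanHalfSpace n) x).open_target.preimage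
    (𝓡∂ n).continuous_symm).measurableSet.inter (𝓡∂ n).isClosed_range.measurableSet

variable [MeasurableSpace M] [BorelSpace M]

theorem measurableSet_chart_source (x : M) : MeasurableSet (extChartAt (𝓡∂ n) x).source :=
  (isOpen_extChartAt_source x).measurableSet

theorem measurableSet_preimage_chart_symm (x : M) {S : Set M} (hS : MeasurableSet S) :
    MeasurableSet ((extChartAt (𝓡∂ n) x).symm ⁻¹' S ∩ (extChartAt (𝓡∂ n) x).target) := by
  have h1 : Measurable ((extChartAt (𝓡∂ n) x).target.domRestrict (extChartAt (𝓡∂ n) x).symm) :=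
    (continuousOn_iff_continuous_domRestrict.1 (continuousOn_extChartAt_symm x)).measurable
  have h2 := MeasurableSet.subtype_image (measurableSet_chart_target x) (h1 hS)
  convert h2 using 1
  ext y
  simp [and_comm]

theorem aemeasurable_chart_symm (g : Metric n M) (x : M) :
    AEMeasurable (extChartAt (𝓡∂ n) x).symm
      (((volume : Measure (Model n)).restrict (extChartAt (𝓡∂ n) x).target).withDensity
        (fun y => ENNReal.ofReal (√(chartGram g x y).det))) :=
  ((continuousOn_extChartAt_symm x).aemeasurable (measurableSet_chart_target x)).mono_ac
    (withDensity_absolutelyContinuous _ _)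

theorem chartVolume_apply (g : Metric n M) (x : M) {S : Set M} (hS : MeasurableSet S) :
    chartVolume g x S = ∫⁻ y in (extChartAt (𝓡∂ n) x).symm ⁻¹' S ∩ (extChartAt (𝓡∂ n) x).target,
      ENNReal.ofReal (√(chartGram g x y).det) := by
  unfold chartVolume
  rw [Measure.map_apply_of_aemeasurable (aemeasurable_chart_symm g x) hS, withDensity_apply',
    Measure.restrict_restrict' (measurableSet_chart_target x)]

theorem chartVolume_compl_source (g : Metric n M) (x : M) :
    chartVolume g x (extChartAt (𝓡∂ n) x).sourceᶜ = 0 := by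
  rw [chartVolume_apply g x (measurableSet_chart_source x).compl]
  have : (extChartAt (𝓡∂ n) x).symm ⁻¹' (extChartAt (𝓡∂ n) x).sourceᶜ ∩
      (extChartAt (𝓡∂ n) x).target = ∅ := by
    ext y
    simp only [mem_inter_iff, mem_preimage, mem_compl_iff, mem_empty_iff_false, iff_false, not_and]
    exact fun h hy => h ((extChartAt (𝓡∂ n) x).map_target hy)
  rw [this]
  simp

theorem chartVolume_restrict_source (g : Metric n M) (x : M) :
    (chartVolume g x).restrict (extChartAt (𝓡∂ n) x).source = chartVolume g x :=
  Measure.restrict_eq_self_of_ae_mem (by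
    rw [ae_iff]; exact chartVolume_compl_source g x)

theorem det_tangentCoordChange (x x' p : M) :
    (tangentCoordChange (𝓡∂ n) x x' p : Model n →L[ℝ] Model n).det = (transition n x x' p).det := by
  set b := (EuclideanSpace.basisFun (Fin n) ℝ).toBasis
  change LinearMap.det _ = _
  rw [← LinearMap.det_toMatrix b]
  congr 1

/-- Change of variables along the transition map: its Jacobian is exactly the factor between the two
densities `√(det g)`. -/
theorem chartVolume_eq_of_subset (g : Metric n M) {x x' : M} {S : Set M} (hS : MeasurableSet S)
    (h : S ⊆ (extChartAt (𝓡∂ n) x).source) (h' : S ⊆ (extChartAt (𝓡∂ n) x').source) :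
    chartVolume g x S = chartVolume g x' S := by
  rw [chartVolume_apply g x hS, chartVolume_apply g x' hS]
  set e := extChartAt (𝓡∂ n) x with he
  set e' := extChartAt (𝓡∂ n) x' with he'
  have himg : (e' ∘ e.symm) '' (e.symm ⁻¹' S ∩ e.target) = e'.symm ⁻¹' S ∩ e'.target := by
    ext z
    constructor
    · rintro ⟨y, ⟨hy1, hy2⟩, rfl⟩
      have := h' hy1
      refine ⟨?_, e'.map_source this⟩
      simp only [mem_preimage, Function.comp_apply, e'.left_inv this]
      exact hy1
    · rintro ⟨hz1, hz2⟩
      have h1 := h hz1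
      refine ⟨e (e'.symm z), ⟨?_, e.map_source h1⟩, ?_⟩
      · simp only [mem_preimage, e.left_inv h1]; exact hz1
      · simp only [Function.comp_apply, e.left_inv h1, e'.right_inv hz2]
  have hinj : InjOn (e' ∘ e.symm) (e.symm ⁻¹' S ∩ e.target) := by
    rintro y ⟨hy1, hy2⟩ w ⟨hw1, hw2⟩ hyw
    have h1 := e'.injOn (h' hy1) (h' hw1) hyw
    exact e.symm.injOn hy2 hw2 h1
  rw [← himg, lintegral_image_eq_lintegral_abs_det_fderiv_mul volume
    (measurableSet_preimage_chart_symm x hS)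
    (f' := fun y => tangentCoordChange (𝓡∂ n) x x' (e.symm y)) ?_ hinj]
  · refine setLIntegral_congr_fun (measurableSet_preimage_chart_symm x hS) fun y hy => ?_
    have h1 := sqrt_chartGram_det_transition g (h hy.1) (h' hy.1)
    rw [← he, ← he', e.right_inv hy.2] at h1
    simp only [h1, Function.comp_apply]
    rw [ENNReal.ofReal_mul (abs_nonneg _), det_tangentCoordChange]
  · rintro y ⟨hy1, hy2⟩
    have := hasFDerivWithinAt_tangentCoordChange (I := 𝓡∂ n) (x := x) (y := x') (z := e.symm y)
      ⟨h hy1, h' hy1⟩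
    rw [← he, ← he', e.right_inv hy2] at this
    exact this.mono (inter_subset_right.trans (extChartAt_target_subset_range (I := 𝓡∂ n) x))

/-- On the domain `U` of the chart at `x`, every other chart measure is dominated by `chartVolume g
x`. So `chartVolume g x`, plus the full volume restricted to the complement of `U`, is an upper
bound of all chart measures and dominates their supremum; restriction to `U` removes the second
summand. -/
theorem riemannianVolume_restrict_source (g : Metric n M) (x : M) :
    (riemannianVolume g).restrict (extChartAt (𝓡∂ n) x).source = chartVolume g x := by
  set U := (extChartAt (𝓡∂ n) x).source with hU
  have hUm : MeasurableSet U := measurableSet_chart_source x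
  apply le_antisymm
  · have hle : riemannianVolume g ≤ chartVolume g x + (riemannianVolume g).restrict Uᶜ := by
      refine iSup_le fun x' => ?_
      rw [← Measure.restrict_add_restrict_compl (μ := chartVolume g x') hUm]
      refine add_le_add ?_ (Measure.restrict_mono le_rfl (le_iSup (chartVolume g) x'))
      refine Measure.le_iff.2 fun S hS => ?_
      rw [Measure.restrict_apply hS, ← chartVolume_restrict_source g x',
        Measure.restrict_apply (hS.inter hUm)]
      rw [chartVolume_eq_of_subset g (x := x') (x' := x)
        ((hS.inter hUm).inter (measurableSet_chart_source x')) inter_subset_right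
        (inter_subset_left.trans inter_subset_right)]
      exact measure_mono (inter_subset_left.trans inter_subset_left)
    calc (riemannianVolume g).restrict U
        ≤ (chartVolume g x + (riemannianVolume g).restrict Uᶜ).restrict U :=
          Measure.restrict_mono le_rfl hle
      _ = chartVolume g x := by
          rw [Measure.restrict_add, Measure.restrict_restrict hUm, inter_compl_self,
            Measure.restrict_empty, add_zero, chartVolume_restrict_source]
  · rw [← chartVolume_restrict_source]
    exact Measure.restrict_mono le_rfl (le_iSup (chartVolume g) x)

/-- The density of the volume of `g'` with respect to the volume of `g`. -/
noncomputable def volumeRatio (g g' : Metric n M) (p : M) : ℝ :=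
  √((gram g' p).det / (gram g p).det)

theorem volumeRatio_eq_chart (g g' : Metric n M) {x p : M}
    (h : p ∈ (extChartAt (𝓡∂ n) x).source) :
    volumeRatio g g' p = √(chartGram g' x (extChartAt (𝓡∂ n) x p)).det /
      √(chartGram g x (extChartAt (𝓡∂ n) x p)).det := by
  have h1 := transition_det_ne_zero h (mem_extChartAt_source (I := 𝓡∂ n) p)
  rw [← Real.sqrt_div (chartGram_det_pos g' h).le, chartGram_det_eq g h, chartGram_det_eq g' h,
    volumeRatio, mul_div_mul_left _ _ (pow_ne_zero 2 h1)]

theorem continuous_volumeRatio (g g' : Metric n M) : Continuous (volumeRatio g g') := by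
  rw [continuous_iff_continuousAt]
  intro x
  have h1 : ContinuousOn (fun y => √(chartGram g' x y).det / √(chartGram g x y).det)
      (extChartAt (𝓡∂ n) x).target :=
    (contDiffOn_sqrt_chartGram_det g' x).continuousOn.div
      (contDiffOn_sqrt_chartGram_det g x).continuousOn
      fun y hy => (Real.sqrt_pos.2 (chartGram_det_pos_of_mem_target g hy)).ne'
  have h2 := h1.comp (continuousOn_extChartAt x) (extChartAt (𝓡∂ n) x).mapsTo
  refine (h2.continuousAt (extChartAt_source_mem_nhds (I := 𝓡∂ n) x)).congr ?_
  filter_upwards [extChartAt_source_mem_nhds (I := 𝓡∂ n) x] with p hp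
  exact (volumeRatio_eq_chart g g' hp).symm

theorem lintegral_chartVolume (g : Metric n M) (x : M) {f : M → ENNReal} (hf : Measurable f) :
    ∫⁻ p, f p ∂(chartVolume g x) = ∫⁻ y in (extChartAt (𝓡∂ n) x).target,
      ENNReal.ofReal (√(chartGram g x y).det) * f ((extChartAt (𝓡∂ n) x).symm y) := by
  have hm : AEMeasurable (fun y => ENNReal.ofReal (√(chartGram g x y).det))
      ((volume : Measure (Model n)).restrict (extChartAt (𝓡∂ n) x).target) :=
    ((contDiffOn_sqrt_chartGram_det g x).continuousOn.aemeasurable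
      (measurableSet_chart_target x)).ennreal_ofReal
  unfold chartVolume
  rw [lintegral_map' hf.aemeasurable (aemeasurable_chart_symm g x),
    lintegral_withDensity_eq_lintegral_mul₀ hm]
  · rfl
  · exact hf.comp_aemeasurable ((continuousOn_extChartAt_symm x).aemeasurable
      (measurableSet_chart_target x))

theorem chartVolume_withDensity_volumeRatio (g g' : Metric n M) (x : M) :
    (chartVolume g x).withDensity (fun p => ENNReal.ofReal (volumeRatio g g' p)) =
      chartVolume g' x := by
  have hr : Measurable (fun p => ENNReal.ofReal (volumeRatio g g' p)) :=
    (continuous_volumeRatio g g').measurable.ennreal_ofReal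
  ext S hS
  rw [withDensity_apply _ hS, ← lintegral_indicator hS, ← lintegral_indicator_one hS,
    lintegral_chartVolume g x (hr.indicator hS),
    lintegral_chartVolume g' x (measurable_one.indicator hS)]
  refine setLIntegral_congr_fun (measurableSet_chart_target x) fun y hy => ?_
  have hp := (extChartAt (𝓡∂ n) x).map_target hy
  by_cases hyS : (extChartAt (𝓡∂ n) x).symm y ∈ S
  · simp only [indicator_of_mem hyS, Pi.one_apply, mul_one]
    rw [← ENNReal.ofReal_mul (Real.sqrt_nonneg _), volumeRatio_eq_chart g g' hp,
      (extChartAt (𝓡∂ n) x).right_inv hy]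
    have := (Real.sqrt_pos.2 (chartGram_det_pos_of_mem_target g hy)).ne'
    congr 1
    field_simp
  · simp only [indicator_of_notMem hyS, mul_zero]

variable [CompactSpace M]

theorem exists_finset_cover_chart_source :
    ∃ t : Finset M, ⋃ x ∈ t, (extChartAt (𝓡∂ n) x).source = univ := by
  obtain ⟨t, -, ht⟩ := isCompact_univ.elim_nhds_subcover (fun x : M => (extChartAt (𝓡∂ n) x).source)
    fun x _ => extChartAt_source_mem_nhds (I := 𝓡∂ n) x
  exact ⟨t, univ_subset_iff.1 ht⟩

theorem riemannianVolume_withDensity_volumeRatio (g g' : Metric n M) :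
    (riemannianVolume g).withDensity (fun p => ENNReal.ofReal (volumeRatio g g' p)) =
      riemannianVolume g' := by
  obtain ⟨t, ht⟩ := exists_finset_cover_chart_source (n := n) (M := M)
  refine (Measure.ext_iff_of_biUnion_eq_univ t.countable_toSet ht).2 fun x _ => ?_
  rw [restrict_withDensity (measurableSet_chart_source x), riemannianVolume_restrict_source,
    riemannianVolume_restrict_source, chartVolume_withDensity_volumeRatio]

/-- Every point has a neighbourhood on which both the coordinates and the density are bounded, hence
one of finite volume; compactness does the rest. -/
instance isFiniteMeasure_riemannianVolume (g : Metric n M) :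
    IsFiniteMeasure (riemannianVolume g) := by
  refine ⟨isCompact_univ.measure_lt_top_of_nhdsWithin fun x _ => ?_⟩
  rw [nhdsWithin_univ]
  set e := extChartAt (𝓡∂ n) x with he
  set C : ℝ := √(chartGram g x (e x)).det + 1 with hC
  have hc1 : ContinuousAt (fun p => √(chartGram g x (e p)).det) x :=
    ((contDiffOn_sqrt_chartGram_det g x).continuousOn.comp (continuousOn_extChartAt x)
      e.mapsTo).continuousAt (extChartAt_source_mem_nhds (I := 𝓡∂ n) x)
  have hc2 : ContinuousAt (fun p => ‖e p‖) x := (continuousAt_extChartAt x).norm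
  have hU : ∀ᶠ p in 𝓝 x, p ∈ e.source ∧ √(chartGram g x (e p)).det < C ∧ ‖e p‖ < ‖e x‖ + 1 := by
    filter_upwards [extChartAt_source_mem_nhds (I := 𝓡∂ n) x,
      hc1.eventually (gt_mem_nhds (lt_add_one _)), hc2.eventually (gt_mem_nhds (lt_add_one _))]
      with p h1 h2 h3
    exact ⟨h1, h2, h3⟩
  obtain ⟨U, hUs, hUo, hxU⟩ := eventually_nhds_iff.1 hU
  refine ⟨U, hUo.mem_nhds hxU, ?_⟩
  have hUsrc : U ⊆ e.source := fun p hp => (hUs p hp).1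
  have h1 : riemannianVolume g U = chartVolume g x U := by
    rw [← riemannianVolume_restrict_source g x, Measure.restrict_apply hUo.measurableSet,
      inter_eq_left.2 hUsrc]
  rw [h1, chartVolume_apply g x hUo.measurableSet]
  have hsub : e.symm ⁻¹' U ∩ e.target ⊆ Metric.ball 0 (‖e x‖ + 1) := by
    rintro y ⟨hy1, hy2⟩
    have := (hUs _ hy1).2.2
    rw [e.right_inv hy2] at this
    simpa using this
  calc ∫⁻ y in e.symm ⁻¹' U ∩ e.target, ENNReal.ofReal (√(chartGram g x y).det)
      ≤ ∫⁻ y in e.symm ⁻¹' U ∩ e.target, ENNReal.ofReal C := by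
        refine setLIntegral_mono' (measurableSet_preimage_chart_symm x hUo.measurableSet) ?_
        rintro y ⟨hy1, hy2⟩
        have := (hUs _ hy1).2.1
        rw [e.right_inv hy2] at this
        exact ENNReal.ofReal_le_ofReal this.le
    _ = ENNReal.ofReal C * volume (e.symm ⁻¹' U ∩ e.target) := by rw [setLIntegral_const]
    _ ≤ ENNReal.ofReal C * volume (Metric.ball (0 : Model n) (‖e x‖ + 1)) := by gcongr
    _ < ⊤ := ENNReal.mul_lt_top ENNReal.ofReal_lt_top measure_ball_lt_top

theorem isFiniteMeasure_weightedVolume (g : Metric n M) {η : M → ℝ} (hη : Continuous η) :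
    IsFiniteMeasure (weightedVolume g η) := by
  have hc : Continuous fun p => Real.exp (-η p) := Real.continuous_exp.comp hη.neg
  obtain ⟨C, hC⟩ := (isCompact_range hc).bddAbove
  refine isFiniteMeasure_withDensity_ofReal (f := fun p => Real.exp (-η p)) ?_
  have : Integrable (fun p => Real.exp (-η p)) (riemannianVolume g) :=
    Integrable.of_bound hc.measurable.aestronglyMeasurable C (Eventually.of_forall fun p => by
      rw [Real.norm_of_nonneg (Real.exp_pos _).le]; exact hC ⟨p, rfl⟩)
  exact this.2

/-- The density of `e^{-η'} dV_{g'}` with respect to `e^{-η} dV_g`. -/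
noncomputable def weightRatio (g g' : Metric n M) (η η' : M → ℝ) (p : M) : ℝ :=
  volumeRatio g g' p * Real.exp (η p - η' p)

theorem continuous_weightRatio (g g' : Metric n M) {η η' : M → ℝ} (hη : Continuous η)
    (hη' : Continuous η') : Continuous (weightRatio g g' η η') :=
  (continuous_volumeRatio g g').mul (Real.continuous_exp.comp (hη.sub hη'))

theorem weightRatio_nonneg (g g' : Metric n M) (η η' : M → ℝ) (p : M) :
    0 ≤ weightRatio g g' η η' p := mul_nonneg (Real.sqrt_nonneg _) (Real.exp_pos _).le

theorem weightedVolume_eq_withDensity (g g' : Metric n M) {η η' : M → ℝ} (hη : Continuous η)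
    (hη' : Continuous η') : weightedVolume g' η' =
      (weightedVolume g η).withDensity (fun p => ENNReal.ofReal (weightRatio g g' η η' p)) := by
  have hm : ∀ {ζ : M → ℝ}, Continuous ζ →
      Measurable fun p => ENNReal.ofReal (Real.exp (-ζ p)) := fun h =>
    (Real.continuous_exp.comp h.neg).measurable.ennreal_ofReal
  unfold weightedVolume
  rw [← riemannianVolume_withDensity_volumeRatio g g',
    ← withDensity_mul _ (continuous_volumeRatio g g').measurable.ennreal_ofReal (hm hη'),
    ← withDensity_mul _ (hm hη) (continuous_weightRatio g g' hη hη').measurable.ennreal_ofReal]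
  congr 1
  ext p
  simp only [Pi.mul_apply]
  rw [← ENNReal.ofReal_mul (show 0 ≤ volumeRatio g g' p from Real.sqrt_nonneg _),
    ← ENNReal.ofReal_mul (Real.exp_pos _).le]
  congr 1
  rw [weightRatio, mul_left_comm, ← Real.exp_add]
  congr 2
  ring

/-- With this, all integrals against `dm_t` become integrals against the fixed measure `dm_0`, and
the dependence on `t` moves into the integrand. -/
theorem integral_weightedVolume_eq (g g' : Metric n M) {η η' : M → ℝ} (hη : Continuous η)
    (hη' : Continuous η') (f : M → ℝ) : ∫ p, f p ∂(weightedVolume g' η') =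
      ∫ p, weightRatio g g' η η' p * f p ∂(weightedVolume g η) := by
  rw [weightedVolume_eq_withDensity g g' hη hη', integral_withDensity_eq_integral_toReal_smul
    (continuous_weightRatio g g' hη hη').measurable.ennreal_ofReal
    (Eventually.of_forall fun _ => ENNReal.ofReal_lt_top)]
  simp only [ENNReal.toReal_ofReal (weightRatio_nonneg _ _ _ _ _), smul_eq_mul]

theorem integral_weightedVolume_of_support (g : Metric n M) {η : M → ℝ} (hη : Continuous η) {x : M}
    {f : M → ℝ} (hf : Function.support f ⊆ (extChartAt (𝓡∂ n) x).source) (hfm : Measurable f) :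
    ∫ p, f p ∂(weightedVolume g η) = ∫ y in (extChartAt (𝓡∂ n) x).target,
      √(chartGram g x y).det * (Real.exp (-η ((extChartAt (𝓡∂ n) x).symm y)) *
        f ((extChartAt (𝓡∂ n) x).symm y)) := by
  have hexp : Continuous fun p => Real.exp (-η p) := Real.continuous_exp.comp hη.neg
  have hm : AEMeasurable (fun y => ENNReal.ofReal (√(chartGram g x y).det))
      ((volume : Measure (Model n)).restrict (extChartAt (𝓡∂ n) x).target) :=
    ((contDiffOn_sqrt_chartGram_det g x).continuousOn.aemeasurable
      (measurableSet_chart_target x)).ennreal_ofReal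
  unfold weightedVolume
  rw [integral_withDensity_eq_integral_toReal_smul hexp.measurable.ennreal_ofReal
    (Eventually.of_forall fun _ => ENNReal.ofReal_lt_top)]
  simp only [ENNReal.toReal_ofReal (Real.exp_pos _).le, smul_eq_mul]
  rw [← setIntegral_eq_integral_of_forall_compl_eq_zero (s := (extChartAt (𝓡∂ n) x).source)
    (fun p hp => by rw [Function.notMem_support.1 fun h => hp (hf h), mul_zero]),
    riemannianVolume_restrict_source]
  unfold chartVolume
  rw [integral_map (aemeasurable_chart_symm g x) (hexp.measurable.fun_mul hfm).aestronglyMeasurable,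
    integral_withDensity_eq_integral_toReal_smul₀ hm
      (Eventually.of_forall fun _ => ENNReal.ofReal_lt_top)]
  simp only [ENNReal.toReal_ofReal (Real.sqrt_nonneg _), smul_eq_mul]

end Volume

end EtaLaplacian

namespace EtaLaplacian

/-! ### Green's formula -/

variable {n : ℕ} [NeZero n] {M : Type*} [TopologicalSpace M]
  [ChartedSpace (EuclideanHalfSpace n) M] [IsManifold (𝓡∂ n) ∞ M]

open Matrix

section Green

theorem volume_coord_eq_zero : volume {y : Model n | y 0 = 0} = 0 := by
  set L : Model n →ₗ[ℝ] ℝ := (EuclideanSpace.proj (0 : Fin n) : Model n →L[ℝ] ℝ).toLinearMap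
  have h := Measure.addHaar_submodule (volume : Measure (Model n)) (LinearMap.ker L) (by
    intro htop
    have h1 : (EuclideanSpace.single (0 : Fin n) (1 : ℝ) : Model n) ∈ LinearMap.ker L := by
      rw [htop]; trivial
    simp [L] at h1)
  exact h

theorem diffVec_eq_zero_of_notMem_tsupport {u : M → ℝ} {p : M} (hp : p ∉ tsupport u) :
    diffVec (n := n) u p = 0 := by
  have h : u =ᶠ[𝓝 p] fun _ => 0 := notMem_tsupport_iff_eventuallyEq.1 hp
  ext i
  have h2 : mfderiv (𝓡∂ n) 𝓘(ℝ, ℝ) u p = mfderiv (𝓡∂ n) 𝓘(ℝ, ℝ) (fun _ : M => (0 : ℝ)) p :=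
    h.mfderiv_eq
  have h3 : mfderiv (𝓡∂ n) 𝓘(ℝ, ℝ) (fun _ : M => (0 : ℝ)) p = 0 := mfderiv_const
  unfold diffVec differential
  rw [h2, h3]
  rfl

theorem contMDiff_exp_neg {η : M → ℝ} (hη : ContMDiff (𝓡∂ n) 𝓘(ℝ, ℝ) ∞ η) :
    ContMDiff (𝓡∂ n) 𝓘(ℝ, ℝ) ∞ fun q => Real.exp (-η q) := by
  have : ContDiff ℝ ∞ fun s : ℝ => Real.exp (-s) := Real.contDiff_exp.comp contDiff_neg
  exact this.contMDiff.comp hη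

theorem differentiableWithinAt_comp_chart_symm {w : M → ℝ} (hw : ContMDiff (𝓡∂ n) 𝓘(ℝ, ℝ) ∞ w)
    {x : M} {y : Model n} (hy : y ∈ (extChartAt (𝓡∂ n) x).target) :
    DifferentiableWithinAt ℝ (w ∘ (extChartAt (𝓡∂ n) x).symm) (range (𝓡∂ n)) y :=
  (((contDiffOn_comp_chart_symm hw x) y hy).differentiableWithinAt
    (by simp)).mono_of_mem_nhdsWithin (extChartAt_target_mem_nhdsWithin_of_mem hy)

theorem uniqueDiffWithinAt_range_of_mem_target {x : M} {y : Model n}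
    (hy : y ∈ (extChartAt (𝓡∂ n) x).target) : UniqueDiffWithinAt ℝ (range (𝓡∂ n)) y :=
  (𝓡∂ n).uniqueDiffOn y (extChartAt_target_subset_range (I := 𝓡∂ n) x hy)

theorem chartDiff_exp_neg {η : M → ℝ} (hη : ContMDiff (𝓡∂ n) 𝓘(ℝ, ℝ) ∞ η) {x : M} {y : Model n}
    (hy : y ∈ (extChartAt (𝓡∂ n) x).target) (i : Fin n) :
    chartDiff (fun q => Real.exp (-η q)) x y i =
      -(Real.exp (-η ((extChartAt (𝓡∂ n) x).symm y)) * chartDiff η x y i) := by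
  have hun := uniqueDiffWithinAt_range_of_mem_target hy
  have h1 := (differentiableWithinAt_comp_chart_symm hη hy).hasFDerivWithinAt.neg.exp
  have h2 := h1.fderivWithin hun
  unfold chartDiff
  have e : (fun q => Real.exp (-η q)) ∘ (extChartAt (𝓡∂ n) x).symm =
    fun y => Real.exp ((-(η ∘ (extChartAt (𝓡∂ n) x).symm)) y) := rfl
  rw [e, h2]
  simp

theorem diffVec_sum {ι : Type*} (T : Finset ι) {u : ι → M → ℝ}
    (hu : ∀ i ∈ T, ContMDiff (𝓡∂ n) 𝓘(ℝ, ℝ) ∞ (u i))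
    (hs : ContMDiff (𝓡∂ n) 𝓘(ℝ, ℝ) ∞ fun q => ∑ i ∈ T, u i q) (p : M) :
    diffVec (n := n) (fun q => ∑ i ∈ T, u i q) p = ∑ i ∈ T, diffVec (u i) p := by
  have ht := mem_extChartAt_target (I := 𝓡∂ n) p
  rw [diffVec_eq_chartDiff (hs.mdifferentiableAt (by simp)), Finset.sum_congr rfl fun i hi =>
    diffVec_eq_chartDiff ((hu i hi).mdifferentiableAt (by simp))]
  ext k
  have e : (fun q => ∑ i ∈ T, u i q) ∘ (extChartAt (𝓡∂ n) p).symm =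
    fun y => ∑ i ∈ T, (u i ∘ (extChartAt (𝓡∂ n) p).symm) y := rfl
  have h := fderivWithin_fun_sum (𝕜 := ℝ) (u := T)
    (A := fun i => u i ∘ (extChartAt (𝓡∂ n) p).symm) (uniqueDiffWithinAt_range_of_mem_target ht)
    (fun i hi => differentiableWithinAt_comp_chart_symm (hu i hi) ht)
  rw [Finset.sum_apply]
  unfold chartDiff
  rw [e, h]
  simp

variable [MeasurableSpace M] [BorelSpace M] [CompactSpace M] [T2Space M]

theorem integrable_of_continuous {μ : Measure M} [IsFiniteMeasure μ] {f : M → ℝ}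
    (hf : Continuous f) : Integrable f μ := by
  obtain ⟨C, hC⟩ := isCompact_univ.exists_bound_of_continuousOn hf.continuousOn
  exact Integrable.of_bound hf.measurable.aestronglyMeasurable C
    (Eventually.of_forall fun p => hC p (mem_univ p))

/-- In the chart, the integrand times the density is the Euclidean divergence of `e^{-η} u √(det g)
∇f`: differentiating `e^{-η}` supplies the drift term `-g(∇η, ∇f)` of the operator. The divergence
theorem on the half space then applies. -/
theorem integral_green_of_tsupport_subset (g : Metric n M) {η f u : M → ℝ}
    (hη : ContMDiff (𝓡∂ n) 𝓘(ℝ, ℝ) ∞ η) (hf : ContMDiff (𝓡∂ n) 𝓘(ℝ, ℝ) ∞ f)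
    (hu : ContMDiff (𝓡∂ n) 𝓘(ℝ, ℝ) ∞ u) (hu0 : ∀ p ∈ (𝓡∂ n).boundary M, u p = 0)
    (hL : Continuous (etaLaplacian g η f)) {x : M}
    (hsupp : tsupport u ⊆ (extChartAt (𝓡∂ n) x).source) :
    ∫ p, (u p * etaLaplacian g η f p + cometric g u f p) ∂(weightedVolume g η) = 0 := by
  set e := extChartAt (𝓡∂ n) x with he
  set F : M → ℝ := fun p => u p * etaLaplacian g η f p + cometric g u f p with hF
  have hFc : Continuous F := (hu.continuous.mul hL).add (continuous_cometric g hu hf)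
  have hF0 : ∀ p, p ∉ tsupport u → F p = 0 := by
    intro p hp
    simp only [hF, cometric, diffVec_eq_zero_of_notMem_tsupport (n := n) hp,
      image_eq_zero_of_notMem_tsupport hp, zero_dotProduct, zero_mul, add_zero]
  rw [integral_weightedVolume_of_support g hη.continuous (x := x) (f := F)
    (fun p hp => hsupp (by_contra fun h => hp (hF0 p h))) hFc.measurable]
  set K : Set (Model n) := e '' tsupport u with hK
  have hKc : IsCompact K := (isClosed_tsupport u).isCompact.image_of_continuousOn
    ((continuousOn_extChartAt x).mono hsupp)
  have hKt : K ⊆ e.target := by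
    rintro _ ⟨p, hp, rfl⟩; exact e.map_source (hsupp hp)
  have hKmem : ∀ y ∈ e.target, e.symm y ∈ tsupport u → y ∈ K := fun y hy h =>
    ⟨e.symm y, h, e.right_inv hy⟩
  set H : Model n → ℝ := fun y => √(chartGram g x y).det * (Real.exp (-η (e.symm y)) * F (e.symm y))
    with hH
  have hHc : ContinuousOn H e.target :=
    (contDiffOn_sqrt_chartGram_det g x).continuousOn.mul
      (((contMDiff_exp_neg hη).continuous.mul hFc).comp_continuousOn (continuousOn_extChartAt_symm x))
  set w : M → ℝ := fun q => u q * Real.exp (-η q) with hw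
  have hws : ContMDiff (𝓡∂ n) 𝓘(ℝ, ℝ) ∞ w := contMDiff_mul hu (contMDiff_exp_neg hη)
  classical
  -- Extension by zero off the chart. It is as regular as required because the support of `u` has
  -- compact image `K` inside the chart target.
  set V : Fin n → Model n → ℝ := fun i y =>
    if y ∈ e.target then w (e.symm y) * chartFlux g f x i y else 0 with hV
  have hVt : ∀ i, ∀ y ∈ e.target, V i y = (w ∘ e.symm) y * chartFlux g f x i y := fun i y hy => by
    simp only [hV, if_pos hy, Function.comp_apply]
  have hVK : ∀ i, ∀ y, y ∉ K → V i y = 0 := by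
    intro i y hy
    simp only [hV]
    split_ifs with h
    · have : e.symm y ∉ tsupport u := fun h' => hy (hKmem y h h')
      simp only [hw, image_eq_zero_of_notMem_tsupport this, zero_mul]
    · rfl
  have hVKn : ∀ i, ∀ y, y ∉ K → V i =ᶠ[𝓝 y] fun _ => 0 := by
    intro i y hy
    filter_upwards [hKc.isClosed.isOpen_compl.mem_nhds hy] with z hz
    exact hVK i z hz
  have hVsm : ∀ i, ContDiffOn ℝ ∞ (fun y => (w ∘ e.symm) y * chartFlux g f x i y) e.target :=
    fun i => (contDiffOn_comp_chart_symm hws x).mul (contDiffOn_chartFlux g hf x i)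
  have hVd : ∀ i y, 0 < y 0 → DifferentiableAt ℝ (V i) y := by
    intro i y hy
    by_cases hyK : y ∈ K
    · have hn := chart_target_mem_nhds (hKt hyK) hy
      refine (((hVsm i).contDiffAt hn).differentiableAt (by simp)).congr_of_eventuallyEq ?_
      filter_upwards [hn] with z hz
      exact hVt i z hz
    · exact (differentiableAt_const (0 : ℝ)).congr_of_eventuallyEq (hVKn i y hyK)
  have hVc : ∀ i, ContinuousOn (V i) {y : Model n | 0 ≤ y 0} := by
    intro i y hy
    by_cases hyK : y ∈ K
    · have h1 : ContinuousWithinAt (V i) e.target y :=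
        ((hVsm i).continuousOn.congr (hVt i)) y (hKt hyK)
      refine h1.mono_of_mem_nhdsWithin ?_
      rw [← range_halfSpace]
      exact extChartAt_target_mem_nhdsWithin_of_mem (hKt hyK)
    · exact ((continuousAt_const (y := (0 : ℝ))).congr (hVKn i y hyK).symm).continuousWithinAt
  have hV0 : ∀ i y, y 0 = 0 → V i y = 0 := by
    intro i y hy
    simp only [hV]
    split_ifs with h
    · have : e.symm y ∈ (𝓡∂ n).boundary M :=
        mem_boundary_of_coord_eq_zero (x := x) (e.map_target h) (by
          rw [← he, e.right_inv h]; exact hy)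
      simp only [hw, hu0 _ this, zero_mul]
    · rfl
  have hdiv : ∀ y ∈ {y : Model n | 0 < y 0},
      ∑ i, fderiv ℝ (V i) y (EuclideanSpace.single i 1) = K.indicator H y := by
    intro y hy0
    by_cases hyK : y ∈ K
    · rw [indicator_of_mem hyK]
      have hy := hKt hyK
      have hn := chart_target_mem_nhds hy hy0
      have hr : range (𝓡∂ n) ∈ 𝓝 y :=
        mem_of_superset hn (extChartAt_target_subset_range (I := 𝓡∂ n) x)
      have hp := e.map_target hy
      have hi : ∀ i, fderiv ℝ (V i) y (EuclideanSpace.single i 1) =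
          w (e.symm y) * fderiv ℝ (chartFlux g f x i) y (EuclideanSpace.single i 1) +
          chartFlux g f x i y * chartDiff w x y i := by
        intro i
        have hev : V i =ᶠ[𝓝 y] fun y => (w ∘ e.symm) y * chartFlux g f x i y := by
          filter_upwards [hn] with z hz
          exact hVt i z hz
        have hwd : DifferentiableAt ℝ (w ∘ e.symm) y :=
          ((contDiffOn_comp_chart_symm hws x).contDiffAt hn).differentiableAt (by simp)
        have hfd : DifferentiableAt ℝ (chartFlux g f x i) y :=
          ((contDiffOn_chartFlux g hf x i).contDiffAt hn).differentiableAt (by simp)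
        rw [hev.fderiv_eq, fderiv_fun_mul hwd hfd, chartDiff, fderivWithin_of_mem_nhds hr]
        simp only [_root_.add_apply, _root_.smul_apply, smul_eq_mul, Function.comp_apply]
        rfl
      have hcw : ∀ i, chartDiff w x y i = Real.exp (-η (e.symm y)) *
          (chartDiff u x y i - u (e.symm y) * chartDiff η x y i) := by
        intro i
        rw [hw, chartDiff_mul hu (contMDiff_exp_neg hη) hy, chartDiff_exp_neg hη hy]
        ring
      have hc : ∀ a : M → ℝ, ContMDiff (𝓡∂ n) 𝓘(ℝ, ℝ) ∞ a →
          ∑ i, chartDiff a x y i * chartGradient g f x y i = cometric g a f (e.symm y) := by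
        intro a ha
        have := cometric_eq_chart g (u := a) (v := f) hp (ha.mdifferentiableAt (by simp))
          (hf.mdifferentiableAt (by simp))
        rw [← he, e.right_inv hy] at this
        exact this.symm
      have hlap := laplacian_eq_chart g hf hp (by rw [← he, e.right_inv hy]; exact hy0)
      rw [← he, e.right_inv hy] at hlap
      have hsq := (Real.sqrt_pos.2 (chartGram_det_pos_of_mem_target g hy)).ne'
      have hlap' : ∑ i, fderiv ℝ (chartFlux g f x i) y (EuclideanSpace.single i 1) =
          √(chartGram g x y).det * laplacian g f (e.symm y) := by
        rw [hlap]; field_simp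
      rw [Finset.sum_congr rfl fun i _ => hi i, Finset.sum_add_distrib, ← Finset.mul_sum, hlap']
      have hsum : ∑ i, chartFlux g f x i y * chartDiff w x y i =
          √(chartGram g x y).det * Real.exp (-η (e.symm y)) * (cometric g u f (e.symm y) -
            u (e.symm y) * cometric g η f (e.symm y)) := by
        rw [← hc u hu, ← hc η hη, Finset.mul_sum, ← Finset.sum_sub_distrib, Finset.mul_sum]
        refine Finset.sum_congr rfl fun i _ => ?_
        rw [hcw, chartFlux]
        ring
      rw [hsum]
      simp only [hH, hF, hw, etaLaplacian, inner_riemannianGradient]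
      ring
    · rw [indicator_of_notMem hyK]
      refine Finset.sum_eq_zero fun i _ => ?_
      rw [(hVKn i y hyK).fderiv_eq]
      simp
  have hPm : MeasurableSet {y : Model n | 0 < y 0} :=
    (isOpen_lt continuous_const (by fun_prop)).measurableSet
  have hHK : IntegrableOn H K := (hHc.mono hKt).integrableOn_compact hKc
  obtain ⟨R, hR⟩ := hKc.isBounded.exists_norm_le
  have hzero := integral_divergence_halfSpace V R
    (fun i y _ hy => hVK i y fun h => absurd (hR y h) (not_le.2 hy)) hVc hV0 hVd
    (((integrable_indicator_iff hKc.measurableSet).2 hHK).integrableOn.congr_fun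
      (fun y hy => (hdiv y hy).symm) hPm)
  rw [setIntegral_congr_fun hPm hdiv, setIntegral_indicator hKc.measurableSet] at hzero
  -- The divergence is computed only where the first coordinate is positive; the rest of `K` lies in
  -- a null hyperplane.
  have hKae : ({y : Model n | 0 < y 0} ∩ K : Set (Model n)) =ᵐ[volume] K := by
    refine (ae_eq_set).2 ⟨by rw [sdiff_eq_empty.2 inter_subset_right]; simp, ?_⟩
    refine measure_mono_null ?_ (volume_coord_eq_zero (n := n))
    rintro y ⟨hy1, hy2⟩
    have h1 : y ∈ range (𝓡∂ n) := extChartAt_target_subset_range (I := 𝓡∂ n) x (hKt hy1)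
    rw [range_halfSpace] at h1
    exact le_antisymm (not_lt.1 fun h => hy2 ⟨h, hy1⟩) h1
  rw [setIntegral_congr_set hKae] at hzero
  rw [← hzero]
  refine setIntegral_eq_of_subset_of_forall_sdiff_eq_zero (measurableSet_chart_target x) hKt ?_
  rintro y ⟨hy1, hy2⟩
  simp only [hF0 _ fun h => hy2 (hKmem y hy1 h), mul_zero]

/-- Green's formula for a function vanishing on the boundary. -/
theorem integral_green (g : Metric n M) {η f u : M → ℝ}
    (hη : ContMDiff (𝓡∂ n) 𝓘(ℝ, ℝ) ∞ η) (hf : ContMDiff (𝓡∂ n) 𝓘(ℝ, ℝ) ∞ f)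
    (hu : ContMDiff (𝓡∂ n) 𝓘(ℝ, ℝ) ∞ u) (hu0 : ∀ p ∈ (𝓡∂ n).boundary M, u p = 0)
    (hL : Continuous (etaLaplacian g η f)) :
    ∫ p, u p * etaLaplacian g η f p ∂(weightedVolume g η) =
      -∫ p, cometric g u f p ∂(weightedVolume g η) := by
  have := isFiniteMeasure_weightedVolume g hη.continuous
  -- Only `u` is cut off: the identity is linear in `u`, and each `ρ i * u` still vanishes on the
  -- boundary.
  obtain ⟨ρ, hρ⟩ := SmoothPartitionOfUnity.exists_isSubordinate_chartAt_source (𝓡∂ n) M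
  have hfin : {i | (Function.support (ρ i)).Nonempty}.Finite :=
    ρ.locallyFinite.finite_nonempty_of_compact
  set T := hfin.toFinset with hT
  have hsum1 : ∀ q, ∑ i ∈ T, ρ i q = 1 := by
    intro q
    rw [← ρ.sum_eq_one (mem_univ q)]
    refine (finsum_eq_sum_of_support_subset _ ?_).symm
    intro i hi
    simp only [hT, Finite.coe_toFinset, mem_ofPred_eq]
    exact ⟨q, hi⟩
  have hus : ∀ i, ContMDiff (𝓡∂ n) 𝓘(ℝ, ℝ) ∞ fun q => ρ i q * u q := fun i =>
    contMDiff_mul (ρ i).contMDiff hu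
  have husum : (fun q => ∑ i ∈ T, ρ i q * u q) = u := by
    ext q
    rw [← Finset.sum_mul, hsum1, one_mul]
  have hz : ∀ i, ∫ p, ((ρ i p * u p) * etaLaplacian g η f p +
      cometric g (fun q => ρ i q * u q) f p) ∂(weightedVolume g η) = 0 := by
    intro i
    refine integral_green_of_tsupport_subset g hη hf (hus i) (fun p hp => by
      rw [hu0 p hp, mul_zero]) hL (x := i) ?_
    rw [extChartAt_source]
    exact (tsupport_mul_subset_left).trans (hρ i)
  have hcom : ∀ p, cometric g u f p = ∑ i ∈ T, cometric g (fun q => ρ i q * u q) f p := by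
    intro p
    have h := diffVec_sum (n := n) T (u := fun i q => ρ i q * u q) (fun i _ => hus i)
      (by rw [husum]; exact hu) p
    rw [husum] at h
    unfold cometric
    rw [h, sum_dotProduct]
  have hI : ∀ i, Integrable (fun p => (ρ i p * u p) * etaLaplacian g η f p +
      cometric g (fun q => ρ i q * u q) f p) (weightedVolume g η) := fun i =>
    integrable_of_continuous (((hus i).continuous.mul hL).add (continuous_cometric g (hus i) hf))
  have htot : ∫ p, (u p * etaLaplacian g η f p + cometric g u f p) ∂(weightedVolume g η) = 0 := by
    have : ∀ p, u p * etaLaplacian g η f p + cometric g u f p =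
        ∑ i ∈ T, ((ρ i p * u p) * etaLaplacian g η f p +
          cometric g (fun q => ρ i q * u q) f p) := by
      intro p
      rw [Finset.sum_add_distrib, ← hcom, ← Finset.sum_mul, ← Finset.sum_mul, hsum1, one_mul]
    simp_rw [this]
    rw [integral_finsetSum _ fun i _ => hI i]
    exact Finset.sum_eq_zero fun i _ => hz i
  have hi : Integrable (fun p => u p * etaLaplacian g η f p) (weightedVolume g η) :=
    integrable_of_continuous (hu.continuous.mul hL)
  rw [integral_add hi
    (integrable_of_continuous (continuous_cometric g hu hf))] at htot
  linarith

end Green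

end EtaLaplacian

namespace EtaLaplacian

/-! ### Perturbation of inner products -/

open Matrix

section OrthonormalFrame

variable {ι : Type*} [Fintype ι] [DecidableEq ι]

open scoped MatrixOrder Matrix.Norms.L2Operator in
-- A positive definite matrix factors as `Bᵀ * B` with `B` invertible; the columns of `B⁻¹` are
-- orthonormal.
theorem exists_orthonormal_frame {G : Matrix ι ι ℝ} (hG : G.PosDef) :
    ∃ E : Matrix ι ι ℝ, E.det ≠ 0 ∧ Eᵀ * G * E = 1 := by
  obtain ⟨B, hB, rfl⟩ := CStarAlgebra.isStrictlyPositive_iff_eq_star_mul_self.1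
    hG.isStrictlyPositive
  rw [star_eq_conjTranspose]
  have hBd : IsUnit B.det := (Matrix.isUnit_iff_isUnit_det B).1 hB
  refine ⟨B⁻¹, (Matrix.isUnit_nonsing_inv_det B hBd).ne_zero, ?_⟩
  rw [conjTranspose_eq_transpose_of_trivial, transpose_nonsing_inv,
    ← Matrix.mul_assoc, nonsing_inv_mul _ (by rwa [det_transpose]), Matrix.one_mul,
    mul_nonsing_inv _ hBd]

theorem frame_mul_transpose {G E : Matrix ι ι ℝ} (hE : Eᵀ * G * E = 1) : E * Eᵀ = G⁻¹ := by
  have h1 : E * (Eᵀ * G) = 1 := mul_eq_one_comm.1 hE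
  rw [← Matrix.mul_assoc] at h1
  exact (inv_eq_left_inv h1).symm

theorem det_frame_congruence {G E : Matrix ι ι ℝ} (G' : Matrix ι ι ℝ) (hE : Eᵀ * G * E = 1) :
    (Eᵀ * G' * E).det = G'.det / G.det := by
  have h := congrArg det hE
  simp only [det_mul, det_transpose, det_one] at h ⊢
  have hG : G.det ≠ 0 := by rintro h0; simp [h0] at h
  field_simp
  linear_combination G'.det * h

/-- Since `E * Eᵀ = G⁻¹`, each squared entry of `E` is at most a diagonal entry of `G⁻¹`. Hence all
orthonormal frames are bounded by the same constant. -/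
theorem abs_frame_congruence_le {G E D : Matrix ι ι ℝ} (hE : Eᵀ * G * E = 1) {B c : ℝ}
    (hB : ∀ k, G⁻¹ k k ≤ B) (hD : ∀ k l, |D k l| ≤ c) (a b : ι) :
    |(Eᵀ * D * E) a b| ≤ (Fintype.card ι : ℝ) ^ 2 * (B * c) := by
  have hEE := frame_mul_transpose hE
  have hsq : ∀ k a, E k a ^ 2 ≤ B := by
    intro k a
    refine le_trans ?_ (hB k)
    rw [← hEE, Matrix.mul_apply]
    simp only [transpose_apply, ← sq]
    exact Finset.single_le_sum (f := fun a => E k a ^ 2) (fun _ _ => sq_nonneg _)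
      (Finset.mem_univ a)
  have hB0 : 0 ≤ B := (sq_nonneg _).trans (hsq a a)
  have h2 : ∀ k l, |E k a| * |E l b| ≤ B := fun k l => by
    nlinarith [hsq k a, hsq l b, sq_abs (E k a), sq_abs (E l b), sq_nonneg (|E k a| - |E l b|)]
  have hterm : ∀ l k, |Eᵀ a k * D k l * E l b| ≤ B * c := by
    intro l k
    rw [abs_mul, abs_mul, transpose_apply]
    calc |E k a| * |D k l| * |E l b| = |E k a| * |E l b| * |D k l| := by ring
      _ ≤ B * c := mul_le_mul (h2 k l) (hD k l) (abs_nonneg _) hB0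
  have hex : (Eᵀ * D * E) a b = ∑ l, ∑ k, Eᵀ a k * D k l * E l b := by
    simp only [Matrix.mul_apply, Finset.sum_mul]
  rw [hex]
  calc |∑ l, ∑ k, Eᵀ a k * D k l * E l b| ≤ ∑ l, ∑ k, |Eᵀ a k * D k l * E l b| :=
        (Finset.abs_sum_le_sum_abs _ _).trans
          (Finset.sum_le_sum fun l _ => Finset.abs_sum_le_sum_abs _ _)
    _ ≤ ∑ _l : ι, ∑ _k : ι, B * c :=
        Finset.sum_le_sum fun l _ => Finset.sum_le_sum fun k _ => hterm l k
    _ = (Fintype.card ι : ℝ) ^ 2 * (B * c) := by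
        simp only [Finset.sum_const, Finset.card_univ, nsmul_eq_mul]; ring

theorem abs_dotProduct_mulVec_le {N : Matrix ι ι ℝ} {c : ℝ} (hN : ∀ a b, |N a b| ≤ c)
    (x y : ι → ℝ) :
    |x ⬝ᵥ N *ᵥ y| ≤ (Fintype.card ι : ℝ) * c * (√(x ⬝ᵥ x) * √(y ⬝ᵥ y)) := by
  rcases isEmpty_or_nonempty ι with hι | ⟨⟨i⟩⟩
  · simp
  have hc : 0 ≤ c := (abs_nonneg _).trans (hN i i)
  have hs : ∀ x : ι → ℝ, ∑ a, |x a| ≤ √(Fintype.card ι) * √(x ⬝ᵥ x) := by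
    intro x
    have := Real.sum_mul_le_sqrt_mul_sqrt Finset.univ (fun _ => (1 : ℝ)) fun a => |x a|
    simpa [dotProduct, sq] using this
  have hx : x ⬝ᵥ N *ᵥ y = ∑ a, ∑ b, x a * N a b * y b := by
    simp only [dotProduct, mulVec, Finset.mul_sum, mul_assoc]
  rw [hx]
  calc |∑ a, ∑ b, x a * N a b * y b| ≤ ∑ a, ∑ b, |x a * N a b * y b| :=
        (Finset.abs_sum_le_sum_abs _ _).trans
          (Finset.sum_le_sum fun l _ => Finset.abs_sum_le_sum_abs _ _)
    _ ≤ ∑ a, ∑ b, c * (|x a| * |y b|) := by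
        refine Finset.sum_le_sum fun a _ => Finset.sum_le_sum fun b _ => ?_
        rw [abs_mul, abs_mul]
        calc |x a| * |N a b| * |y b| = |N a b| * (|x a| * |y b|) := by ring
          _ ≤ _ := mul_le_mul_of_nonneg_right (hN a b) (by positivity)
    _ = c * ((∑ a, |x a|) * ∑ b, |y b|) := by
        rw [Finset.sum_mul_sum, Finset.mul_sum]
        simp only [Finset.mul_sum]
    _ ≤ c * ((√(Fintype.card ι) * √(x ⬝ᵥ x)) * (√(Fintype.card ι) * √(y ⬝ᵥ y))) := by
        gcongr
        · exact hs x
        · exact hs y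
    _ = c * ((√(Fintype.card ι) * √(Fintype.card ι)) * (√(x ⬝ᵥ x) * √(y ⬝ᵥ y))) := by ring
    _ = _ := by rw [Real.mul_self_sqrt (by positivity)]; ring

end OrthonormalFrame

/-! ### Lipschitz dependence on the inner product -/

section Perturbation

variable {n : ℕ} [NeZero n]

theorem dotProduct_inv_of_frame {G E : Matrix (Fin n) (Fin n) ℝ} (hd : E.det ≠ 0)
    (hE : Eᵀ * G * E = 1) (a b : Fin n → ℝ) : a ⬝ᵥ G⁻¹ *ᵥ b = (Eᵀ *ᵥ a) ⬝ᵥ (Eᵀ *ᵥ b) := by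
  rw [← dotProduct_inv_congruence hd a b, hE, inv_one, one_mulVec]

theorem dotProduct_inv_nonneg {G : Matrix (Fin n) (Fin n) ℝ} (hG : G.PosDef) (a : Fin n → ℝ) :
    0 ≤ a ⬝ᵥ G⁻¹ *ᵥ a := by
  obtain ⟨E, hd, hE⟩ := exists_orthonormal_frame hG
  rw [dotProduct_inv_of_frame hd hE]
  exact Finset.sum_nonneg fun _ _ => mul_self_nonneg _

theorem abs_dotProduct_inv_le {G : Matrix (Fin n) (Fin n) ℝ} (hG : G.PosDef) (a b : Fin n → ℝ) :
    |a ⬝ᵥ G⁻¹ *ᵥ b| ≤ √(a ⬝ᵥ G⁻¹ *ᵥ a) * √(b ⬝ᵥ G⁻¹ *ᵥ b) := by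
  obtain ⟨E, hd, hE⟩ := exists_orthonormal_frame hG
  simp only [dotProduct_inv_of_frame hd hE]
  have h0 : 0 ≤ (Eᵀ *ᵥ a) ⬝ᵥ (Eᵀ *ᵥ a) := Finset.sum_nonneg fun _ _ => mul_self_nonneg _
  rw [← Real.sqrt_mul h0]
  refine Real.abs_le_sqrt ?_
  have := Finset.sum_mul_sq_le_sq_mul_sq Finset.univ (Eᵀ *ᵥ a) (Eᵀ *ᵥ b)
  simpa [dotProduct, sq] using this

/-- The relative volume density and the weighted dual form depend on the inner product in a
Lipschitz way, uniformly in the reference inner product. -/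
theorem exists_lipschitz_volume_cometric (n : ℕ) [NeZero n] :
    ∃ K > 0, ∃ r > 0, ∀ (G G' : Matrix (Fin n) (Fin n) ℝ) (s : ℝ), G.PosDef → s ≤ r →
      (∀ E : Matrix (Fin n) (Fin n) ℝ, Eᵀ * G * E = 1 → ∀ a b, |(Eᵀ * (G' - G) * E) a b| ≤ s) →
        |√(G'.det / G.det) - 1| ≤ K * s ∧
        ∀ a b : Fin n → ℝ, |√(G'.det / G.det) * (a ⬝ᵥ G'⁻¹ *ᵥ b) - a ⬝ᵥ G⁻¹ *ᵥ b| ≤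
          K * s * (√(a ⬝ᵥ G⁻¹ *ᵥ a) * √(b ⬝ᵥ G⁻¹ *ᵥ b)) := by
  obtain ⟨K, hK, r, hr, h⟩ := exists_lipschitz_sqrt_det_inv (ι := Fin n)
  have hn : (1 : ℝ) ≤ n := by exact_mod_cast NeZero.one_le
  -- In an orthonormal frame of `G` the matrix `G'` is a perturbation of the identity, so `K` does
  -- not depend on `G`. The factor `n` is the cost of passing from entries to the bilinear form.
  refine ⟨n * K, by positivity, r, hr, fun G G' s hG hs hE => ?_⟩
  obtain ⟨E, hd, hE1⟩ := exists_orthonormal_frame hG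
  have hA : ∀ a b, |(Eᵀ * G' * E) a b - (1 : Matrix (Fin n) (Fin n) ℝ) a b| ≤ s := by
    intro a b
    have := hE E hE1 a b
    rwa [Matrix.mul_sub, Matrix.sub_mul, hE1, Matrix.sub_apply] at this
  have hs0 : 0 ≤ s := (abs_nonneg _).trans (hA 0 0)
  obtain ⟨h1, h2⟩ := h _ s hs hA
  rw [det_frame_congruence G' hE1] at h1 h2
  refine ⟨h1.trans ?_, fun a b => ?_⟩
  · rw [mul_assoc]
    exact le_mul_of_one_le_left (by positivity) hn
  · have h3 := abs_dotProduct_mulVec_le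
      (N := √(G'.det / G.det) • (Eᵀ * G' * E)⁻¹ - 1) (c := K * s) (fun a b => by
        simpa using h2 a b) (Eᵀ *ᵥ a) (Eᵀ *ᵥ b)
    rw [sub_mulVec, smul_mulVec, dotProduct_sub, dotProduct_smul, one_mulVec,
      dotProduct_inv_congruence hd, smul_eq_mul, ← dotProduct_inv_of_frame hd hE1,
      ← dotProduct_inv_of_frame hd hE1, ← dotProduct_inv_of_frame hd hE1, Fintype.card_fin] at h3
    simpa [mul_assoc] using h3

end Perturbation

end EtaLaplacian

namespace EtaLaplacian

/-! ### Differentiable families of functions and metrics -/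

variable {n : ℕ} [NeZero n] {M : Type*} [TopologicalSpace M]
  [ChartedSpace (EuclideanHalfSpace n) M] [IsManifold (𝓡∂ n) ∞ M]

open Matrix

section Families

theorem DifferentiableFamily.differentiableAt {X : Type*} [TopologicalSpace X] {J : Set ℝ}
    {f : ℝ → X → ℝ} {s : Set X} (hf : DifferentiableFamily J f s) {t₀ : ℝ} (ht : t₀ ∈ J) {x : X}
    (hx : x ∈ s) : DifferentiableAt ℝ (fun t => f t x) t₀ := by
  obtain ⟨D, hD⟩ := hf t₀ ht
  exact (hasDerivAt_iff_tendsto_slope.2 (hD.tendsto_at hx)).differentiableAt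

/-- The limit `D` of the difference quotients is not assumed bounded, but locally it lies within `1`
of a single quotient at some `t₁ ≠ 0`, which is continuous. -/
theorem DifferentiableFamily.exists_bound {X : Type*} [TopologicalSpace X] {J : Set ℝ}
    {f : ℝ → X → ℝ} {s : Set X} (hf : DifferentiableFamily J f s) (h0 : (0 : ℝ) ∈ J)
    (hc : ∀ᶠ t in 𝓝 0, ContinuousOn (f t) s) {x : X} (hx : x ∈ s) :
    ∃ U ∈ 𝓝[s] x, ∃ C : ℝ, ∃ δ > 0, ∀ t, |t| < δ → ∀ y ∈ U, |f t y - f 0 y| ≤ C * |t| := by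
  obtain ⟨D, hD⟩ := hf 0 h0
  obtain ⟨v, hv, hvD⟩ := Metric.tendstoLocallyUniformlyOn_iff.1 hD 1 one_pos x hx
  have hc' : ∀ᶠ t in 𝓝[≠] (0 : ℝ), ContinuousOn (f t) s := nhdsWithin_le_nhds hc
  obtain ⟨t₁, ht₁, hct₁, -⟩ := (hvD.and (hc'.and self_mem_nhdsWithin)).exists
  have hslope : ContinuousOn (fun y => slope (fun r => f r y) 0 t₁) s := by
    simp only [slope, vsub_eq_sub, smul_eq_mul]
    exact continuousOn_const.mul (hct₁.sub hc.self_of_nhds)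
  set A := slope (fun r => f r x) 0 t₁ with hA
  have hW : ∀ᶠ y in 𝓝[s] x, |slope (fun r => f r y) 0 t₁| < |A| + 1 :=
    (hslope x hx).abs.eventually (gt_mem_nhds (by simp [hA]))
  obtain ⟨δ, hδ, hδ'⟩ := Metric.mem_nhdsWithin_iff.1 hvD
  -- The constant `|A| + 3`: the quotient at `t` is within `1` of `D`, `D` is within `1` of the
  -- quotient at `t₁`, and the latter is below `|A| + 1`.
  refine ⟨v ∩ {y | |slope (fun r => f r y) 0 t₁| < |A| + 1}, inter_mem hv hW, |A| + 3, δ, hδ,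
    fun t ht y hy => ?_⟩
  rcases eq_or_ne t 0 with rfl | hne
  · simp
  have h1 := hδ' ⟨by simpa using ht, hne⟩ y hy.1
  have h2 := ht₁ y hy.1
  have h3 : |slope (fun r => f r y) 0 t₁| < |A| + 1 := hy.2
  rw [Real.dist_eq] at h1 h2
  have h4 : |slope (fun r => f r y) 0 t| ≤ |A| + 3 := by
    rw [abs_lt] at h1 h2 h3
    exact abs_le.2 ⟨by linarith, by linarith⟩
  have h5 : f t y - f 0 y = slope (fun r => f r y) 0 t * t := by
    simp only [slope, vsub_eq_sub, smul_eq_mul, sub_zero]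
    field_simp
  rw [h5, abs_mul]
  gcongr

/-- `F t x a` stands for any estimate at `x` that weakens as `a` grows; a finite cover then allows
the largest constant and the smallest radius. -/
theorem exists_uniform_bound_of_local {X : Type*} [TopologicalSpace X] [CompactSpace X]
    {F : ℝ → X → ℝ → Prop} (hmono : ∀ t x a b, a ≤ b → F t x a → F t x b)
    (h : ∀ x, ∃ U ∈ 𝓝 x, ∃ C : ℝ, ∃ δ > 0, ∀ t, |t| < δ → ∀ y ∈ U, F t y (C * |t|)) :
    ∃ C > 0, ∃ δ > 0, ∀ t, |t| < δ → ∀ y, F t y (C * |t|) := by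
  have key : ∃ C : ℝ, ∃ δ > 0, ∀ t, |t| < δ → ∀ y ∈ (univ : Set X), F t y (C * |t|) := by
    refine isCompact_univ.induction_on (p := fun S => ∃ C : ℝ, ∃ δ > 0, ∀ t, |t| < δ →
      ∀ y ∈ S, F t y (C * |t|)) ⟨0, 1, one_pos, by simp⟩ ?_ ?_ ?_
    · rintro S T hST ⟨C, δ, hδ, hT⟩
      exact ⟨C, δ, hδ, fun t ht y hy => hT t ht y (hST hy)⟩
    · rintro S T ⟨C, δ, hδ, hS⟩ ⟨C', δ', hδ', hT⟩
      refine ⟨max C C', min δ δ', lt_min hδ hδ', fun t ht y hy => ?_⟩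
      rcases hy with hy | hy
      · exact hmono _ _ _ _ (mul_le_mul_of_nonneg_right (le_max_left _ _) (abs_nonneg _))
          (hS t (ht.trans_le (min_le_left _ _)) y hy)
      · exact hmono _ _ _ _ (mul_le_mul_of_nonneg_right (le_max_right _ _) (abs_nonneg _))
          (hT t (ht.trans_le (min_le_right _ _)) y hy)
    · intro x _
      obtain ⟨U, hU, C, δ, hδ, hC⟩ := h x
      exact ⟨U, nhdsWithin_le_nhds hU, C, δ, hδ, hC⟩
  obtain ⟨C, δ, hδ, hC⟩ := key
  exact ⟨max C 1, by positivity, δ, hδ, fun t ht y => hmono _ _ _ _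
    (mul_le_mul_of_nonneg_right (le_max_left _ _) (abs_nonneg _)) (hC t ht y (mem_univ y))⟩

variable [CompactSpace M]

theorem DifferentiableFamily.exists_uniform_bound {J : Set ℝ} {f : ℝ → M → ℝ}
    (hf : DifferentiableFamily J f univ) (h0 : (0 : ℝ) ∈ J)
    (hc : ∀ᶠ t in 𝓝 0, Continuous (f t)) :
    ∃ C > 0, ∃ δ > 0, ∀ t, |t| < δ → ∀ p, |f t p - f 0 p| ≤ C * |t| := by
  refine exists_uniform_bound_of_local (F := fun t p a => |f t p - f 0 p| ≤ a)
    (fun _ _ _ _ hab h => h.trans hab) fun p => ?_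
  obtain ⟨U, hU, h⟩ := hf.exists_bound h0 (hc.mono fun t h => h.continuousOn) (mem_univ p)
  exact ⟨U, by rwa [nhdsWithin_univ] at hU, h⟩

/-- The components of `g t - g 0` in orthonormal frames of `g 0` are `O(t)`, uniformly on `M`. -/
theorem exists_metric_bound {J : Set ℝ} {g : ℝ → Metric n M} (hg : DifferentiableVariation J g)
    (h0 : (0 : ℝ) ∈ J) :
    ∃ C > 0, ∃ δ > 0, ∀ t, |t| < δ → ∀ p, ∀ E : Matrix (Fin n) (Fin n) ℝ,
      Eᵀ * gram (g 0) p * E = 1 →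
        ∀ a b, |(Eᵀ * (gram (g t) p - gram (g 0) p) * E) a b| ≤ C * |t| := by
  refine exists_uniform_bound_of_local (F := fun t p c => ∀ E : Matrix (Fin n) (Fin n) ℝ,
    Eᵀ * gram (g 0) p * E = 1 → ∀ a b, |(Eᵀ * (gram (g t) p - gram (g 0) p) * E) a b| ≤ c)
    (fun _ _ _ _ hab h E hE a b => (h E hE a b).trans hab) fun x => ?_
  set e := extChartAt (𝓡∂ n) x with he
  have hx : e x ∈ e.target := mem_extChartAt_target x
  have hloc := fun i j => (hg x i j).exists_bound h0
    (Eventually.of_forall fun t => (contDiffOn_chartGram (g t) x i j).continuousOn) hx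
  choose U hU C δ hδ hC using hloc
  have hinv : ∀ k, ∀ᶠ y in 𝓝[e.target] (e x), (chartGram (g 0) x y)⁻¹ k k <
      (chartGram (g 0) x (e x))⁻¹ k k + 1 := fun k =>
    ((contDiffOn_chartGram_inv (g 0) x k k).continuousOn (e x) hx).eventually
      (gt_mem_nhds (by linarith))
  set B := ∑ k, |(chartGram (g 0) x (e x))⁻¹ k k + 1| with hB
  set C' := ∑ i, ∑ j, |C i j| with hC'
  have hCC : ∀ i j, C i j ≤ C' := fun i j => (le_abs_self _).trans <|
    (Finset.single_le_sum (f := fun j => |C i j|) (fun _ _ => abs_nonneg _)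
      (Finset.mem_univ j)).trans
    (Finset.single_le_sum (f := fun i => ∑ j, |C i j|)
      (fun _ _ => Finset.sum_nonneg fun _ _ => abs_nonneg _) (Finset.mem_univ i))
  have hδall : ∃ δ' > 0, ∀ i j, δ' ≤ δ i j := by
    refine ⟨Finset.univ.inf' Finset.univ_nonempty fun q : Fin n × Fin n => δ q.1 q.2, ?_, ?_⟩
    · exact (Finset.lt_inf'_iff _).2 fun q _ => hδ q.1 q.2
    · exact fun i j => Finset.inf'_le (fun q : Fin n × Fin n => δ q.1 q.2) (Finset.mem_univ (i, j))
  obtain ⟨δ', hδ', hδδ⟩ := hδall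
  have hall : ∀ᶠ y in 𝓝[e.target] (e x), (∀ i j, y ∈ U i j) ∧
      ∀ k, (chartGram (g 0) x y)⁻¹ k k < (chartGram (g 0) x (e x))⁻¹ k k + 1 :=
    (eventually_all.2 fun i => eventually_all.2 fun j => hU i j).and (eventually_all.2 hinv)
  have htend : Tendsto e (𝓝 x) (𝓝[e.target] (e x)) :=
    tendsto_nhdsWithin_iff.2 ⟨continuousAt_extChartAt x,
      mem_of_superset (extChartAt_source_mem_nhds (I := 𝓡∂ n) x) fun p hp => e.map_source hp⟩
  refine ⟨_, (htend.eventually hall).and (extChartAt_source_mem_nhds (I := 𝓡∂ n) x),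
    (Fintype.card (Fin n) : ℝ) ^ 2 * (B * C'), δ', hδ', ?_⟩
  rintro t ht p ⟨⟨hpU, hpinv⟩, hp⟩ E hE a b
  have hTd := transition_det_ne_zero (x' := p) hp (mem_extChartAt_source p)
  set T := transition n x p p with hT
  have hcg : ∀ g : Metric n M, chartGram g x (e p) = Tᵀ * gram g p * T := fun g =>
    chartGram_eq g hp
  -- If `E` is orthonormal for `gram`, then `T⁻¹ * E` is orthonormal for the chart matrix, where the
  -- bounds near `x` are available.
  have hTT : T * (T⁻¹ * E) = E := by
    rw [← Matrix.mul_assoc, mul_nonsing_inv _ (isUnit_iff_ne_zero.2 hTd), Matrix.one_mul]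
  have hconj : ∀ A : Matrix (Fin n) (Fin n) ℝ,
      (T⁻¹ * E)ᵀ * (Tᵀ * A * T) * (T⁻¹ * E) = Eᵀ * A * E := by
    intro A
    calc (T⁻¹ * E)ᵀ * (Tᵀ * A * T) * (T⁻¹ * E) =
        (T * (T⁻¹ * E))ᵀ * A * (T * (T⁻¹ * E)) := by
          simp only [transpose_mul, Matrix.mul_assoc]
      _ = _ := by rw [hTT]
  have hE' : (T⁻¹ * E)ᵀ * chartGram (g 0) x (e p) * (T⁻¹ * E) = 1 := by
    rw [hcg, hconj, hE]
  have := abs_frame_congruence_le hE' (D := chartGram (g t) x (e p) - chartGram (g 0) x (e p))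
    (B := B) (c := C' * |t|)
    (fun k => (hpinv k).le.trans ((le_abs_self _).trans (Finset.single_le_sum
      (f := fun k => |(chartGram (g 0) x (e x))⁻¹ k k + 1|) (fun _ _ => abs_nonneg _)
      (Finset.mem_univ k))))
    (fun k l => (hC k l t (ht.trans_le (hδδ k l)) _ (hpU k l)).trans
      (mul_le_mul_of_nonneg_right (hCC k l) (abs_nonneg _))) a b
  rw [hcg, hcg, ← Matrix.sub_mul, ← Matrix.mul_sub, hconj] at this
  refine this.trans (le_of_eq (by ring))

end Families

/-! ### The velocity of the metric and its contractions -/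

section VelocityForm

theorem hasDerivAt_gram {J : Set ℝ} {g : ℝ → Metric n M} (hg : DifferentiableVariation J g)
    (h0 : (0 : ℝ) ∈ J) (p : M) (i j : Fin n) :
    HasDerivAt (fun t => gram (g t) p i j) (metricVelocity g p (frame p i) (frame p j)) 0 := by
  have hp := mem_extChartAt_source (I := 𝓡∂ n) p
  have h : (fun t => gram (g t) p i j) =
      fun t => chartGram (g t) p (extChartAt (𝓡∂ n) p p) i j := by
    ext t
    rw [chartGram_eq (g t) hp, transition_self hp]
    simp
  have hd : DifferentiableAt ℝ (fun t => gram (g t) p i j) 0 := by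
    rw [h]
    exact (hg p i j).differentiableAt h0 (mem_extChartAt_target p)
  exact hd.hasDerivAt

/-- The matrix of the velocity of a family of metrics. -/
noncomputable def velocityGram (g : ℝ → Metric n M) (p : M) : Matrix (Fin n) (Fin n) ℝ :=
  Matrix.of fun i j => metricVelocity g p (frame p i) (frame p j)

/-- The trace of the velocity of a family of metrics. -/
noncomputable def velocityTrace (g : ℝ → Metric n M) (p : M) : ℝ :=
  ((gram (g 0) p)⁻¹ * velocityGram g p).trace

/-- The velocity of a family of metrics, evaluated at the gradients of two functions. -/
noncomputable def velocityForm (g : ℝ → Metric n M) (u v : M → ℝ) (p : M) : ℝ :=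
  diffVec u p ⬝ᵥ ((gram (g 0) p)⁻¹ * velocityGram g p * (gram (g 0) p)⁻¹) *ᵥ diffVec v p

/-- The two contractions behind this are `⟨g, H⟩ = tr_g H` and `⟨du ⊗ dv, H⟩ = H(∇u, ∇v)`. -/
theorem tensorInner_velocity (g : ℝ → Metric n M) (c : ℝ) (u v : M → ℝ) (p : M) :
    tensorInner (g 0) p
      (fun a b => c * (g 0).inner p a b - 2 * (differential u p a * differential v p b))
      (metricVelocity g p) = c * velocityTrace g p - 2 * velocityForm g u v p := by
  have hsymm : ∀ i j, (gram (g 0) p)⁻¹ i j = (gram (g 0) p)⁻¹ j i := fun i j => by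
    conv_lhs => rw [← transpose_gram, ← transpose_nonsing_inv, transpose_apply]
  set G := gram (g 0) p with hG
  set H := velocityGram g p with hH
  have hGG : G * G⁻¹ = 1 := mul_nonsing_inv _ (isUnit_iff_ne_zero.2 (gram_det_pos (g 0) p).ne')
  have h1 : tensorInner (g 0) p
      (fun a b => c * (g 0).inner p a b - 2 * (differential u p a * differential v p b))
      (metricVelocity g p) = ∑ i, ∑ j, ∑ k, ∑ l, G⁻¹ i k * G⁻¹ j l *
        (c * G i j - 2 * (diffVec u p i * diffVec v p j)) * H k l := rfl
  have htr : velocityTrace g p = ∑ i, ∑ j, ∑ k, ∑ l, G⁻¹ i k * G⁻¹ j l * G i j * H k l := by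
    have hGGG : ∀ k l, ∑ i, ∑ j, G⁻¹ i k * G⁻¹ j l * G i j = G⁻¹ k l := by
      intro k l
      have h2 : G⁻¹ * (G * G⁻¹) = G⁻¹ := by rw [hGG, Matrix.mul_one]
      conv_rhs => rw [← h2]
      simp only [Matrix.mul_apply, Finset.mul_sum]
      refine Finset.sum_congr rfl fun i _ => Finset.sum_congr rfl fun j _ => ?_
      rw [hsymm k i]
      ring
    have h3 : velocityTrace g p = ∑ l, ∑ k, G⁻¹ k l * H k l := by
      simp only [velocityTrace, Matrix.trace, Matrix.diag, Matrix.mul_apply]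
      exact Finset.sum_congr rfl fun l _ => Finset.sum_congr rfl fun k _ => by rw [hsymm]
    rw [h3, Finset.sum_comm]
    calc _ = ∑ k, ∑ l, ∑ i, ∑ j, G⁻¹ i k * G⁻¹ j l * G i j * H k l :=
          Finset.sum_congr rfl fun k _ => Finset.sum_congr rfl fun l _ => by
            rw [← hGGG k l, Finset.sum_mul]
            exact Finset.sum_congr rfl fun i _ => Finset.sum_mul _ _ _
      _ = ∑ k, ∑ i, ∑ l, ∑ j, G⁻¹ i k * G⁻¹ j l * G i j * H k l :=
          Finset.sum_congr rfl fun k _ => Finset.sum_comm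
      _ = ∑ i, ∑ k, ∑ l, ∑ j, G⁻¹ i k * G⁻¹ j l * G i j * H k l := Finset.sum_comm
      _ = ∑ i, ∑ k, ∑ j, ∑ l, G⁻¹ i k * G⁻¹ j l * G i j * H k l :=
          Finset.sum_congr rfl fun i _ => Finset.sum_congr rfl fun k _ => Finset.sum_comm
      _ = _ := Finset.sum_congr rfl fun i _ => Finset.sum_comm
  have hf : velocityForm g u v p =
      ∑ i, ∑ j, ∑ k, ∑ l, G⁻¹ i k * G⁻¹ j l * (diffVec u p i * diffVec v p j) * H k l := by
    simp only [velocityForm, dotProduct, mulVec, Matrix.mul_apply, Finset.mul_sum, Finset.sum_mul]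
    refine Finset.sum_congr rfl fun i _ => Finset.sum_congr rfl fun j _ => ?_
    rw [Finset.sum_comm]
    refine Finset.sum_congr rfl fun k _ => Finset.sum_congr rfl fun l _ => ?_
    rw [hsymm j l]
    ring
  rw [h1, htr, hf, Finset.mul_sum, Finset.mul_sum, ← Finset.sum_sub_distrib]
  simp only [Finset.mul_sum, ← Finset.sum_sub_distrib]
  refine Finset.sum_congr rfl fun i _ => Finset.sum_congr rfl fun j _ =>
    Finset.sum_congr rfl fun k _ => Finset.sum_congr rfl fun l _ => by ring

end VelocityForm

end EtaLaplacian

namespace EtaLaplacian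

/-! ### Families of weights and densities -/

variable {n : ℕ} [NeZero n] {M : Type*} [TopologicalSpace M]
  [ChartedSpace (EuclideanHalfSpace n) M] [IsManifold (𝓡∂ n) ∞ M]

open Matrix

section WeightFamily

variable {J : Set ℝ} {η : ℝ → M → ℝ}

theorem contMDiff_slice (hη : ContMDiffOn (𝓘(ℝ, ℝ).prod (𝓡∂ n)) 𝓘(ℝ, ℝ) ∞
    (fun q : ℝ × M => η q.1 q.2) (J ×ˢ univ)) {t : ℝ} (ht : t ∈ J) :
    ContMDiff (𝓡∂ n) 𝓘(ℝ, ℝ) ∞ (η t) := by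
  have h : ContMDiff (𝓡∂ n) (𝓘(ℝ, ℝ).prod (𝓡∂ n)) ∞ fun p : M => (t, p) :=
    contMDiff_const.prodMk contMDiff_id
  rw [← contMDiffOn_univ] at h ⊢
  exact hη.comp h fun p _ => ⟨ht, mem_univ _⟩

/-- The derivative in `t` is the derivative in `s` of the jointly smooth map `((t, p), s) ↦ η s p`,
evaluated along `s = t`; such partial derivatives are again jointly smooth. -/
theorem contMDiffAt_deriv_parameter (hJ : IsOpen J)
    (hη : ContMDiffOn (𝓘(ℝ, ℝ).prod (𝓡∂ n)) 𝓘(ℝ, ℝ) ∞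
      (fun q : ℝ × M => η q.1 q.2) (J ×ˢ univ)) {t : ℝ} (ht : t ∈ J) (p : M) :
    ContMDiffAt (𝓘(ℝ, ℝ).prod (𝓡∂ n)) 𝓘(ℝ, ℝ) ∞
      (fun q : ℝ × M => deriv (fun s => η s q.2) q.1) (t, p) := by
  have hη' : ContMDiffAt (𝓘(ℝ, ℝ).prod (𝓡∂ n)) 𝓘(ℝ, ℝ) ∞ (fun q : ℝ × M => η q.1 q.2) (t, p) :=
    (hη (t, p) ⟨ht, mem_univ _⟩).contMDiffAt ((hJ.prod isOpen_univ).mem_nhds ⟨ht, mem_univ _⟩)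
  have hr : ContMDiffAt ((𝓘(ℝ, ℝ).prod (𝓡∂ n)).prod 𝓘(ℝ, ℝ)) (𝓘(ℝ, ℝ).prod (𝓡∂ n)) ∞
      (fun q : (ℝ × M) × ℝ => (q.2, q.1.2)) ((t, p), t) :=
    contMDiffAt_snd.prodMk (contMDiffAt_snd.comp _ contMDiffAt_fst)
  have hf : ContMDiffAt ((𝓘(ℝ, ℝ).prod (𝓡∂ n)).prod 𝓘(ℝ, ℝ)) 𝓘(ℝ, ℝ) ∞
      (Function.uncurry fun (q : ℝ × M) (s : ℝ) => η s q.2) ((t, p), t) :=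
    ContMDiffAt.comp (g := fun q : ℝ × M => η q.1 q.2) ((t, p), t) hη' hr
  have h := ContMDiffAt.mfderiv (fun (q : ℝ × M) (s : ℝ) => η s q.2) Prod.fst hf
    contMDiffAt_fst (m := ∞) (by simp)
  have h2 := h.clm_apply (contMDiffAt_const (c := (1 : ℝ)))
  refine h2.congr_of_eventuallyEq (Eventually.of_forall fun q => ?_)
  have e := congrFun (inTangentCoordinates_model_space (𝕜 := ℝ) (I := 𝓘(ℝ, ℝ)) (I' := 𝓘(ℝ, ℝ))
    Prod.fst (fun x : ℝ × M => η x.1 x.2)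
    (fun x : ℝ × M => mfderiv 𝓘(ℝ, ℝ) 𝓘(ℝ, ℝ) (fun s => η s x.2) x.1) (t, p)) q
  exact (congrArg (fun L : ℝ →L[ℝ] ℝ => L 1) (e.trans mfderiv_eq_fderiv)).symm

theorem contMDiff_weightVelocity (hJ : IsOpen J)
    (hη : ContMDiffOn (𝓘(ℝ, ℝ).prod (𝓡∂ n)) 𝓘(ℝ, ℝ) ∞
      (fun q : ℝ × M => η q.1 q.2) (J ×ˢ univ)) (h0 : (0 : ℝ) ∈ J) :
    ContMDiff (𝓡∂ n) 𝓘(ℝ, ℝ) ∞ (weightVelocity η) := by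
  intro p
  have h : ContMDiffAt (𝓡∂ n) (𝓘(ℝ, ℝ).prod (𝓡∂ n)) ∞ (fun p : M => ((0 : ℝ), p)) p :=
    contMDiffAt_const.prodMk contMDiffAt_id
  exact ContMDiffAt.comp (g := fun q : ℝ × M => deriv (fun s => η s q.2) q.1) p
    (contMDiffAt_deriv_parameter hJ hη h0 p) h

theorem differentiableAt_parameter (hJ : IsOpen J)
    (hη : ContMDiffOn (𝓘(ℝ, ℝ).prod (𝓡∂ n)) 𝓘(ℝ, ℝ) ∞
      (fun q : ℝ × M => η q.1 q.2) (J ×ˢ univ)) {t : ℝ} (ht : t ∈ J) (p : M) :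
    DifferentiableAt ℝ (fun s => η s p) t := by
  have hη' : ContMDiffAt (𝓘(ℝ, ℝ).prod (𝓡∂ n)) 𝓘(ℝ, ℝ) ∞ (fun q : ℝ × M => η q.1 q.2) (t, p) :=
    (hη (t, p) ⟨ht, mem_univ _⟩).contMDiffAt ((hJ.prod isOpen_univ).mem_nhds ⟨ht, mem_univ _⟩)
  have h : ContMDiffAt 𝓘(ℝ, ℝ) (𝓘(ℝ, ℝ).prod (𝓡∂ n)) ∞ (fun s : ℝ => (s, p)) t :=
    contMDiffAt_id.prodMk contMDiffAt_const
  have h2 := ContMDiffAt.comp (g := fun q : ℝ × M => η q.1 q.2) t hη' h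
  exact h2.contDiffAt.differentiableAt (by simp)

theorem exists_weight_bound [CompactSpace M] (hJ : IsOpen J)
    (hη : ContMDiffOn (𝓘(ℝ, ℝ).prod (𝓡∂ n)) 𝓘(ℝ, ℝ) ∞
      (fun q : ℝ × M => η q.1 q.2) (J ×ˢ univ)) (h0 : (0 : ℝ) ∈ J) :
    ∃ C > 0, ∃ δ > 0, ∀ t, |t| < δ → ∀ p, |η t p - η 0 p| ≤ C * |t| := by
  refine exists_uniform_bound_of_local (F := fun t p a => |η t p - η 0 p| ≤ a)
    (fun _ _ _ _ hab h => h.trans hab) fun p => ?_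
  have hc := (contMDiffAt_deriv_parameter hJ hη h0 p).continuousAt
  set A := |deriv (fun s => η s p) 0| with hA
  -- The derivative in `t` is bounded by `A + 1` on a product neighbourhood of `(0, p)`, so the mean
  -- value inequality applies on one common interval for all nearby points.
  have hev : ∀ᶠ q : ℝ × M in 𝓝 (0, p), |deriv (fun s => η s q.2) q.1| < A + 1 ∧ q.1 ∈ J :=
    (hc.abs.eventually (gt_mem_nhds (by simp [hA]))).and
      (continuousAt_fst.eventually (hJ.mem_nhds h0))
  rw [nhds_prod_eq, eventually_prod_iff] at hev
  obtain ⟨P, hP, Q, hQ, hPQ⟩ := hev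
  obtain ⟨δ, hδ, hδP⟩ := Metric.eventually_nhds_iff.1 hP
  refine ⟨_, hQ, A + 1, δ, hδ, fun t ht y hy => ?_⟩
  have hmem : ∀ s ∈ Metric.ball (0 : ℝ) δ, P s := fun s hs => hδP hs
  have := (convex_ball (0 : ℝ) δ).norm_image_sub_le_of_norm_deriv_le (f := fun s => η s y)
    (C := A + 1) (x := 0) (y := t)
    (fun s hs => differentiableAt_parameter hJ hη (hPQ (hmem s hs) hy).2 y)
    (fun s hs => (hPQ (hmem s hs) hy).1.le) (Metric.mem_ball_self hδ) (by simpa using ht)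
  simpa using this

end WeightFamily

/-! ### The density and the Dirichlet form as functions of time -/

section RatioFamily

variable {J : Set ℝ} {g : ℝ → Metric n M} {η : ℝ → M → ℝ}

theorem cometric_self_nonneg (g : Metric n M) (u : M → ℝ) (p : M) : 0 ≤ cometric g u u p :=
  dotProduct_inv_nonneg (gram_posDef g p) _

theorem abs_cometric_le (g : Metric n M) (u v : M → ℝ) (p : M) :
    |cometric g u v p| ≤ √(cometric g u u p) * √(cometric g v v p) :=
  abs_dotProduct_inv_le (gram_posDef g p) _ _

theorem weightRatio_self (g : Metric n M) (η : M → ℝ) (p : M) : weightRatio g g η η p = 1 := by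
  simp [weightRatio, volumeRatio, div_self (gram_det_pos g p).ne']

/-- The density of `dm_t` with respect to `dm_0` and the Dirichlet form density of `dm_t` differ
from their values at `t = 0` by `O(t)`, uniformly on `M`. -/
theorem exists_weightRatio_bound [CompactSpace M] (hg : DifferentiableVariation J g)
    (hJ : IsOpen J) (hη : ContMDiffOn (𝓘(ℝ, ℝ).prod (𝓡∂ n)) 𝓘(ℝ, ℝ) ∞
      (fun q : ℝ × M => η q.1 q.2) (J ×ˢ univ)) (h0 : (0 : ℝ) ∈ J) :
    ∃ C > 0, ∃ δ > 0, ∀ t, |t| < δ → ∀ p,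
      |weightRatio (g 0) (g t) (η 0) (η t) p - 1| ≤ C * |t| ∧
      ∀ u v : M → ℝ, |weightRatio (g 0) (g t) (η 0) (η t) p * cometric (g t) u v p -
        cometric (g 0) u v p| ≤
          C * |t| * (√(cometric (g 0) u u p) * √(cometric (g 0) v v p)) := by
  obtain ⟨K, hK, r, hr, hKr⟩ := exists_lipschitz_volume_cometric n
  obtain ⟨C₁, hC₁, δ₁, hδ₁, h₁⟩ := exists_metric_bound hg h0
  obtain ⟨C₂, hC₂, δ₂, hδ₂, h₂⟩ := exists_weight_bound hJ hη h0
  -- The radius `r / C₁` makes the metric perturbation admissible. The radius `1 / C₂` keeps the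
  -- exponent at most `1` in absolute value, where `|e^x - 1| ≤ 2|x|`; hence the `2`, and the bound
  -- `3` for the exponential.
  refine ⟨3 * (K * C₁) + 2 * C₂, by positivity, min (min δ₁ δ₂) (min (r / C₁) (1 / C₂)),
    by positivity, fun t ht p => ?_⟩
  obtain ⟨⟨ht1, ht2⟩, ht3, ht4⟩ : (|t| < δ₁ ∧ |t| < δ₂) ∧ |t| < r / C₁ ∧ |t| < 1 / C₂ := by
    simpa only [lt_min_iff] using ht
  rw [lt_div_iff₀ hC₁] at ht3
  rw [lt_div_iff₀ hC₂] at ht4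
  obtain ⟨h3, h4⟩ := hKr (gram (g 0) p) (gram (g t) p) (C₁ * |t|) (gram_posDef _ _) (by linarith)
    (h₁ t ht1 p)
  have h5 : |Real.exp (η 0 p - η t p) - 1| ≤ 2 * (C₂ * |t|) := by
    have h6 : |η 0 p - η t p| ≤ C₂ * |t| := by rw [abs_sub_comm]; exact h₂ t ht2 p
    exact (Real.abs_exp_sub_one_le (by linarith)).trans (by linarith)
  have hE3 : Real.exp (η 0 p - η t p) ≤ 3 := by
    have := (abs_le.1 h5).2
    linarith
  have hE0 := (Real.exp_pos (η 0 p - η t p)).le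
  set E := Real.exp (η 0 p - η t p) with hE
  have hw : weightRatio (g 0) (g t) (η 0) (η t) p =
    √((gram (g t) p).det / (gram (g 0) p).det) * E := rfl
  set V := √((gram (g t) p).det / (gram (g 0) p).det) with hV
  rw [hw]
  constructor
  · calc |V * E - 1| = |E * (V - 1) + (E - 1)| := by ring_nf
      _ ≤ |E * (V - 1)| + |E - 1| := abs_add_le _ _
      _ ≤ 3 * (K * (C₁ * |t|)) + 2 * (C₂ * |t|) := by
        rw [abs_mul, abs_of_nonneg hE0]; gcongr
      _ = _ := by ring
  · intro u v
    have h6 : |V * cometric (g t) u v p - cometric (g 0) u v p| ≤ K * (C₁ * |t|) *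
      (√(cometric (g 0) u u p) * √(cometric (g 0) v v p)) := h4 _ _
    have h7 := abs_cometric_le (g 0) u v p
    set S := √(cometric (g 0) u u p) * √(cometric (g 0) v v p) with hS
    have hS0 : 0 ≤ S := by positivity
    calc |V * E * cometric (g t) u v p - cometric (g 0) u v p| =
          |E * (V * cometric (g t) u v p - cometric (g 0) u v p) +
            (E - 1) * cometric (g 0) u v p| := by ring_nf
      _ ≤ |E * (V * cometric (g t) u v p - cometric (g 0) u v p)| +
            |(E - 1) * cometric (g 0) u v p| := abs_add_le _ _
      _ ≤ 3 * (K * (C₁ * |t|) * S) + 2 * (C₂ * |t|) * S := by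
        rw [abs_mul, abs_mul, abs_of_nonneg hE0]; gcongr
      _ = _ := by ring

/-- The derivative of the density of `dm_t` with respect to `dm_0`. -/
noncomputable def ratioVelocity (g : ℝ → Metric n M) (η : ℝ → M → ℝ) (p : M) : ℝ :=
  velocityTrace g p / 2 - weightVelocity η p

/-- Jacobi's formula under the square root gives half the trace of the velocity; the exponential
gives `-η̇`. -/
theorem hasDerivAt_weightRatio (hg : DifferentiableVariation J g)
    (hJ : IsOpen J) (hη : ContMDiffOn (𝓘(ℝ, ℝ).prod (𝓡∂ n)) 𝓘(ℝ, ℝ) ∞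
      (fun q : ℝ × M => η q.1 q.2) (J ×ˢ univ)) (h0 : (0 : ℝ) ∈ J) (p : M) :
    HasDerivAt (fun t => weightRatio (g 0) (g t) (η 0) (η t) p) (ratioVelocity g η p) 0 := by
  have hG := fun i j => hasDerivAt_gram hg h0 p i j
  have hd := hasDerivAt_det (A := fun t => gram (g t) p) (A' := velocityGram g p) hG
  have hpos := gram_det_pos (g 0) p
  have h1 := (hd.div_const (gram (g 0) p).det).sqrt (by simp [div_self hpos.ne'])
  have h2 := ((differentiableAt_parameter hJ hη h0 p).hasDerivAt.const_sub (η 0 p)).exp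
  have h3 := h1.mul h2
  refine h3.congr_deriv ?_
  have htr : (((gram (g 0) p).adjugate) * velocityGram g p).trace =
      (gram (g 0) p).det * velocityTrace g p := by
    rw [velocityTrace, Matrix.inv_def, Ring.inverse_eq_inv', Matrix.smul_mul, Matrix.trace_smul,
      smul_eq_mul, mul_inv_cancel_left₀ hpos.ne']
  rw [htr, ratioVelocity, weightVelocity, sub_self, Real.exp_zero, div_self hpos.ne',
    mul_div_cancel_left₀ _ hpos.ne']
  simp
  ring

theorem hasDerivAt_weightRatio_mul_cometric (hg : DifferentiableVariation J g)
    (hJ : IsOpen J) (hη : ContMDiffOn (𝓘(ℝ, ℝ).prod (𝓡∂ n)) 𝓘(ℝ, ℝ) ∞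
      (fun q : ℝ × M => η q.1 q.2) (J ×ˢ univ)) (h0 : (0 : ℝ) ∈ J) (u v : M → ℝ) (p : M) :
    HasDerivAt (fun t => weightRatio (g 0) (g t) (η 0) (η t) p * cometric (g t) u v p)
      (ratioVelocity g η p * cometric (g 0) u v p - velocityForm g u v p) 0 := by
  have hi := fun i j => hasDerivAt_inv_entry (A := fun t => gram (g t) p) (A' := velocityGram g p)
    (fun i j => hasDerivAt_gram hg h0 p i j) (gram_det_pos (g 0) p).ne' i j
  have hc : HasDerivAt (fun t => cometric (g t) u v p) (-velocityForm g u v p) 0 := by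
    have h1 : HasDerivAt (fun t => ∑ i, ∑ j, diffVec (n := n) u p i *
        ((gram (g t) p)⁻¹ i j * diffVec v p j))
        (∑ i, ∑ j, diffVec (n := n) u p i * (-((gram (g 0) p)⁻¹ * velocityGram g p *
          (gram (g 0) p)⁻¹) i j * diffVec v p j)) 0 :=
      HasDerivAt.fun_sum fun i _ => HasDerivAt.fun_sum fun j _ =>
        ((hi i j).mul_const _).const_mul _
    refine (h1.congr_deriv ?_).congr_of_eventuallyEq (Eventually.of_forall fun t => ?_)
    · simp only [velocityForm, dotProduct, mulVec, Finset.mul_sum, neg_mul, mul_neg,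
        Finset.sum_neg_distrib]
    · simp only [cometric, dotProduct, mulVec, Finset.mul_sum]
  refine ((hasDerivAt_weightRatio hg hJ hη h0 p).mul hc).congr_deriv ?_
  rw [weightRatio_self]
  ring

end RatioFamily

end EtaLaplacian

namespace EtaLaplacian

/-! ### Integrability of the velocities -/

variable {n : ℕ} [NeZero n] {M : Type*} [TopologicalSpace M]
  [ChartedSpace (EuclideanHalfSpace n) M] [IsManifold (𝓡∂ n) ∞ M]

open Matrix

theorem eventually_abs_lt {δ : ℝ} (hδ : 0 < δ) : ∀ᶠ t in 𝓝 (0 : ℝ), |t| < δ := by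
  filter_upwards [Metric.ball_mem_nhds (0 : ℝ) hδ] with t ht
  simpa using ht

section VelocityIntegrable

variable {J : Set ℝ} {g : ℝ → Metric n M}

theorem weightVelocity_zero (p : M) : weightVelocity (fun _ _ => 0) p = 0 := by
  simp [weightVelocity]

variable [CompactSpace M]

/-- The `O(t)` bounds pass to the derivatives at `0`. The zero weight isolates the trace: the
density then has derivative `tr H / 2`, bounded by `C`, and subtracting the trace part from the
derivative of the form doubles the constant. -/
theorem exists_velocity_bound (hg : DifferentiableVariation J g) (hJ : IsOpen J)
    (h0 : (0 : ℝ) ∈ J) : ∃ C, 0 ≤ C ∧ ∀ p, |velocityTrace g p| ≤ C ∧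
      ∀ u v, |velocityForm g u v p| ≤ C * (√(cometric (g 0) u u p) * √(cometric (g 0) v v p)) := by
  have hη : ContMDiffOn (𝓘(ℝ, ℝ).prod (𝓡∂ n)) 𝓘(ℝ, ℝ) ∞
      (fun q : ℝ × M => (fun (_ : ℝ) (_ : M) => (0 : ℝ)) q.1 q.2) (J ×ˢ univ) := contMDiffOn_const
  obtain ⟨C, hC, δ, hδ, h⟩ := exists_weightRatio_bound (η := fun _ _ => 0) hg hJ hη h0
  have hev := eventually_abs_lt hδ
  have hρ : ∀ p, |velocityTrace g p| ≤ 2 * C := by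
    intro p
    have h1 := (hasDerivAt_weightRatio (η := fun _ _ => 0) hg hJ hη h0 p).le_of_lip' hC.le (hev.mono fun t ht => by
      simpa [weightRatio_self] using (h t ht p).1)
    rw [ratioVelocity, weightVelocity_zero, Real.norm_eq_abs, sub_zero, abs_div, abs_two] at h1
    linarith
  refine ⟨2 * C, by positivity, fun p => ⟨hρ p, fun u v => ?_⟩⟩
  set S := √(cometric (g 0) u u p) * √(cometric (g 0) v v p) with hS
  have hS0 : 0 ≤ S := by positivity
  have h1 := (hasDerivAt_weightRatio_mul_cometric (η := fun _ _ => 0) hg hJ hη h0 u v p).le_of_lip'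
    (C := C * S) (by positivity) (hev.mono fun t ht => by
      have := (h t ht p).2 u v
      rw [weightRatio_self, one_mul, sub_zero, Real.norm_eq_abs, Real.norm_eq_abs]
      linarith)
  have h2 := abs_cometric_le (g 0) u v p
  rw [Real.norm_eq_abs, ratioVelocity, weightVelocity_zero, sub_zero] at h1
  have h3 : |velocityTrace g p / 2 * cometric (g 0) u v p| ≤ C * S := by
    rw [abs_mul, abs_div, abs_two]
    exact mul_le_mul (by linarith [hρ p]) h2 (abs_nonneg _) hC.le
  rw [abs_le] at *
  constructor <;> linarith

variable [MeasurableSpace M] [BorelSpace M] [T2Space M]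

/-- A pointwise limit of difference quotients of continuous densities, again taken with zero weight.
-/
theorem measurable_velocityTrace (hg : DifferentiableVariation J g) (hJ : IsOpen J)
    (h0 : (0 : ℝ) ∈ J) : Measurable (velocityTrace g) := by
  have hη : ContMDiffOn (𝓘(ℝ, ℝ).prod (𝓡∂ n)) 𝓘(ℝ, ℝ) ∞
      (fun q : ℝ × M => (fun (_ : ℝ) (_ : M) => (0 : ℝ)) q.1 q.2) (J ×ˢ univ) := contMDiffOn_const
  have h : Measurable fun p => velocityTrace g p / 2 := by
    refine measurable_of_tendsto_metrizable' (𝓝[≠] (0 : ℝ))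
      (f := fun t p => slope (fun t => weightRatio (g 0) (g t) (fun _ => 0) (fun _ => 0) p) 0 t)
      (fun t => ?_) (tendsto_pi_nhds.2 fun p => ?_)
    · have h1 := fun t => (continuous_weightRatio (g 0) (g t) (η := fun _ => 0) (η' := fun _ => 0)
        continuous_const continuous_const).measurable
      simp only [slope, vsub_eq_sub, smul_eq_mul]
      exact measurable_const.mul ((h1 t).sub (h1 0))
    · have := hasDerivAt_iff_tendsto_slope.1 (hasDerivAt_weightRatio (η := fun _ _ => 0) hg hJ hη h0 p)
      simpa only [ratioVelocity, weightVelocity_zero, sub_zero] using this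
  simpa using h.mul_const 2

theorem measurable_velocityForm (hg : DifferentiableVariation J g) (hJ : IsOpen J)
    (h0 : (0 : ℝ) ∈ J) {u v : M → ℝ} (hu : ContMDiff (𝓡∂ n) 𝓘(ℝ, ℝ) ∞ u)
    (hv : ContMDiff (𝓡∂ n) 𝓘(ℝ, ℝ) ∞ v) : Measurable (velocityForm g u v) := by
  have hη : ContMDiffOn (𝓘(ℝ, ℝ).prod (𝓡∂ n)) 𝓘(ℝ, ℝ) ∞
      (fun q : ℝ × M => (fun (_ : ℝ) (_ : M) => (0 : ℝ)) q.1 q.2) (J ×ˢ univ) := contMDiffOn_const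
  have h : Measurable fun p => velocityTrace g p / 2 * cometric (g 0) u v p -
      velocityForm g u v p := by
    refine measurable_of_tendsto_metrizable' (𝓝[≠] (0 : ℝ))
      (f := fun t p => slope (fun t => weightRatio (g 0) (g t) (fun _ => 0) (fun _ => 0) p *
        cometric (g t) u v p) 0 t)
      (fun t => ?_) (tendsto_pi_nhds.2 fun p => ?_)
    · have h1 := fun t => ((continuous_weightRatio (g 0) (g t) (η := fun _ => 0) (η' := fun _ => 0)
        continuous_const continuous_const).mul (continuous_cometric (g t) hu hv)).measurable
      simp only [slope, vsub_eq_sub, smul_eq_mul]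
      exact measurable_const.mul ((h1 t).sub (h1 0))
    · have := hasDerivAt_iff_tendsto_slope.1
        (hasDerivAt_weightRatio_mul_cometric (η := fun _ _ => 0) hg hJ hη h0 u v p)
      simpa only [ratioVelocity, weightVelocity_zero, sub_zero] using this
  have h2 := (((measurable_velocityTrace hg hJ h0).div_const 2).mul
    (continuous_cometric (g 0) hu hv).measurable).sub h
  simpa only [Pi.sub_def, Pi.mul_def, sub_sub_cancel] using h2

theorem integrable_velocityTrace_mul (hg : DifferentiableVariation J g) (hJ : IsOpen J)
    (h0 : (0 : ℝ) ∈ J) {μ : Measure M} [IsFiniteMeasure μ] {f : M → ℝ} (hf : Continuous f) :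
    Integrable (fun p => velocityTrace g p * f p) μ := by
  obtain ⟨C, hC, h⟩ := exists_velocity_bound hg hJ h0
  exact (integrable_of_continuous hf).bdd_mul
    (measurable_velocityTrace hg hJ h0).aestronglyMeasurable
    (Eventually.of_forall fun p => (h p).1)

theorem integrable_velocityForm (hg : DifferentiableVariation J g) (hJ : IsOpen J)
    (h0 : (0 : ℝ) ∈ J) {μ : Measure M} [IsFiniteMeasure μ] {u v : M → ℝ}
    (hu : ContMDiff (𝓡∂ n) 𝓘(ℝ, ℝ) ∞ u) (hv : ContMDiff (𝓡∂ n) 𝓘(ℝ, ℝ) ∞ v) :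
    Integrable (velocityForm g u v) μ := by
  obtain ⟨C, hC, h⟩ := exists_velocity_bound hg hJ h0
  have h1 : Continuous fun p => C * (√(cometric (g 0) u u p) * √(cometric (g 0) v v p)) :=
    continuous_const.mul ((continuous_cometric (g 0) hu hu).sqrt.mul
      (continuous_cometric (g 0) hv hv).sqrt)
  exact (integrable_of_continuous h1).mono'
    (measurable_velocityForm hg hJ h0 hu hv).aestronglyMeasurable
    (Eventually.of_forall fun p => (h p).2 u v)

end VelocityIntegrable

/-! ### Differences of functions and convergence of energies -/

section EnergyConvergence

theorem diffVec_sub {u v : M → ℝ} (hu : ContMDiff (𝓡∂ n) 𝓘(ℝ, ℝ) ∞ u)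
    (hv : ContMDiff (𝓡∂ n) 𝓘(ℝ, ℝ) ∞ v) (p : M) :
    diffVec (n := n) (fun q => u q - v q) p = diffVec u p - diffVec v p := by
  have hs : ContMDiff (𝓡∂ n) 𝓘(ℝ, ℝ) ∞ fun q => u q - v q := hu.sub hv
  have ht := mem_extChartAt_target (I := 𝓡∂ n) p
  rw [diffVec_eq_chartDiff (hs.mdifferentiableAt (by simp)),
    diffVec_eq_chartDiff (hu.mdifferentiableAt (by simp)),
    diffVec_eq_chartDiff (hv.mdifferentiableAt (by simp))]
  ext k
  have e : (fun q => u q - v q) ∘ (extChartAt (𝓡∂ n) p).symm =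
    fun y => (u ∘ (extChartAt (𝓡∂ n) p).symm) y - (v ∘ (extChartAt (𝓡∂ n) p).symm) y := rfl
  have h := fderivWithin_fun_sub (𝕜 := ℝ) (uniqueDiffWithinAt_range_of_mem_target ht)
    (differentiableWithinAt_comp_chart_symm hu ht) (differentiableWithinAt_comp_chart_symm hv ht)
  rw [Pi.sub_apply]
  unfold chartDiff
  rw [e, h]
  rfl

theorem cometric_sub_left (g : Metric n M) {u v : M → ℝ} (hu : ContMDiff (𝓡∂ n) 𝓘(ℝ, ℝ) ∞ u)
    (hv : ContMDiff (𝓡∂ n) 𝓘(ℝ, ℝ) ∞ v) (w : M → ℝ) (p : M) :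
    cometric g (fun q => u q - v q) w p = cometric g u w p - cometric g v w p := by
  unfold cometric
  rw [diffVec_sub hu hv, sub_dotProduct]

theorem cometric_sub_self (g : Metric n M) {u v : M → ℝ} (hu : ContMDiff (𝓡∂ n) 𝓘(ℝ, ℝ) ∞ u)
    (hv : ContMDiff (𝓡∂ n) 𝓘(ℝ, ℝ) ∞ v) (p : M) :
    cometric g (fun q => u q - v q) (fun q => u q - v q) p =
      cometric g u u p - 2 * cometric g u v p + cometric g v v p := by
  rw [cometric_sub_left g hu hv, cometric_comm g u, cometric_comm g v,
    cometric_sub_left g hu hv, cometric_sub_left g hu hv, cometric_comm g v u]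
  ring

/-- Convergence to `0` in `L¹` of nonnegative functions implies that of their square roots. -/
theorem tendsto_integral_sqrt {X ι : Type*} [MeasurableSpace X] {μ : Measure X}
    [IsFiniteMeasure μ] {l : Filter ι} {F : ι → X → ℝ} (h0 : ∀ i x, 0 ≤ F i x)
    (hF : ∀ᶠ i in l, Integrable (F i) μ) (hF' : ∀ᶠ i in l, Integrable (fun x => √(F i x)) μ)
    (h : Tendsto (fun i => ∫ x, F i x ∂μ) l (𝓝 0)) :
    Tendsto (fun i => ∫ x, √(F i x) ∂μ) l (𝓝 0) := by
  refine tendsto_order.2 ⟨fun a ha => Eventually.of_forall fun i =>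
    ha.trans_le (integral_nonneg fun x => Real.sqrt_nonneg _), fun a ha => ?_⟩
  have hm : 0 ≤ μ.real univ := measureReal_nonneg
  -- Chosen so that in `√F ≤ F / s + s` the constant term integrates to less than `a / 2`; the other
  -- term is small once `∫ F` is.
  set s := a / (2 * (μ.real univ + 1)) with hs
  have hs0 : 0 < s := by positivity
  have hsm : s * μ.real univ < a / 2 := by
    rw [hs, div_mul_eq_mul_div, div_lt_div_iff₀ (by positivity) two_pos]
    nlinarith
  filter_upwards [hF, hF', h.eventually (gt_mem_nhds (show 0 < s * (a / 2) by positivity))]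
    with i h1 h2 h3
  have h4 : ∀ x, √(F i x) ≤ F i x / s + s := by
    intro x
    rw [div_add' _ _ _ hs0.ne', le_div_iff₀ hs0]
    nlinarith [Real.sq_sqrt (h0 i x), Real.sqrt_nonneg (F i x), sq_nonneg (√(F i x) - s),
      mul_nonneg (Real.sqrt_nonneg (F i x)) hs0.le]
  calc ∫ x, √(F i x) ∂μ ≤ ∫ x, (F i x / s + s) ∂μ :=
        integral_mono h2 ((h1.div_const s).add (integrable_const s)) h4
    _ = (∫ x, F i x ∂μ) / s + s * μ.real univ := by
        rw [integral_add (h1.div_const s) (integrable_const s), integral_div, integral_const,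
          smul_eq_mul, mul_comm s]
    _ < a / 2 + a / 2 := by
        refine add_lt_add ?_ hsm
        rw [div_lt_iff₀ hs0]
        linarith
    _ = a := by ring

end EnergyConvergence

end EtaLaplacian

namespace EtaLaplacian

/-! ### Families of eigenfunctions -/

variable {n : ℕ} [NeZero n] {M : Type*} [TopologicalSpace M]
  [ChartedSpace (EuclideanHalfSpace n) M] [IsManifold (𝓡∂ n) ∞ M]

open Matrix

section Eigenfamily

/-- The functions `φ t`, `t ∈ J`, depend differentiably on `t` and are Dirichlet eigenfunctions of
the `η t`-Laplacian of `g t` with eigenvalues `lam t`. -/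
structure IsEigenfamily (J : Set ℝ) (g : ℝ → Metric n M) (η φ : ℝ → M → ℝ) (lam : ℝ → ℝ) :
    Prop where
  contMDiff : ∀ t ∈ J, ContMDiff (𝓡∂ n) 𝓘(ℝ, ℝ) ∞ (φ t)
  differentiableFamily : DifferentiableFamily J φ univ
  eigen : ∀ t ∈ J, ∀ p, -etaLaplacian (g t) (η t) (φ t) p = lam t * φ t p
  dirichlet : ∀ t ∈ J, ∀ p ∈ (𝓡∂ n).boundary M, φ t p = 0

variable {J : Set ℝ} {g : ℝ → Metric n M} {η φ : ℝ → M → ℝ} {lam : ℝ → ℝ}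

variable [CompactSpace M] [T2Space M] [MeasurableSpace M] [BorelSpace M]

/-- The weak form of the eigenvalue equation. The continuity of the Laplacian required by Green's
formula is immediate here, since it equals `-c * v`. -/
theorem integral_cometric_of_eigen (g : Metric n M) {η u v : M → ℝ}
    (hη : ContMDiff (𝓡∂ n) 𝓘(ℝ, ℝ) ∞ η) (hu : ContMDiff (𝓡∂ n) 𝓘(ℝ, ℝ) ∞ u)
    (hv : ContMDiff (𝓡∂ n) 𝓘(ℝ, ℝ) ∞ v) {c : ℝ} (hve : ∀ p, -etaLaplacian g η v p = c * v p)
    (hu0 : ∀ p ∈ (𝓡∂ n).boundary M, u p = 0) :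
    ∫ p, cometric g u v p ∂(weightedVolume g η) = c * ∫ p, u p * v p ∂(weightedVolume g η) := by
  have hL : etaLaplacian g η v = fun p => -(c * v p) := by
    ext p; rw [← hve p, neg_neg]
  have h1 := integral_green g hη hv hu hu0 (by
    rw [hL]; exact (continuous_const.mul hv.continuous).neg)
  rw [← neg_eq_iff_eq_neg, ← integral_neg] at h1
  rw [← h1, hL, ← integral_const_mul]
  congr 1
  ext p
  ring

theorem IsEigenfamily.integral_cometric (h : IsEigenfamily J g η φ lam)
    (hη : ∀ t ∈ J, ContMDiff (𝓡∂ n) 𝓘(ℝ, ℝ) ∞ (η t)) {t : ℝ} (ht : t ∈ J) {u : M → ℝ}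
    (hu : ContMDiff (𝓡∂ n) 𝓘(ℝ, ℝ) ∞ u) (hu0 : ∀ p ∈ (𝓡∂ n).boundary M, u p = 0) :
    ∫ p, cometric (g t) u (φ t) p ∂(weightedVolume (g t) (η t)) =
      lam t * ∫ p, u p * φ t p ∂(weightedVolume (g t) (η t)) :=
  integral_cometric_of_eigen (g t) (hη t ht) hu (h.contMDiff t ht) (h.eigen t ht) hu0

theorem IsEigenfamily.integral_ratio_mul_cometric (h : IsEigenfamily J g η φ lam)
    (hη : ∀ t ∈ J, ContMDiff (𝓡∂ n) 𝓘(ℝ, ℝ) ∞ (η t)) (h0 : (0 : ℝ) ∈ J) {t : ℝ} (ht : t ∈ J)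
    {u : M → ℝ} (hu : ContMDiff (𝓡∂ n) 𝓘(ℝ, ℝ) ∞ u) (hu0 : ∀ p ∈ (𝓡∂ n).boundary M, u p = 0) :
    ∫ p, weightRatio (g 0) (g t) (η 0) (η t) p * cometric (g t) u (φ t) p
        ∂(weightedVolume (g 0) (η 0)) =
      lam t * ∫ p, weightRatio (g 0) (g t) (η 0) (η t) p * (u p * φ t p)
        ∂(weightedVolume (g 0) (η 0)) := by
  rw [← integral_weightedVolume_eq (g 0) (g t) (hη 0 h0).continuous (hη t ht).continuous,
    ← integral_weightedVolume_eq (g 0) (g t) (hη 0 h0).continuous (hη t ht).continuous]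
  exact h.integral_cometric hη ht hu hu0

theorem IsEigenfamily.exists_bound (h : IsEigenfamily J g η φ lam) (hJ : IsOpen J)
    (h0 : (0 : ℝ) ∈ J) : ∃ C > 0, ∃ δ > 0, ∀ t, |t| < δ → ∀ p, |φ t p - φ 0 p| ≤ C * |t| :=
  h.differentiableFamily.exists_uniform_bound h0
    ((hJ.eventually_mem h0).mono fun t ht => (h.contMDiff t ht).continuous)

theorem tendsto_zero_of_abs_le {X : Type*} {f : ℝ → X → ℝ} {C δ : ℝ} (hδ : 0 < δ) {x : X} {a : ℝ}
    (h : ∀ t, |t| < δ → |f t x - a| ≤ C * |t|) : Tendsto (fun t => f t x) (𝓝 0) (𝓝 a) := by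
  rw [tendsto_iff_norm_sub_tendsto_zero]
  have h1 : Tendsto (fun t : ℝ => C * |t|) (𝓝 0) (𝓝 0) := by
    have : Continuous fun t : ℝ => C * |t| := by fun_prop
    simpa using this.tendsto 0
  exact squeeze_zero' (Eventually.of_forall fun _ => norm_nonneg _)
    ((eventually_abs_lt hδ).mono h) h1

/-- Integrals of continuous functions converging uniformly converge. -/
theorem tendsto_integral_of_abs_le {μ : Measure M} [IsFiniteMeasure μ] {f : ℝ → M → ℝ}
    (hf : ∀ᶠ t in 𝓝 0, Continuous (f t)) {f₀ : M → ℝ} (hf₀ : Continuous f₀) {C δ : ℝ}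
    (hδ : 0 < δ) (h : ∀ t, |t| < δ → ∀ p, |f t p - f₀ p| ≤ C * |t|) :
    Tendsto (fun t => ∫ p, f t p ∂μ) (𝓝 0) (𝓝 (∫ p, f₀ p ∂μ)) := by
  rw [tendsto_iff_norm_sub_tendsto_zero]
  have h1 : Tendsto (fun t : ℝ => C * |t| * μ.real univ) (𝓝 0) (𝓝 0) := by
    have : Continuous fun t : ℝ => C * |t| * μ.real univ := by fun_prop
    simpa using this.tendsto 0
  refine squeeze_zero' (Eventually.of_forall fun _ => norm_nonneg _) ?_ h1
  filter_upwards [hf, eventually_abs_lt hδ] with t h2 h3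
  rw [← integral_sub (integrable_of_continuous h2) (integrable_of_continuous hf₀)]
  exact norm_integral_le_of_norm_le_const (Eventually.of_forall fun p => h t h3 p)

/-- The eigenfunctions converge in the Dirichlet norm. -/
theorem IsEigenfamily.tendsto_energy (h : IsEigenfamily J g η φ lam)
    (hg : DifferentiableVariation J g) (hJ : IsOpen J)
    (hη : ContMDiffOn (𝓘(ℝ, ℝ).prod (𝓡∂ n)) 𝓘(ℝ, ℝ) ∞
      (fun q : ℝ × M => η q.1 q.2) (J ×ˢ univ)) (h0 : (0 : ℝ) ∈ J) (hlam : ContinuousAt lam 0)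
    (hnorm : ∀ t ∈ J, ∫ p, φ t p * φ t p ∂(weightedVolume (g t) (η t)) = 1) :
    Tendsto (fun t => ∫ p, cometric (g 0) (fun q => φ t q - φ 0 q) (fun q => φ t q - φ 0 q) p
      ∂(weightedVolume (g 0) (η 0))) (𝓝 0) (𝓝 0) := by
  have hηs : ∀ t ∈ J, ContMDiff (𝓡∂ n) 𝓘(ℝ, ℝ) ∞ (η t) := fun t ht => contMDiff_slice hη ht
  have := isFiniteMeasure_weightedVolume (g 0) (hηs 0 h0).continuous
  set μ := weightedVolume (g 0) (η 0) with hμ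
  have hJn : ∀ᶠ t in 𝓝 (0 : ℝ), t ∈ J := hJ.mem_nhds h0
  obtain ⟨C, hC, δ, hδ, hR⟩ := exists_weightRatio_bound hg hJ hη h0
  obtain ⟨B, hB, δ', hδ', hφ⟩ := h.exists_bound hJ h0
  have hs := h.contMDiff
  set a : ℝ → ℝ := fun t => ∫ p, cometric (g 0) (φ t) (φ t) p ∂μ with ha
  have ha0 : ∀ t, 0 ≤ a t := fun t => integral_nonneg fun p => cometric_self_nonneg _ _ _
  have hcint : ∀ t ∈ J, Integrable (cometric (g 0) (φ t) (φ t)) μ := fun t ht =>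
    integrable_of_continuous (continuous_cometric (g 0) (hs t ht) (hs t ht))
  -- By the weak equation and normalization, `lam t` is the energy of `φ t` for time `t`; `a t` is
  -- its energy for time `0`, and the two forms differ by a relative error `C * |t|`.
  have hla : ∀ t ∈ J, |t| < δ → |lam t - a t| ≤ C * |t| * a t := by
    intro t ht htδ
    have h1 := h.integral_cometric hηs ht (hs t ht) (h.dirichlet t ht)
    rw [hnorm t ht, mul_one, integral_weightedVolume_eq (g 0) (g t) (hηs 0 h0).continuous
      (hηs t ht).continuous] at h1
    have hi : Integrable (fun p => weightRatio (g 0) (g t) (η 0) (η t) p *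
        cometric (g t) (φ t) (φ t) p) μ :=
      integrable_of_continuous ((continuous_weightRatio (g 0) (g t) (hηs 0 h0).continuous
        (hηs t ht).continuous).mul (continuous_cometric (g t) (hs t ht) (hs t ht)))
    rw [← h1, ha, ← integral_sub hi (hcint t ht), ← integral_const_mul, ← Real.norm_eq_abs]
    refine norm_integral_le_of_norm_le ((hcint t ht).const_mul _) (Eventually.of_forall fun p => ?_)
    have := (hR t htδ p).2 (φ t) (φ t)
    rwa [Real.mul_self_sqrt (cometric_self_nonneg _ _ _)] at this
  have hlim : Tendsto a (𝓝 0) (𝓝 (lam 0)) := by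
    have h1 : Tendsto (fun t => a t - lam t) (𝓝 0) (𝓝 0) := by
      have h2 : Tendsto (fun t => C * |t| * (2 * |lam t|)) (𝓝 0) (𝓝 0) := by
        have : ContinuousAt (fun t => C * |t| * (2 * |lam t|)) 0 := by fun_prop
        simpa [ContinuousAt] using this
      refine squeeze_zero_norm' ?_ h2
      filter_upwards [hJn, eventually_abs_lt hδ, eventually_abs_lt
        (show 0 < 1 / (2 * C) by positivity)] with t ht1 ht2 ht3
      have h3 := hla t ht1 ht2
      rw [lt_div_iff₀ (by positivity)] at ht3
      -- For `|t| < 1 / (2 * C)` the error is at most half of `a t` and can be absorbed, which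
      -- bounds `a t` by `2 * |lam t|`.
      have h4 : C * |t| * a t ≤ 1 / 2 * a t := mul_le_mul_of_nonneg_right (by linarith) (ha0 t)
      have h5 : a t ≤ 2 * |lam t| := by
        have := (abs_le.1 h3).1
        linarith [le_abs_self (lam t)]
      rw [Real.norm_eq_abs, abs_sub_comm]
      exact h3.trans (mul_le_mul_of_nonneg_left h5 (by positivity))
    simpa using h1.add hlam.tendsto
  have hinner : Tendsto (fun t => ∫ p, φ t p * φ 0 p ∂μ) (𝓝 0) (𝓝 1) := by
    rw [← hnorm 0 h0]
    obtain ⟨D, hD⟩ := isCompact_univ.exists_bound_of_continuousOn (hs 0 h0).continuous.continuousOn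
    refine tendsto_integral_of_abs_le (C := B * D) (f := fun t p => φ t p * φ 0 p) (hJn.mono fun t ht =>
      (hs t ht).continuous.mul (hs 0 h0).continuous)
      ((hs 0 h0).continuous.mul (hs 0 h0).continuous) hδ' fun t ht p => ?_
    rw [← sub_mul, abs_mul]
    calc _ ≤ B * |t| * D := mul_le_mul (hφ t ht p) (hD p (mem_univ p)) (abs_nonneg _) (by positivity)
      _ = _ := by ring
  -- Expanding the square, the mixed term is evaluated by the weak equation of `φ 0` tested with `φ
  -- t`, so no derivative of `φ t` is left in it.
  have hexp : ∀ t ∈ J, ∫ p, cometric (g 0) (fun q => φ t q - φ 0 q) (fun q => φ t q - φ 0 q) p ∂μ =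
      a t - 2 * (lam 0 * ∫ p, φ t p * φ 0 p ∂μ) + lam 0 := by
    intro t ht
    have h1 := h.integral_cometric hηs h0 (hs t ht) (h.dirichlet t ht)
    have h2 := h.integral_cometric hηs h0 (hs 0 h0) (h.dirichlet 0 h0)
    rw [hnorm 0 h0, mul_one] at h2
    have hi : Integrable (cometric (g 0) (φ t) (φ 0)) μ :=
      integrable_of_continuous (continuous_cometric (g 0) (hs t ht) (hs 0 h0))
    simp_rw [cometric_sub_self (g 0) (hs t ht) (hs 0 h0)]
    have hi' : Integrable (fun p => cometric (g 0) (φ t) (φ t) p -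
        2 * cometric (g 0) (φ t) (φ 0) p) μ := (hcint t ht).sub (hi.const_mul 2)
    rw [integral_add hi' (hcint 0 h0),
      integral_sub (hcint t ht) (hi.const_mul 2), integral_const_mul, h1, h2]
  have hfin : Tendsto (fun t => a t - 2 * (lam 0 * ∫ p, φ t p * φ 0 p ∂μ) + lam 0) (𝓝 0)
      (𝓝 (lam 0 - 2 * (lam 0 * 1) + lam 0)) :=
    (hlim.sub ((hinner.const_mul _).const_mul _)).add tendsto_const_nhds
  rw [show lam 0 - 2 * (lam 0 * 1) + lam 0 = 0 by ring] at hfin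
  exact hfin.congr' (hJn.mono fun t ht => (hexp t ht).symm)

/-- The first variation of an eigenvalue, tested against an eigenfunction at `t = 0`. -/
theorem IsEigenfamily.deriv_mul_integral (h : IsEigenfamily J g η φ lam)
    (hg : DifferentiableVariation J g) (hJ : IsOpen J)
    (hη : ContMDiffOn (𝓘(ℝ, ℝ).prod (𝓡∂ n)) 𝓘(ℝ, ℝ) ∞
      (fun q : ℝ × M => η q.1 q.2) (J ×ˢ univ)) (h0 : (0 : ℝ) ∈ J)
    (hlam : DifferentiableAt ℝ lam 0)
    (hnorm : ∀ t ∈ J, ∫ p, φ t p * φ t p ∂(weightedVolume (g t) (η t)) = 1) {ψ : M → ℝ}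
    (hψ : ContMDiff (𝓡∂ n) 𝓘(ℝ, ℝ) ∞ ψ) (hψ0 : ∀ p ∈ (𝓡∂ n).boundary M, ψ p = 0)
    (hψe : ∀ p, -etaLaplacian (g 0) (η 0) ψ p = lam 0 * ψ p) :
    deriv lam 0 * ∫ p, φ 0 p * ψ p ∂(weightedVolume (g 0) (η 0)) +
      lam 0 * ∫ p, ratioVelocity g η p * (φ 0 p * ψ p) ∂(weightedVolume (g 0) (η 0)) =
      ∫ p, (ratioVelocity g η p * cometric (g 0) (φ 0) ψ p - velocityForm g (φ 0) ψ p)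
        ∂(weightedVolume (g 0) (η 0)) := by
  have hηs : ∀ t ∈ J, ContMDiff (𝓡∂ n) 𝓘(ℝ, ℝ) ∞ (η t) := fun t ht => contMDiff_slice hη ht
  have := isFiniteMeasure_weightedVolume (g 0) (hηs 0 h0).continuous
  have henergy := h.tendsto_energy hg hJ hη h0 hlam.continuousAt hnorm
  set μ := weightedVolume (g 0) (η 0) with hμ
  have hJn : ∀ᶠ t in 𝓝 (0 : ℝ), t ∈ J := hJ.mem_nhds h0
  have hJn' : ∀ᶠ t in 𝓝[≠] (0 : ℝ), t ∈ J := nhdsWithin_le_nhds hJn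
  obtain ⟨C, hC, δ, hδ, hR⟩ := exists_weightRatio_bound hg hJ hη h0
  obtain ⟨B, hB, δ', hδ', hφ⟩ := h.exists_bound hJ h0
  have hδn : ∀ᶠ t in 𝓝[≠] (0 : ℝ), |t| < δ := nhdsWithin_le_nhds (eventually_abs_lt hδ)
  have hδn' : ∀ᶠ t in 𝓝[≠] (0 : ℝ), |t| < δ' := nhdsWithin_le_nhds (eventually_abs_lt hδ')
  have hs := h.contMDiff
  set ρ : ℝ → M → ℝ := fun t => weightRatio (g 0) (g t) (η 0) (η t) with hρ
  have hρc : ∀ t ∈ J, Continuous (ρ t) := fun t ht =>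
    continuous_weightRatio (g 0) (g t) (hηs 0 h0).continuous (hηs t ht).continuous
  have hρ0 : ∀ p, ρ 0 p = 1 := fun p => weightRatio_self _ _ _
  have hρlim : ∀ p, Tendsto (fun t => ρ t p) (𝓝[≠] 0) (𝓝 1) := fun p =>
    (tendsto_zero_of_abs_le hδ fun t ht => (hR t ht p).1).mono_left nhdsWithin_le_nhds
  have hφlim : ∀ p, Tendsto (fun t => φ t p) (𝓝[≠] 0) (𝓝 (φ 0 p)) := fun p =>
    (tendsto_zero_of_abs_le hδ' fun t ht => hφ t ht p).mono_left nhdsWithin_le_nhds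
  obtain ⟨P, hP⟩ := isCompact_univ.exists_bound_of_continuousOn (hs 0 h0).continuous.continuousOn
  obtain ⟨Q, hQ⟩ := isCompact_univ.exists_bound_of_continuousOn hψ.continuous.continuousOn
  have hφP : ∀ t, |t| < δ' → ∀ p, |φ t p| ≤ P + B * δ' := by
    intro t ht p
    have h1 := hP p (mem_univ p)
    have h2 : B * |t| ≤ B * δ' := mul_le_mul_of_nonneg_left ht.le hB.le
    have h3 := hφ t ht p
    rw [Real.norm_eq_abs] at h1
    rw [abs_le] at *
    constructor <;> linarith
  have hψcc := continuous_cometric (g 0) hψ hψ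
  obtain ⟨S, hS⟩ := isCompact_univ.exists_bound_of_continuousOn hψcc.sqrt.continuousOn
  have hweak : ∀ t ∈ J, ∫ p, ρ t p * cometric (g t) (φ t) ψ p ∂μ =
      lam t * ∫ p, ρ t p * (φ t p * ψ p) ∂μ := by
    intro t ht
    have := h.integral_ratio_mul_cometric hηs h0 ht hψ hψ0
    simpa only [cometric_comm (g t) ψ, mul_comm (ψ _)] using this
  -- The equation of `ψ` at time `0` will be tested with `φ t` itself; here the assumption that `ψ`
  -- has the eigenvalue `lam 0` enters.
  have hψfam : ∀ u : M → ℝ, ContMDiff (𝓡∂ n) 𝓘(ℝ, ℝ) ∞ u →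
      (∀ p ∈ (𝓡∂ n).boundary M, u p = 0) →
      ∫ p, cometric (g 0) u ψ p ∂μ = lam 0 * ∫ p, u p * ψ p ∂μ := fun u hu hu0 =>
    integral_cometric_of_eigen (g 0) (hηs 0 h0) hu hψ hψe hu0
  have hlim1 : Tendsto (fun t => ∫ p, ρ t p * (φ t p * ψ p) ∂μ) (𝓝[≠] 0)
      (𝓝 (∫ p, φ 0 p * ψ p ∂μ)) := by
    refine tendsto_integral_filter_of_dominated_convergence
      (fun _ => (1 + C * δ) * ((P + B * δ') * Q)) ?_ ?_ (integrable_const _) ?_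
    · exact hJn'.mono fun t ht => ((hρc t ht).mul ((hs t ht).continuous.mul
        hψ.continuous)).measurable.aestronglyMeasurable
    · filter_upwards [hδn, hδn'] with t ht ht'
      refine Eventually.of_forall fun p => ?_
      have h1 : |ρ t p| ≤ 1 + C * δ := by
        have h2 := (hR t ht p).1
        have h3 : C * |t| ≤ C * δ := mul_le_mul_of_nonneg_left ht.le hC.le
        rw [abs_le] at *
        constructor <;> linarith
      rw [Real.norm_eq_abs, abs_mul, abs_mul]
      exact mul_le_mul h1 (mul_le_mul (hφP t ht' p) (hQ p (mem_univ p)) (abs_nonneg _)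
        ((abs_nonneg _).trans (hφP t ht' p))) (by positivity) (by positivity)
    · refine Eventually.of_forall fun p => ?_
      simpa using (hρlim p).mul ((hφlim p).mul_const (ψ p))
  have hlim2 : Tendsto (fun t => ∫ p, (ρ t p - 1) / t * (φ t p * ψ p) ∂μ) (𝓝[≠] 0)
      (𝓝 (∫ p, ratioVelocity g η p * (φ 0 p * ψ p) ∂μ)) := by
    refine tendsto_integral_filter_of_dominated_convergence
      (fun _ => C * ((P + B * δ') * Q)) ?_ ?_ (integrable_const _) ?_
    · exact hJn'.mono fun t ht => ((((hρc t ht).sub continuous_const).div_const t).mul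
        ((hs t ht).continuous.mul hψ.continuous)).measurable.aestronglyMeasurable
    · filter_upwards [hδn, hδn', self_mem_nhdsWithin] with t ht ht' htne
      refine Eventually.of_forall fun p => ?_
      have h1 : |(ρ t p - 1) / t| ≤ C := by
        rw [abs_div, div_le_iff₀ (abs_pos.2 htne)]
        exact (hR t ht p).1
      rw [Real.norm_eq_abs, abs_mul, abs_mul]
      exact mul_le_mul h1 (mul_le_mul (hφP t ht' p) (hQ p (mem_univ p)) (abs_nonneg _)
        ((abs_nonneg _).trans (hφP t ht' p))) (by positivity) (by positivity)
    · refine Eventually.of_forall fun p => ?_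
      refine Tendsto.mul ?_ ((hφlim p).mul_const (ψ p))
      have := hasDerivAt_iff_tendsto_slope.1 (hasDerivAt_weightRatio hg hJ hη h0 p)
      refine this.congr fun t => ?_
      rw [slope_def_field, weightRatio_self, sub_zero]
  -- The limit of the main part, where the fixed function `φ 0` replaces `φ t` and the pointwise
  -- derivative of the form can be used under dominated convergence.
  have hlim3 : Tendsto (fun t => ∫ p, (ρ t p * cometric (g t) (φ 0) ψ p -
      cometric (g 0) (φ 0) ψ p) / t ∂μ) (𝓝[≠] 0)
      (𝓝 (∫ p, (ratioVelocity g η p * cometric (g 0) (φ 0) ψ p - velocityForm g (φ 0) ψ p)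
        ∂μ)) := by
    have hcc := continuous_cometric (g 0) (hs 0 h0) (hs 0 h0)
    refine tendsto_integral_filter_of_dominated_convergence
      (fun p => C * (√(cometric (g 0) (φ 0) (φ 0) p) * √(cometric (g 0) ψ ψ p))) ?_ ?_
      (integrable_of_continuous (continuous_const.mul (hcc.sqrt.mul hψcc.sqrt))) ?_
    · exact hJn'.mono fun t ht => ((((hρc t ht).mul (continuous_cometric (g t) (hs 0 h0) hψ)).sub
        (continuous_cometric (g 0) (hs 0 h0) hψ)).div_const t).measurable.aestronglyMeasurable
    · filter_upwards [hδn, self_mem_nhdsWithin] with t ht htne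
      refine Eventually.of_forall fun p => ?_
      rw [Real.norm_eq_abs, abs_div, div_le_iff₀ (abs_pos.2 htne)]
      exact ((hR t ht p).2 _ _).trans (le_of_eq (by ring))
    · refine Eventually.of_forall fun p => ?_
      have := hasDerivAt_iff_tendsto_slope.1
        (hasDerivAt_weightRatio_mul_cometric hg hJ hη h0 (φ 0) ψ p)
      refine this.congr fun t => ?_
      rw [slope_def_field, weightRatio_self, sub_zero, one_mul]
  set d : ℝ → M → ℝ := fun t q => φ t q - φ 0 q with hd
  have hds : ∀ t ∈ J, ContMDiff (𝓡∂ n) 𝓘(ℝ, ℝ) ∞ (d t) := fun t ht => (hs t ht).sub (hs 0 h0)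
  have hdc : ∀ t ∈ J, Continuous (cometric (g 0) (d t) (d t)) := fun t ht =>
    continuous_cometric (g 0) (hds t ht) (hds t ht)
  -- The remainder. Dividing the `O(t)` bound on the difference of the forms by `t` leaves `C * S`
  -- times the `L¹` norm of `|d (φ t - φ 0)|`, which vanishes in the limit by convergence of
  -- energies.
  have hlim4 : Tendsto (fun t => ∫ p, (ρ t p * cometric (g t) (d t) ψ p -
      cometric (g 0) (d t) ψ p) / t ∂μ) (𝓝[≠] 0) (𝓝 0) := by
    have h1 := tendsto_integral_sqrt (μ := μ) (l := 𝓝 (0 : ℝ))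
      (F := fun t p => cometric (g 0) (d t) (d t) p) (fun t p => cometric_self_nonneg _ _ _)
      (hJn.mono fun t ht => integrable_of_continuous (hdc t ht))
      (hJn.mono fun t ht => integrable_of_continuous (hdc t ht).sqrt) henergy
    have h2 := (h1.mono_left (nhdsWithin_le_nhds (s := {0}ᶜ))).const_mul (C * S)
    rw [mul_zero] at h2
    refine squeeze_zero_norm' ?_ h2
    filter_upwards [hδn, hJn', self_mem_nhdsWithin] with t ht htJ htne
    rw [← integral_const_mul]
    refine norm_integral_le_of_norm_le
      ((integrable_of_continuous (hdc t htJ).sqrt).const_mul _) (Eventually.of_forall fun p => ?_)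
    rw [Real.norm_eq_abs, abs_div, div_le_iff₀ (abs_pos.2 htne)]
    have h3 : √(cometric (g 0) ψ ψ p) ≤ S := (le_abs_self _).trans (hS p (mem_univ p))
    refine ((hR t ht p).2 _ _).trans ?_
    calc C * |t| * (√(cometric (g 0) (d t) (d t) p) * √(cometric (g 0) ψ ψ p)) ≤
          C * |t| * (√(cometric (g 0) (d t) (d t) p) * S) := by gcongr
      _ = _ := by ring
  have hlim5 : Tendsto (fun t => (lam t - lam 0) / t) (𝓝[≠] 0) (𝓝 (deriv lam 0)) := by
    have := hasDerivAt_iff_tendsto_slope.1 hlam.hasDerivAt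
    refine this.congr fun t => ?_
    rw [slope_def_field, sub_zero]
  have hleft := (hlim5.mul hlim1).add (hlim2.const_mul (lam 0))
  have hright := hlim3.add hlim4
  rw [add_zero] at hright
  -- For `t ≠ 0` both expressions equal the difference of the weak equations at times `t` and `0`,
  -- divided by `t`; so their limits coincide.
  refine tendsto_nhds_unique (hleft.congr' ?_) hright
  filter_upwards [hJn', self_mem_nhdsWithin] with t ht htne
  have htne' : t ≠ 0 := htne
  have i1 : ∀ s ∈ J, ∀ u : M → ℝ, ContMDiff (𝓡∂ n) 𝓘(ℝ, ℝ) ∞ u →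
      Integrable (fun p => ρ s p * cometric (g s) u ψ p) μ := fun s hs u hu =>
    integrable_of_continuous ((hρc s hs).mul (continuous_cometric (g s) hu hψ))
  have i2 : ∀ u : M → ℝ, ContMDiff (𝓡∂ n) 𝓘(ℝ, ℝ) ∞ u →
      Integrable (cometric (g 0) u ψ) μ := fun u hu =>
    integrable_of_continuous (continuous_cometric (g 0) hu hψ)
  have i3 : Integrable (fun p => ρ t p * (φ t p * ψ p)) μ :=
    integrable_of_continuous ((hρc t ht).mul ((hs t ht).continuous.mul hψ.continuous))
  have i4 : Integrable (fun p => φ t p * ψ p) μ :=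
    integrable_of_continuous ((hs t ht).continuous.mul hψ.continuous)
  have e1 : ∫ p, (ρ t p - 1) / t * (φ t p * ψ p) ∂μ =
      (∫ p, ρ t p * (φ t p * ψ p) ∂μ - ∫ p, φ t p * ψ p ∂μ) / t := by
    rw [← integral_sub i3 i4, ← integral_div]
    congr 1
    ext p
    ring
  have e2 : ∀ u : M → ℝ, ContMDiff (𝓡∂ n) 𝓘(ℝ, ℝ) ∞ u →
      ∫ p, (ρ t p * cometric (g t) u ψ p - cometric (g 0) u ψ p) / t ∂μ =
      (∫ p, ρ t p * cometric (g t) u ψ p ∂μ - ∫ p, cometric (g 0) u ψ p ∂μ) / t := fun u hu => by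
    rw [← integral_sub (i1 t ht u hu) (i2 u hu), ← integral_div]
  have e3 : ∫ p, ρ t p * cometric (g t) (d t) ψ p ∂μ =
      ∫ p, ρ t p * cometric (g t) (φ t) ψ p ∂μ - ∫ p, ρ t p * cometric (g t) (φ 0) ψ p ∂μ := by
    rw [← integral_sub (i1 t ht _ (hs t ht)) (i1 t ht _ (hs 0 h0))]
    congr 1
    ext p
    rw [hd, cometric_sub_left _ (hs t ht) (hs 0 h0)]
    ring
  have e4 : ∫ p, cometric (g 0) (d t) ψ p ∂μ =
      ∫ p, cometric (g 0) (φ t) ψ p ∂μ - ∫ p, cometric (g 0) (φ 0) ψ p ∂μ := by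
    rw [← integral_sub (i2 _ (hs t ht)) (i2 _ (hs 0 h0))]
    congr 1
    ext p
    rw [hd, cometric_sub_left _ (hs t ht) (hs 0 h0)]
  rw [e1, e2 _ (hs 0 h0), e2 _ (hds t ht), e3, e4, hweak t ht,
    hψfam _ (hs t ht) (h.dirichlet t ht)]
  field_simp
  ring

end Eigenfamily

end EtaLaplacian

namespace EtaLaplacian

/-! ### Products of eigenfunctions -/

variable {n : ℕ} [NeZero n] {M : Type*} [TopologicalSpace M]
  [ChartedSpace (EuclideanHalfSpace n) M] [IsManifold (𝓡∂ n) ∞ M]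

open Matrix

section Variation

variable [CompactSpace M] [T2Space M] [MeasurableSpace M] [BorelSpace M]

/-- The weight `w` need not vanish on the boundary, but `w * u` and `w * v` do. Testing the equation
of `v` with the first and that of `u` with the second, and adding, gives the claim, because `⟨d(wu),
dv⟩ + ⟨d(wv), du⟩ = ⟨dw, d(uv)⟩ + 2 w ⟨du, dv⟩`. -/
theorem integral_cometric_mul_of_eigen (g : Metric n M) {η w u v : M → ℝ}
    (hη : ContMDiff (𝓡∂ n) 𝓘(ℝ, ℝ) ∞ η) (hw : ContMDiff (𝓡∂ n) 𝓘(ℝ, ℝ) ∞ w)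
    (hu : ContMDiff (𝓡∂ n) 𝓘(ℝ, ℝ) ∞ u) (hv : ContMDiff (𝓡∂ n) 𝓘(ℝ, ℝ) ∞ v) {c : ℝ}
    (hue : ∀ p, -etaLaplacian g η u p = c * u p) (hve : ∀ p, -etaLaplacian g η v p = c * v p)
    (hu0 : ∀ p ∈ (𝓡∂ n).boundary M, u p = 0) (hv0 : ∀ p ∈ (𝓡∂ n).boundary M, v p = 0) :
    ∫ p, cometric g w (fun q => u q * v q) p ∂(weightedVolume g η) =
      2 * (c * ∫ p, w p * (u p * v p) ∂(weightedVolume g η)) -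
        2 * ∫ p, w p * cometric g u v p ∂(weightedVolume g η) := by
  have := isFiniteMeasure_weightedVolume g hη.continuous
  have h1 := integral_cometric_of_eigen g hη (contMDiff_mul hw hu) hv hve
    fun p hp => by rw [hu0 p hp, mul_zero]
  have h2 := integral_cometric_of_eigen g hη (contMDiff_mul hw hv) hu hue
    fun p hp => by rw [hv0 p hp, mul_zero]
  have e1 : ∫ p, w p * u p * v p ∂(weightedVolume g η) =
      ∫ p, w p * (u p * v p) ∂(weightedVolume g η) := by
    congr 1; ext p; ring
  have e2 : ∫ p, w p * v p * u p ∂(weightedVolume g η) =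
      ∫ p, w p * (u p * v p) ∂(weightedVolume g η) := by
    congr 1; ext p; ring
  have i1 : Integrable (cometric g (fun q => w q * u q) v) (weightedVolume g η) :=
    integrable_of_continuous (continuous_cometric g (contMDiff_mul hw hu) hv)
  have i2 : Integrable (cometric g (fun q => w q * v q) u) (weightedVolume g η) :=
    integrable_of_continuous (continuous_cometric g (contMDiff_mul hw hv) hu)
  have i3 : Integrable (fun p => 2 * (w p * cometric g u v p)) (weightedVolume g η) :=
    integrable_of_continuous
      (continuous_const.mul (hw.continuous.mul (continuous_cometric g hu hv)))
  have i12 : Integrable (fun p => cometric g (fun q => w q * u q) v p +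
      cometric g (fun q => w q * v q) u p) (weightedVolume g η) := i1.add i2
  rw [← e1, two_mul, ← h1]
  nth_rewrite 2 [h1]
  rw [e1, ← e2, ← h2, ← integral_const_mul, ← integral_add i1 i2, ← integral_sub i12 i3]
  congr 1
  ext p
  rw [cometric_mul_right g w hu hv, cometric_mul_left g v hw hu, cometric_mul_left g u hw hv,
    cometric_comm g v u]
  ring

end Variation

end EtaLaplacian

/-! ### The first variation formula -/

theorem proposition3p2 {n : ℕ} [NeZero n] {M : Type*} [TopologicalSpace M] [T2Space M]
    [CompactSpace M] [ChartedSpace (EuclideanHalfSpace n) M] [IsManifold (𝓡∂ n) ∞ M]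
    [MeasurableSpace M] [BorelSpace M]
    (ε : ℝ) (hε : 0 < ε)
    -- the variation of the metric and of the weight
    (g : ℝ → Metric n M)
    (hg : DifferentiableVariation (Ioo (-ε) ε) g)
    (η : ℝ → M → ℝ)
    (hη : ContMDiffOn (𝓘(ℝ, ℝ).prod (𝓡∂ n)) 𝓘(ℝ, ℝ) ∞ (fun q : ℝ × M => η q.1 q.2)
      (Ioo (-ε) ε ×ˢ univ))
    -- the eigenfunctions and the eigenvalues
    {m : ℕ} (φ : Fin m → ℝ → M → ℝ) (lam : Fin m → ℝ → ℝ) (lam₀ : ℝ)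
    (hφ_smooth : ∀ i, ∀ t ∈ Ioo (-ε) ε, ContMDiff (𝓡∂ n) 𝓘(ℝ, ℝ) ∞ (φ i t))
    (hφ_diff : ∀ i, DifferentiableFamily (Ioo (-ε) ε) (φ i) univ)
    (hlam_diff : ∀ i, DifferentiableOn ℝ (lam i) (Ioo (-ε) ε))
    (hlam_zero : ∀ i, lam i 0 = lam₀)
    (heigen : ∀ i, ∀ t ∈ Ioo (-ε) ε, ∀ p : M,
      -etaLaplacian (g t) (η t) (φ i t) p = lam i t * φ i t p)
    (hdirichlet : ∀ i, ∀ t ∈ Ioo (-ε) ε, ∀ p ∈ (𝓡∂ n).boundary M, φ i t p = 0)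
    (hortho : ∀ i j, ∀ t ∈ Ioo (-ε) ε,
      ∫ p, φ i t p * φ j t p ∂(weightedVolume (g t) (η t)) = if i = j then 1 else 0)
    (i j : Fin m) :
    Integrable (fun p => tensorInner (g 0) p
        (fun v w =>
          1 / 2 * etaLaplacian (g 0) (η 0) (fun q => φ i 0 q * φ j 0 q) p *
              (g 0).inner p v w
            - 2 * (differential (φ i 0) p v * differential (φ j 0) p w))
        (metricVelocity g p))
      (weightedVolume (g 0) (η 0)) ∧
    Integrable (fun p => (g 0).inner p
        (riemannianGradient (g 0) (weightVelocity η) p)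
        (riemannianGradient (g 0) (fun q => φ i 0 q * φ j 0 q) p))
      (weightedVolume (g 0) (η 0)) ∧
    HasDerivAt (fun t => (lam i t + lam j t) * (if i = j then 1 else 0))
      ((∫ p, tensorInner (g 0) p
          (fun v w =>
            1 / 2 * etaLaplacian (g 0) (η 0) (fun q => φ i 0 q * φ j 0 q) p *
                (g 0).inner p v w
              - 2 * (differential (φ i 0) p v * differential (φ j 0) p w))
          (metricVelocity g p) ∂(weightedVolume (g 0) (η 0)))
        + ∫ p, (g 0).inner p
            (riemannianGradient (g 0) (weightVelocity η) p)
            (riemannianGradient (g 0) (fun q => φ i 0 q * φ j 0 q) p)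
          ∂(weightedVolume (g 0) (η 0)))
      0 := by

  have h0 : (0 : ℝ) ∈ Ioo (-ε) ε := ⟨by linarith, hε⟩
  have hJ : IsOpen (Ioo (-ε) ε) := isOpen_Ioo
  have hfam : ∀ k, IsEigenfamily (Ioo (-ε) ε) g η (φ k) (lam k) := fun k =>
    ⟨hφ_smooth k, hφ_diff k, heigen k, hdirichlet k⟩
  have hη0 : ContMDiff (𝓡∂ n) 𝓘(ℝ, ℝ) ∞ (η 0) := contMDiff_slice hη h0
  have hw : ContMDiff (𝓡∂ n) 𝓘(ℝ, ℝ) ∞ (weightVelocity η) := contMDiff_weightVelocity hJ hη h0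
  have := isFiniteMeasure_weightedVolume (g 0) hη0.continuous
  have hi := hφ_smooth i 0 h0
  have hj := hφ_smooth j 0 h0
  have hie : ∀ p, -etaLaplacian (g 0) (η 0) (φ i 0) p = lam₀ * φ i 0 p := fun p => by
    rw [heigen i 0 h0, hlam_zero]
  have hje : ∀ p, -etaLaplacian (g 0) (η 0) (φ j 0) p = lam₀ * φ j 0 p := fun p => by
    rw [heigen j 0 h0, hlam_zero]
  have hdi : DifferentiableAt ℝ (lam i) 0 := (hlam_diff i).differentiableAt (hJ.mem_nhds h0)
  -- The test function is the eigenfunction `φ j 0`; it has the eigenvalue of `φ i 0` because all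
  -- eigenvalues agree at time `0`.
  have hkey := (hfam i).deriv_mul_integral hg hJ hη h0 hdi
    (fun t ht => by simpa using hortho i i t ht) hj (hdirichlet j 0 h0)
    (fun p => by rw [heigen j 0 h0, hlam_zero, hlam_zero])
  rw [hortho i j 0 h0, hlam_zero] at hkey
  have hvel := integral_cometric_mul_of_eigen (g 0) hη0 hw hi hj hie hje
    (hdirichlet i 0 h0) (hdirichlet j 0 h0)
  set μ := weightedVolume (g 0) (η 0) with hμ
  -- The product rule with both eigenvalue equations: the zeroth-order terms add up to `-2 * lam₀ *
  -- φ i 0 * φ j 0`.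
  have hL : ∀ p, 1 / 2 * etaLaplacian (g 0) (η 0) (fun q => φ i 0 q * φ j 0 q) p =
      cometric (g 0) (φ i 0) (φ j 0) p - lam₀ * (φ i 0 p * φ j 0 p) := by
    intro p
    rw [etaLaplacian_mul (g 0) (η 0) hi hj]
    linear_combination (-(1 / 2)) * φ i 0 p * hje p - 1 / 2 * φ j 0 p * hie p
  have hT : ∀ p, tensorInner (g 0) p
      (fun v w => 1 / 2 * etaLaplacian (g 0) (η 0) (fun q => φ i 0 q * φ j 0 q) p *
        (g 0).inner p v w - 2 * (differential (φ i 0) p v * differential (φ j 0) p w))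
      (metricVelocity g p) =
      velocityTrace g p * cometric (g 0) (φ i 0) (φ j 0) p -
        lam₀ * (velocityTrace g p * (φ i 0 p * φ j 0 p)) -
        2 * velocityForm g (φ i 0) (φ j 0) p := by
    intro p
    rw [tensorInner_velocity, hL]
    ring
  have hccont := continuous_cometric (g 0) hi hj
  have hfcont : Continuous fun p => φ i 0 p * φ j 0 p := hi.continuous.mul hj.continuous
  have iA : Integrable (fun p => velocityTrace g p * (φ i 0 p * φ j 0 p)) μ :=
    integrable_velocityTrace_mul hg hJ h0 hfcont
  have iB : Integrable (fun p => velocityTrace g p * cometric (g 0) (φ i 0) (φ j 0) p) μ :=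
    integrable_velocityTrace_mul hg hJ h0 hccont
  have iV : Integrable (velocityForm g (φ i 0) (φ j 0)) μ :=
    integrable_velocityForm hg hJ h0 hi hj
  have iX : Integrable (fun p => weightVelocity η p * (φ i 0 p * φ j 0 p)) μ :=
    integrable_of_continuous (hw.continuous.mul hfcont)
  have iY : Integrable (fun p => weightVelocity η p * cometric (g 0) (φ i 0) (φ j 0) p) μ :=
    integrable_of_continuous (hw.continuous.mul hccont)
  have iBA : Integrable (fun p => velocityTrace g p * cometric (g 0) (φ i 0) (φ j 0) p -
      lam₀ * (velocityTrace g p * (φ i 0 p * φ j 0 p))) μ := iB.sub (iA.const_mul _)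
  have e1 : ∫ p, ratioVelocity g η p * (φ i 0 p * φ j 0 p) ∂μ =
      1 / 2 * ∫ p, velocityTrace g p * (φ i 0 p * φ j 0 p) ∂μ -
        ∫ p, weightVelocity η p * (φ i 0 p * φ j 0 p) ∂μ := by
    rw [← integral_const_mul, ← integral_sub (iA.const_mul _) iX]
    congr 1
    ext p
    rw [ratioVelocity]
    ring
  have iR : Integrable (fun p => ratioVelocity g η p * cometric (g 0) (φ i 0) (φ j 0) p) μ := by
    refine ((iB.const_mul (1 / 2)).sub iY).congr (Eventually.of_forall fun p => ?_)
    simp only [Pi.sub_apply, ratioVelocity]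
    ring
  have e2 : ∫ p, (ratioVelocity g η p * cometric (g 0) (φ i 0) (φ j 0) p -
      velocityForm g (φ i 0) (φ j 0) p) ∂μ =
      1 / 2 * ∫ p, velocityTrace g p * cometric (g 0) (φ i 0) (φ j 0) p ∂μ -
        ∫ p, weightVelocity η p * cometric (g 0) (φ i 0) (φ j 0) p ∂μ -
        ∫ p, velocityForm g (φ i 0) (φ j 0) p ∂μ := by
    rw [integral_sub iR iV, ← integral_const_mul, ← integral_sub (iB.const_mul _) iY]
    congr 2
    ext p
    rw [ratioVelocity]
    ring
  rw [e1, e2] at hkey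
  simp_rw [hT, inner_riemannianGradient]
  refine ⟨iBA.sub (iV.const_mul 2), integrable_of_continuous
    (continuous_cometric (g 0) hw (contMDiff_mul hi hj)), ?_⟩
  rw [integral_sub iBA (iV.const_mul 2), integral_sub iB (iA.const_mul _), integral_const_mul,
    integral_const_mul, hvel]
  -- For `i ≠ j` the function is identically zero, and for `i = j` it is `2 * lam i`; in both cases
  -- the derivative of `lam i` alone describes it.
  have hval : ∀ δ : ℝ, δ = (if i = j then 1 else 0) →
      HasDerivAt (fun t => (lam i t + lam j t) * δ) (2 * (deriv (lam i) 0 * δ)) 0 := by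
    rintro δ hδ
    split_ifs at hδ with hij
    · subst hij hδ
      exact ((hdi.hasDerivAt.add hdi.hasDerivAt).mul_const 1).congr_deriv (by ring)
    · subst hδ
      simpa using hasDerivAt_const (0 : ℝ) (0 : ℝ)
  refine (hval _ rfl).congr_deriv ?_
  linear_combination 2 * hkey
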